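/- Let $k$ be a field, $X$ a noetherian smooth $k$-scheme, $n\ge 0$ an integer such that $X$ is smooth over $k$ of relative dimension $\le n$ near each of its points (for example $n=\dim X$), and assume that $n!$ is invertible in $k$. Let $w\in\Gamma(X,\mathcal O_X)$, write $\Omega=\Omega^1_{X/k}$, and consider curved modules of curvature $w$: $\mathbb Z/2$-graded $\mathcal O_X$-modules $\mathcal M=\mathcal M_0\oplus\mathcal M_1$ with an odd $\mathcal O_X$-linear $d$, $d^2=w$. Let $\mathcal E$ be a matrix factorization of $w$, i.e. a curved module with differential $e=(e_0,e_1)$ whose components are vector bundles, and let $\nabla_i:\mathcal E_i\to\Omega\otimes\mathcal E_i$ ($i=0,1$) be global connections. Put $[\nabla,e]=\nabla_{i+1}e_i-(1\otimes e_i)\nabla_i:\mathcal E_i\to\Omega\otimes\mathcal E_{i+1}$; it is $\mathcal O_X$-linear, and $\wedge[\nabla,e]^i:\mathcal E\to\Omega^i\otimes\mathcal E$ denotes its $i$-th power followed by the wedge product of forms. **Notation.** * $\Omega_{dw}\otimes\mathcal E$ is $\bigoplus_q\Omega^q\otimes\mathcal E$ with differential $dw\wedge(-)+(-1)^q(1\otimes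 e)$ on the $q$-th summand, and $\Omega_{dw}$ is $\bigoplus_q\Omega^q$ with differential $dw\wedge(-)$, graded by the parity of $q$. * $J^1(\mathcal M)=(\mathcal O_X\otimes_k\mathcal O_X/I^2)\otimes_{\mathcal O_X}\mathcal M$ (with $I$ the kernel of multiplication) is the sheaf of first jets with its left $\mathcal O_X$-structure, $\varepsilon:J^1(\mathcal M)\to\mathcal M$ is the projection $a\otimes s\mapsto as$, and $\iota:\Omega\otimes\mathcal M\to J^1(\mathcal M)$ is $da\otimes s\mapsto a\otimes s-1\otimes as$. * $\mathcal At(\mathcal E)$ is the curved module $\bigoplus_{q=0}^{n}\mathcal A_q$ with $\mathcal A_q=\Omega^{\otimes q}\otimes J^1(\mathcal E)$ for $q<n$ and $\mathcal A_n=\Omega^{\otimes n}\otimes\mathcal E$. Its differential is the sum of: the operator $B_{dw}:\mathcal A_q\to\mathcal A_{q+1}$ ($q<n$), inserting $dw$ by $\omega_1\otimes\dots\otimes\omega_q\otimes s\mapsto\sum_{j=0}^q(-1)^j\omega_1\otimes\dots\otimes\omega_j\otimes dw\otimes\omega_{j+1}\otimes\dots\otimes\omega_q\otimes s$ (followed by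 $\varepsilon$ if $q+1=n$); the operator $(-1)^{q}m:\mathcal A_{q+1}\to\mathcal A_q$, $m(\omega_1\otimes\dots\otimes\omega_{q+1}\otimes s)=\omega_1\otimes\dots\otimes\omega_q\otimes\iota(\omega_{q+1}\otimes\varepsilon s)$ (with $\varepsilon$ read as the identity on $\mathcal A_n$); and $(-1)^q$ times the map induced by $e$ on $\mathcal A_q$. Let $\pi:\mathcal At(\mathcal E)\to\mathcal E$ be induced by $\varepsilon$ on $\mathcal A_0$, and $\Lambda=\sum_{q=0}^n\frac{\wedge}{q!}:\mathcal At(\mathcal E)\to\Omega_{dw}\otimes\mathcal E$, $\wedge(\omega_1\otimes\dots\otimes\omega_q\otimes s)=\omega_1\wedge\dots\wedge\omega_q\otimes\varepsilon s$. * The coderived category $D^{co}$ is the quotient of the homotopy category of quasi-coherent curved modules by the smallest triangulated subcategory that contains the total curved modules of short exact sequences and is closed under direct sums. * $\mathcal B(\mathcal E)$ is the curved bar complex of $\mathcal E$: it has $\mathcal O_X^{\otimes_k(q+1)}\otimes_k\mathcal E$ in degree $q\ge0$, it is regarded as a presheaf on the affine opens, and it is totalized by direct products. Its differential is the sum of the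 bar differential, of $a_0\otimes\dots\otimes a_q\otimes x\mapsto\sum_{j=0}^q(-1)^ja_0\otimes\dots\otimes a_j\otimes w\otimes a_{j+1}\otimes\dots\otimes a_q\otimes x$, and of $(-1)^q$ times the map induced by $e$. Let $\lambda:\mathcal B(\mathcal E)\otimes\mathcal E^\vee\to\mathcal E\otimes\mathcal E^\vee\cong\mathcal Hom(\mathcal E,\mathcal E)$ be induced by $a_0\otimes x\mapsto a_0x$ in degree $q=0$, and let $h:\mathcal B(\mathcal E)\otimes\mathcal E^\vee\to\Omega_{dw}$ be the composite of the maps $a_0\otimes\dots\otimes a_q\otimes x\mapsto\frac1{q!}\,a_0\,da_1\wedge\dots\wedge da_q\otimes x$ ($q\le n$; zero for $q>n$) with the contraction $(\omega\otimes x)\otimes\xi\mapsto(-1)^{|x|}\xi(x)\,\omega$. * $D(X)$ is the derived category of $\mathbb Z/2$-graded complexes on $X$: complexes of presheaves of $\mathcal O_X$-modules on the affine opens are localized at the morphisms inducing isomorphisms on cohomology sheaves. **Claim.** 1. The map $\varphi=\sum_{i=0}^{n}\frac{\wedge[\nabla,e]^i}{i!}:\mathcal E\to\Omega_{dw}\otimes\mathcal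 E$ is a closed degree $0$ morphism of $w$-curved modules. 2. $\mathcal At(\mathcal E)$ and $\Omega_{dw}\otimes\mathcal E$ are quasi-coherent, $\pi$ has coacyclic cone, $\Lambda$ is a closed morphism, and the morphism $\mathcal Exp(at(\mathcal E)):\mathcal E\to\Omega_{dw}\otimes\mathcal E$ of $D^{co}$ defined by the roof $\mathcal E\xleftarrow{\ \pi\ }\mathcal At(\mathcal E)\xrightarrow{\ \Lambda\ }\Omega_{dw}\otimes\mathcal E$ is the image of $\varphi$. 3. $\lambda$ is a quasi-isomorphism and the map defining $h$ is closed, so that the roof $\mathcal Hom(\mathcal E,\mathcal E)\xleftarrow{\ \lambda\ }\mathcal B(\mathcal E)\otimes\mathcal E^\vee\xrightarrow{\ h\ }\Omega_{dw}$ defines the boundary bulk map $\mathcal T_{\mathcal E}:\mathcal Hom(\mathcal E,\mathcal E)\to\Omega_{dw}$ in $D(X)$; the supertrace $\mathrm{str}(\varphi)$ (the alternating sum of the traces of the components $\mathcal E_i\to\Omega^{\mathrm{even}}\otimes\mathcal E_i$ of $\varphi$) is a closed global section of $\Omega_{dw}$; and the Chern character $ch(\mathcal E)=\mathcal T_{\mathcal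 E}(\mathrm{id}_{\mathcal E})$, as a morphism $\mathcal O_X\to\Omega_{dw}$ in $D(X)$, that is, a class in $H^0\mathbb R\Gamma(\Omega_{dw})$, is the class of $$\mathrm{str}(\varphi)=\mathrm{str}\Big(\sum_{i=0}^{n}\frac{[\nabla,e]^i}{i!}\Big).$$ -/

import Mathlib

set_option linter.unusedVariables false

open CategoryTheory TensorProduct

universe u

namespace CurvedSheaf

noncomputable section

/-! ### Presheaves of algebras and of modules on a preordered set

In the application the preordered set is the set of affine opens of a scheme. -/

/-- A presheaf of commutative `k`-algebras on the preordered set `C`. -/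
structure AlgPresheaf (k : Type u) [Field k] (C : Type u) [Preorder C] where
  ring : C → Type u
  [commRing : ∀ U, CommRing (ring U)]
  [algebra : ∀ U, Algebra k (ring U)]
  res : ∀ {U V : C}, V ≤ U → (ring U →ₐ[k] ring V)
  res_id : ∀ (U : C) (a : ring U), res (le_refl U) a = a
  res_comp : ∀ {U V W : C} (h : V ≤ U) (h' : W ≤ V) (a : ring U),
    res h' (res h a) = res (h'.trans h) a

attribute [instance] AlgPresheaf.commRing AlgPresheaf.algebra

variable {k : Type u} [Field k] {C : Type u} [Preorder C]

/-- A presheaf of modules over a presheaf of `k`-algebras. -/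
structure PMod (O : AlgPresheaf k C) where
  obj : C → Type u
  [addCommGroup : ∀ U, AddCommGroup (obj U)]
  [module : ∀ U, Module (O.ring U) (obj U)]
  res : ∀ {U V : C}, V ≤ U → (obj U →+ obj V)
  res_smul : ∀ {U V : C} (h : V ≤ U) (a : O.ring U) (x : obj U),
    res h (a • x) = O.res h a • res h x
  res_id : ∀ (U : C) (x : obj U), res (le_refl U) x = x
  res_comp : ∀ {U V W : C} (h : V ≤ U) (h' : W ≤ V) (x : obj U),
    res h' (res h x) = res (h'.trans h) x

attribute [instance] PMod.addCommGroup PMod.module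

variable {O : AlgPresheaf k C}

namespace PMod

/-- The `k`-vector space structure underlying the sections of a presheaf of modules. -/
instance kModule (M : PMod O) (U : C) : Module k (M.obj U) :=
  Module.compHom (M.obj U) (algebraMap k (O.ring U))

instance kTower (M : PMod O) (U : C) : IsScalarTower k (O.ring U) (M.obj U) where
  smul_assoc c a x := by
    change (c • a) • x = (algebraMap k (O.ring U) c) • (a • x)
    rw [Algebra.smul_def, mul_smul]

lemma k_smul (M : PMod O) (U : C) (c : k) (x : M.obj U) :
    c • x = (algebraMap k (O.ring U) c) • x := rfl

lemma res_k_smul (M : PMod O) {U V : C} (h : V ≤ U) (c : k) (x : M.obj U) :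
    M.res h (c • x) = c • M.res h x := by
  rw [k_smul, M.res_smul, AlgHom.commutes, k_smul]

/-- Morphisms of presheaves of modules. -/
@[ext]
structure Hom (M N : PMod O) where
  app : ∀ U, M.obj U →ₗ[O.ring U] N.obj U
  naturality : ∀ {U V : C} (h : V ≤ U) (x : M.obj U),
    app V (M.res h x) = N.res h (app U x)

instance : Category (PMod O) where
  Hom M N := Hom M N
  id M := ⟨fun _ => LinearMap.id, fun _ _ => rfl⟩
  comp f g := ⟨fun U => (g.app U).comp (f.app U), fun h x => by
    simp only [LinearMap.comp_apply, f.naturality, g.naturality]⟩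

lemma hom_nat {M N : PMod O} (f : M ⟶ N) {U V : C} (h : V ≤ U) (x : M.obj U) :
    f.app V (M.res h x) = N.res h (f.app U x) := f.naturality h x

lemma hom_ext' {M N : PMod O} {f g : M ⟶ N} (h : ∀ U (x : M.obj U), f.app U x = g.app U x) :
    f = g := Hom.ext (funext fun U => LinearMap.ext (h U))

@[simp] lemma id_app (M : PMod O) (U : C) (x : M.obj U) : (𝟙 M : M ⟶ M).app U x = x := rfl
@[simp] lemma comp_app {M N P : PMod O} (f : M ⟶ N) (g : N ⟶ P) (U : C) (x : M.obj U) :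
    (f ≫ g).app U x = g.app U (f.app U x) := rfl

instance (M N : PMod O) : Zero (M ⟶ N) := ⟨⟨fun _ => 0, fun h x => by simp⟩⟩
instance (M N : PMod O) : Add (M ⟶ N) :=
  ⟨fun f g => ⟨fun U => f.app U + g.app U, fun h x => by simp [hom_nat]⟩⟩
instance (M N : PMod O) : Neg (M ⟶ N) :=
  ⟨fun f => ⟨fun U => -f.app U, fun h x => by simp [hom_nat]⟩⟩
instance (M N : PMod O) : Sub (M ⟶ N) :=
  ⟨fun f g => ⟨fun U => f.app U - g.app U, fun h x => by simp [hom_nat]⟩⟩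

@[simp] lemma zero_app (M N : PMod O) (U : C) (x : M.obj U) : (0 : M ⟶ N).app U x = 0 := rfl
@[simp] lemma add_app {M N : PMod O} (f g : M ⟶ N) (U : C) (x : M.obj U) :
    (f + g).app U x = f.app U x + g.app U x := rfl
@[simp] lemma neg_app {M N : PMod O} (f : M ⟶ N) (U : C) (x : M.obj U) :
    (-f).app U x = -f.app U x := rfl
@[simp] lemma sub_app {M N : PMod O} (f g : M ⟶ N) (U : C) (x : M.obj U) :
    (f - g).app U x = f.app U x - g.app U x := rfl

instance (M N : PMod O) : AddCommGroup (M ⟶ N) where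
  add_assoc f g h := hom_ext' fun U x => by simp [add_assoc]
  zero_add f := hom_ext' fun U x => by simp
  add_zero f := hom_ext' fun U x => by simp
  add_comm f g := hom_ext' fun U x => by simp [add_comm]
  neg_add_cancel f := hom_ext' fun U x => by simp
  sub_eq_add_neg f g := hom_ext' fun U x => by simp [sub_eq_add_neg]
  nsmul := nsmulRec
  zsmul := zsmulRec

instance : Preadditive (PMod O) where
  add_comp _ _ _ f g h := hom_ext' fun U x => by simp
  comp_add _ _ _ f g h := hom_ext' fun U x => by simp

/-- Multiplication of a morphism by a scalar of the ground field. -/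
def csmul {M N : PMod O} (c : k) (f : M ⟶ N) : M ⟶ N :=
  ⟨fun U => (algebraMap k (O.ring U) c) • f.app U, fun h x => by
    simp [hom_nat, res_k_smul]⟩

@[simp] lemma csmul_app {M N : PMod O} (c : k) (f : M ⟶ N) (U : C) (x : M.obj U) :
    (csmul c f).app U x = c • f.app U x := rfl

end PMod

/-- A global section of `O`: a compatible family of elements. -/
structure GlobalFun (O : AlgPresheaf k C) where
  val : ∀ U, O.ring U
  res_val : ∀ {U V : C} (h : V ≤ U), O.res h (val U) = val V

instance : Zero (GlobalFun O) := ⟨⟨fun _ => 0, fun _ => map_zero _⟩⟩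
instance : Neg (GlobalFun O) := ⟨fun w => ⟨fun U => -w.val U, fun _ => by
  rw [map_neg, w.res_val]⟩⟩

@[simp] lemma GlobalFun.zero_val (U : C) : (0 : GlobalFun O).val U = 0 := rfl
@[simp] lemma GlobalFun.neg_val (w : GlobalFun O) (U : C) : (-w).val U = -w.val U := rfl

/-- Multiplication by a global section, as an endomorphism of a presheaf of modules. -/
def GlobalFun.mul (w : GlobalFun O) (M : PMod O) : M ⟶ M :=
  ⟨fun U => w.val U • LinearMap.id, fun h x => by simp [M.res_smul, w.res_val]⟩

@[simp] lemma GlobalFun.mul_app (w : GlobalFun O) (M : PMod O) (U : C) (x : M.obj U) :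
    (w.mul M).app U x = w.val U • x := rfl

namespace PMod

/-- The structure presheaf as a presheaf of modules. -/
def unit (O : AlgPresheaf k C) : PMod O where
  obj U := O.ring U
  res h := (O.res h : _ →+ _)
  res_smul h a x := map_mul (O.res h) a x
  res_id U x := O.res_id U x
  res_comp h h' x := O.res_comp h h' x

/-- The zero presheaf of modules. -/
def zero (O : AlgPresheaf k C) : PMod O where
  obj _ := PUnit
  res _ := 0
  res_smul _ _ _ := rfl
  res_id _ _ := rfl
  res_comp _ _ _ := rfl

/-- The direct sum of two presheaves of modules. -/
def prod (M N : PMod O) : PMod O where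
  obj U := M.obj U × N.obj U
  res h := (M.res h).prodMap (N.res h)
  res_smul h a x := Prod.ext (M.res_smul h a x.1) (N.res_smul h a x.2)
  res_id U x := Prod.ext (M.res_id U x.1) (N.res_id U x.2)
  res_comp h h' x := Prod.ext (M.res_comp h h' x.1) (N.res_comp h h' x.2)

/-- The product of a family of presheaves of modules. -/
def pi (F : ℕ → PMod O) : PMod O where
  obj U := ∀ j, (F j).obj U
  res h := AddMonoidHom.mk' (fun x j => (F j).res h (x j)) fun x y => by ext j; simp
  res_smul h a x := by ext j; simp [res_smul]
  res_id U x := by ext j; simp [res_id]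
  res_comp h h' x := by ext j; simp [res_comp]

/-! #### Tensor products over `O` -/

section SemiTens

variable {R R' M N M' N' : Type u} [CommRing R] [CommRing R'] [AddCommGroup M] [AddCommGroup N]
  [AddCommGroup M'] [AddCommGroup N'] [Module R M] [Module R N] [Module R' M'] [Module R' N']

/-- The tensor product of two semilinear maps. -/
def semiTens (σ : R → R') (f : M →+ M') (g : N →+ N') (hf : ∀ r x, f (r • x) = σ r • f x)
    (hg : ∀ r x, g (r • x) = σ r • g x) : M ⊗[R] N →+ M' ⊗[R'] N' :=
  TensorProduct.liftAddHom
    (AddMonoidHom.mk' (fun a => AddMonoidHom.mk' (fun b => f a ⊗ₜ[R'] g b)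
      fun b b' => by rw [map_add, tmul_add])
      fun a a' => by ext b; simp only [AddMonoidHom.mk'_apply, AddMonoidHom.add_apply, map_add,
        add_tmul])
    fun r a b => by simp only [AddMonoidHom.mk'_apply, hf, hg, smul_tmul]

lemma semiTens_tmul (σ : R → R') (f : M →+ M') (g : N →+ N')
    (hf : ∀ r x, f (r • x) = σ r • f x) (hg : ∀ r x, g (r • x) = σ r • g x) (a : M) (b : N) :
    semiTens σ f g hf hg (a ⊗ₜ[R] b) = f a ⊗ₜ[R'] g b := rfl

end SemiTens

/-- The sectionwise tensor product. -/
def tens (K M : PMod O) : PMod O where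
  obj U := K.obj U ⊗[O.ring U] M.obj U
  res h := semiTens (O.res h) (K.res h) (M.res h) (K.res_smul h) (M.res_smul h)
  res_smul {U V} h a x := by
    induction x using TensorProduct.induction_on with
    | zero => rw [smul_zero, map_zero, smul_zero]
    | tmul x y => rw [smul_tmul', semiTens_tmul, semiTens_tmul, res_smul, smul_tmul']
    | add x y hx hy => rw [smul_add, map_add, map_add, hx, hy, smul_add]
  res_id U x := by
    induction x using TensorProduct.induction_on with
    | zero => rw [map_zero]
    | tmul x y => rw [semiTens_tmul, res_id, res_id]
    | add x y hx hy => rw [map_add, hx, hy]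
  res_comp h h' x := by
    induction x using TensorProduct.induction_on with
    | zero => rw [map_zero, map_zero, map_zero]
    | tmul x y => rw [semiTens_tmul, semiTens_tmul, semiTens_tmul, res_comp, res_comp]
    | add x y hx hy => rw [map_add, map_add, map_add, hx, hy]

/-- The pure tensor `a ⊗ b` over `O`. -/
def tmk (K M : PMod O) (U : C) (a : K.obj U) (b : M.obj U) : (tens K M).obj U :=
  a ⊗ₜ[O.ring U] b

@[simp] lemma tens_res (K M : PMod O) {U V : C} (h : V ≤ U) (a : K.obj U) (b : M.obj U) :
    (tens K M).res h (tmk K M U a b) = tmk K M V (K.res h a) (M.res h b) := rfl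

lemma tmk_smul_left (K M : PMod O) (U : C) (r : O.ring U) (a : K.obj U) (b : M.obj U) :
    tmk K M U (r • a) b = r • tmk K M U a b := rfl

lemma tmk_smul_right (K M : PMod O) (U : C) (r : O.ring U) (a : K.obj U) (b : M.obj U) :
    tmk K M U a (r • b) = r • tmk K M U a b := tmul_smul r a b

lemma tmk_add_left (K M : PMod O) (U : C) (a a' : K.obj U) (b : M.obj U) :
    tmk K M U (a + a') b = tmk K M U a b + tmk K M U a' b := add_tmul a a' b

lemma tmk_add_right (K M : PMod O) (U : C) (a : K.obj U) (b b' : M.obj U) :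
    tmk K M U a (b + b') = tmk K M U a b + tmk K M U a b' := tmul_add a b b'

lemma tmk_sub_right (K M : PMod O) (U : C) (a : K.obj U) (b b' : M.obj U) :
    tmk K M U a (b - b') = tmk K M U a b - tmk K M U a b' := tmul_sub a b b'

lemma tmk_zero_right (K M : PMod O) (U : C) (a : K.obj U) :
    tmk K M U a 0 = 0 := tmul_zero _ a

lemma tmk_neg_right (K M : PMod O) (U : C) (a : K.obj U) (b : M.obj U) :
    tmk K M U a (-b) = -tmk K M U a b := tmul_neg a b

/-- Additive induction over pure tensors. -/
lemma tens_induction {K M : PMod O} {U : C} {p : (tens K M).obj U → Prop}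
    (t : (tens K M).obj U) (h : ∀ a b, p (tmk K M U a b)) (h0 : p 0)
    (hadd : ∀ s t, p s → p t → p (s + t)) : p t :=
  TensorProduct.induction_on (motive := p) t h0 h hadd

lemma tens_hom_ext {K M N : PMod O} {f g : tens K M ⟶ N}
    (h : ∀ U a b, f.app U (tmk K M U a b) = g.app U (tmk K M U a b)) : f = g :=
  hom_ext' fun U x => tens_induction (p := fun x => f.app U x = g.app U x) x (h U) (by simp)
    fun s t hs ht => by rw [map_add, map_add, hs, ht]

/-- The linear map out of a tensor product defined by a bilinear map. -/
def tliftApp {K M N : PMod O} {U : C} (f : K.obj U →ₗ[O.ring U] M.obj U →ₗ[O.ring U] N.obj U) :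
    (tens K M).obj U →ₗ[O.ring U] N.obj U := TensorProduct.lift f

/-- A morphism out of a tensor product from a natural bilinear map. -/
def tlift {K M N : PMod O} (f : ∀ U, K.obj U →ₗ[O.ring U] M.obj U →ₗ[O.ring U] N.obj U)
    (hf : ∀ {U V : C} (h : V ≤ U) (a : K.obj U) (b : M.obj U),
      f V (K.res h a) (M.res h b) = N.res h (f U a b)) : tens K M ⟶ N where
  app U := tliftApp (f U)
  naturality {U V} h x := tens_induction
    (p := fun x => tliftApp (f V) ((tens K M).res h x) = N.res h (tliftApp (f U) x)) x
    (fun a b => hf h a b) (by simp) fun s t hs ht => by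
      rw [map_add, map_add, map_add, map_add, hs, ht]

@[simp] lemma tlift_app {K M N : PMod O}
    (f : ∀ U, K.obj U →ₗ[O.ring U] M.obj U →ₗ[O.ring U] N.obj U)
    (hf : ∀ {U V : C} (h : V ≤ U) (a : K.obj U) (b : M.obj U),
      f V (K.res h a) (M.res h b) = N.res h (f U a b)) (U : C) (a : K.obj U) (b : M.obj U) :
    (tlift f hf).app U (tmk K M U a b) = f U a b := rfl

/-- The natural bilinear map `(a, b) ↦ a ⊗ b`. -/
def tmkₗ (K M : PMod O) (U : C) :
    K.obj U →ₗ[O.ring U] M.obj U →ₗ[O.ring U] (tens K M).obj U :=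
  LinearMap.mk₂ _ (tmk K M U) (tmk_add_left K M U) (tmk_smul_left K M U)
    (tmk_add_right K M U) (tmk_smul_right K M U)

@[simp] lemma tmkₗ_apply (K M : PMod O) (U : C) (a : K.obj U) (b : M.obj U) :
    tmkₗ K M U a b = tmk K M U a b := rfl

/-- The tensor product of two morphisms. -/
def tmap {K K' M M' : PMod O} (f : K ⟶ K') (g : M ⟶ M') : tens K M ⟶ tens K' M' :=
  tlift (fun U => (tmkₗ K' M' U).compl₁₂ (f.app U) (g.app U)) fun h a b => by
    simp [hom_nat]

@[simp] lemma tmap_app {K K' M M' : PMod O} (f : K ⟶ K') (g : M ⟶ M') (U : C)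
    (a : K.obj U) (b : M.obj U) :
    (tmap f g).app U (tmk K M U a b) = tmk K' M' U (f.app U a) (g.app U b) := rfl

/-! #### Kähler differentials -/

section Kaehler

variable {R R' : Type u} [CommRing R] [CommRing R'] [Algebra k R] [Algebra k R']

/-- The map induced on Kähler differentials by a homomorphism of algebras. -/
def kaehlerMap (φ : R →ₐ[k] R') : Ω[R⁄k] →+ Ω[R'⁄k] :=
  letI : Algebra R R' := φ.toRingHom.toAlgebra
  haveI : IsScalarTower k R R' := IsScalarTower.of_algebraMap_eq fun c => (φ.commutes c).symm
  (KaehlerDifferential.map k k R R').toAddMonoidHom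

lemma kaehlerMap_smul (φ : R →ₐ[k] R') (r : R) (ω : Ω[R⁄k]) :
    kaehlerMap φ (r • ω) = φ r • kaehlerMap φ ω := by
  let _ : Algebra R R' := φ.toRingHom.toAlgebra
  have _ : IsScalarTower k R R' := IsScalarTower.of_algebraMap_eq fun c => (φ.commutes c).symm
  refine ((KaehlerDifferential.map k k R R').map_smul r ω).trans ?_
  rw [algebra_compatible_smul R' r]
  rfl

lemma kaehlerMap_D (φ : R →ₐ[k] R') (r : R) :
    kaehlerMap φ (KaehlerDifferential.D k R r) = KaehlerDifferential.D k R' (φ r) := by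
  let _ : Algebra R R' := φ.toRingHom.toAlgebra
  have _ : IsScalarTower k R R' := IsScalarTower.of_algebraMap_eq fun c => (φ.commutes c).symm
  exact KaehlerDifferential.map_D k k R R' r

lemma kaehler_induction {p : Ω[R⁄k] → Prop} (ω : Ω[R⁄k])
    (hD : ∀ r a : R, p (r • KaehlerDifferential.D k R a)) (h0 : p 0)
    (hadd : ∀ s t, p s → p t → p (s + t)) : p ω := by
  have h : ω ∈ Submodule.span R (Set.range (KaehlerDifferential.D k R)) := by
    rw [KaehlerDifferential.span_range_derivation]; trivial
  induction h using Submodule.span_induction with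
  | mem x hx => obtain ⟨a, rfl⟩ := hx; simpa using hD 1 a
  | zero => exact h0
  | add x y _ _ hx hy => exact hadd x y hx hy
  | smul r x hx' hx =>
    clear hx
    induction hx' using Submodule.span_induction generalizing r with
    | mem x hx => obtain ⟨a, rfl⟩ := hx; exact hD r a
    | zero => simpa using h0
    | add x y _ _ hx hy => rw [smul_add]; exact hadd _ _ (hx r) (hy r)
    | smul s x _ hx => rw [smul_smul]; exact hx _

end Kaehler

/-- The presheaf `Ω` of Kähler differentials of `O` over `k`. -/
def Om (O : AlgPresheaf k C) : PMod O where
  obj U := Ω[O.ring U⁄k]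
  res h := kaehlerMap (O.res h)
  res_smul h a x := kaehlerMap_smul _ a x
  res_id U x := by
    refine kaehler_induction (p := fun x => kaehlerMap (O.res (le_refl U)) x = x) x
      (fun r a => ?_) (map_zero _) fun s t hs ht => by rw [map_add, hs, ht]
    rw [kaehlerMap_smul, kaehlerMap_D, O.res_id, O.res_id]
  res_comp h h' x := by
    refine kaehler_induction (p := fun x => kaehlerMap (O.res h') (kaehlerMap (O.res h) x) =
      kaehlerMap (O.res (h'.trans h)) x) x (fun r a => ?_) (by simp only [map_zero])
      fun s t hs ht => by rw [map_add, map_add, map_add, hs, ht]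
    simp only [kaehlerMap_smul, kaehlerMap_D, O.res_comp]

/-- The universal derivation `d : O → Ω`. -/
def dd (U : C) (a : O.ring U) : (Om O).obj U := KaehlerDifferential.D k (O.ring U) a

lemma dd_add (U : C) (a b : O.ring U) : dd U (a + b) = dd U a + dd U b :=
  map_add (KaehlerDifferential.D k (O.ring U)) a b

lemma dd_mul (U : C) (a b : O.ring U) : dd U (a * b) = a • dd U b + b • dd U a :=
  (KaehlerDifferential.D k (O.ring U)).leibniz a b

lemma dd_k_smul (U : C) (c : k) (a : O.ring U) :
    dd U (c • a) = (algebraMap k (O.ring U) c) • dd U a := by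
  refine ((KaehlerDifferential.D k (O.ring U)).map_smul c a).trans ?_
  rw [algebra_compatible_smul (O.ring U) c]
  rfl

lemma res_dd {U V : C} (h : V ≤ U) (a : O.ring U) :
    (Om O).res h (dd U a) = dd V (O.res h a) := kaehlerMap_D (O.res h) a

lemma Om_induction {U : C} {p : (Om O).obj U → Prop} (ω : (Om O).obj U)
    (hD : ∀ r a : O.ring U, p (r • dd U a)) (h0 : p 0)
    (hadd : ∀ s t, p s → p t → p (s + t)) : p ω := kaehler_induction (p := p) ω hD h0 hadd

/-- The one-form `dw`. -/
def dw (w : GlobalFun O) (U : C) : (Om O).obj U := dd U (w.val U)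

lemma res_dw (w : GlobalFun O) {U V : C} (h : V ≤ U) : (Om O).res h (dw w U) = dw w V := by
  rw [dw, res_dd, w.res_val, dw]

/-- The map `x ↦ dw ⊗ x`. -/
def dwTens (w : GlobalFun O) (M : PMod O) : M ⟶ tens (Om O) M where
  app U := tmkₗ (Om O) M U (dw w U)
  naturality h x := by simp [res_dw]

@[simp] lemma dwTens_app (w : GlobalFun O) (M : PMod O) (U : C) (x : M.obj U) :
    (dwTens w M).app U x = tmk (Om O) M U (dw w U) x := rfl

end PMod

namespace PMod

/-! #### The modules `O ⊗ₖ M` -/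

/-- The presheaf `U ↦ O(U) ⊗ₖ M(U)`, a module through the left factor. -/
def fr (M : PMod O) : PMod O where
  obj U := O.ring U ⊗[k] M.obj U
  res h := semiTens (R := k) (R' := k) id (O.res h : _ →+ _) (M.res h)
    (fun c x => map_smul (O.res h) c x) (fun c x => M.res_k_smul h c x)
  res_smul {U V} h a x := by
    induction x using TensorProduct.induction_on with
    | zero => rw [smul_zero, map_zero, smul_zero]
    | tmul x y => exact congrArg (· ⊗ₜ[k] M.res h y) (map_mul (O.res h) a x)
    | add x y hx hy => rw [smul_add, map_add, map_add, hx, hy, smul_add]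
  res_id U x := by
    induction x using TensorProduct.induction_on with
    | zero => rw [map_zero]
    | tmul x y => exact congrArg₂ (· ⊗ₜ[k] ·) (O.res_id U x) (M.res_id U y)
    | add x y hx hy => rw [map_add, hx, hy]
  res_comp h h' x := by
    induction x using TensorProduct.induction_on with
    | zero => rw [map_zero, map_zero, map_zero]
    | tmul x y => exact congrArg₂ (· ⊗ₜ[k] ·) (O.res_comp h h' x) (M.res_comp h h' y)
    | add x y hx hy => rw [map_add, map_add, map_add, hx, hy]

/-- The pure tensor `a ⊗ x` over `k`. -/
def fmk (M : PMod O) (U : C) (a : O.ring U) (x : M.obj U) : (fr M).obj U := a ⊗ₜ[k] x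

@[simp] lemma fr_res (M : PMod O) {U V : C} (h : V ≤ U) (a : O.ring U) (x : M.obj U) :
    (fr M).res h (fmk M U a x) = fmk M V (O.res h a) (M.res h x) := rfl

lemma fmk_smul (M : PMod O) (U : C) (r a : O.ring U) (x : M.obj U) :
    fmk M U (r * a) x = r • fmk M U a x := rfl

lemma fmk_one (M : PMod O) (U : C) (a : O.ring U) (x : M.obj U) :
    a • fmk M U 1 x = fmk M U a x := by rw [← fmk_smul, mul_one]

lemma fmk_add_left (M : PMod O) (U : C) (a b : O.ring U) (x : M.obj U) :
    fmk M U (a + b) x = fmk M U a x + fmk M U b x := add_tmul a b x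

lemma fmk_add_right (M : PMod O) (U : C) (a : O.ring U) (x y : M.obj U) :
    fmk M U a (x + y) = fmk M U a x + fmk M U a y := tmul_add a x y

lemma fmk_sub_right (M : PMod O) (U : C) (a : O.ring U) (x y : M.obj U) :
    fmk M U a (x - y) = fmk M U a x - fmk M U a y := tmul_sub a x y

lemma fmk_zero_right (M : PMod O) (U : C) (a : O.ring U) :
    fmk M U a 0 = 0 := tmul_zero _ a

lemma fmk_k_smul_right (M : PMod O) (U : C) (c : k) (a : O.ring U) (x : M.obj U) :
    fmk M U a (c • x) = c • fmk M U a x := by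
  have h : (a ⊗ₜ[k] (c • x) : O.ring U ⊗[k] M.obj U) = (c • a) ⊗ₜ[k] x := (smul_tmul c a x).symm
  rw [Algebra.smul_def] at h
  exact h

lemma fmk_k_smul_left (M : PMod O) (U : C) (c : k) (a : O.ring U) (x : M.obj U) :
    fmk M U (c • a) x = c • fmk M U a x := by
  rw [Algebra.smul_def]; rfl

lemma fr_induction {M : PMod O} {U : C} {p : (fr M).obj U → Prop}
    (t : (fr M).obj U) (h : ∀ a x, p (fmk M U a x)) (h0 : p 0)
    (hadd : ∀ s t, p s → p t → p (s + t)) : p t :=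
  TensorProduct.induction_on (motive := p) t h0 h hadd

lemma fr_hom_ext {M N : PMod O} {f g : fr M ⟶ N}
    (h : ∀ U a x, f.app U (fmk M U a x) = g.app U (fmk M U a x)) : f = g :=
  hom_ext' fun U x => fr_induction (p := fun x => f.app U x = g.app U x) x (h U) (by simp)
    fun s t hs ht => by rw [map_add, map_add, hs, ht]

/-- The additive map `a ⊗ x ↦ a • f x`. -/
def fliftAdd {M N : PMod O} {U : C} (f : M.obj U →+ N.obj U)
    (hk : ∀ (c : k) (x : M.obj U), f (c • x) = c • f x) : (fr M).obj U →+ N.obj U :=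
  TensorProduct.liftAddHom (R := k)
    (AddMonoidHom.mk' (fun a : O.ring U => AddMonoidHom.mk' (fun x => a • f x)
      fun x y => by rw [map_add, smul_add])
      fun a b => by ext x; simp [add_smul])
    fun c a x => by
      simp only [AddMonoidHom.mk'_apply, hk]
      rw [k_smul, smul_smul, Algebra.smul_def, mul_comm]

/-- The `O`-linear morphism `a ⊗ x ↦ a • f x` defined by a natural `k`-linear map `f`. -/
def flift {M N : PMod O} (f : ∀ U, M.obj U →+ N.obj U)
    (hk : ∀ U (c : k) (x : M.obj U), f U (c • x) = c • f U x)
    (hn : ∀ {U V : C} (h : V ≤ U) (x : M.obj U), f V (M.res h x) = N.res h (f U x)) :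
    fr M ⟶ N where
  app U :=
    { toFun := fliftAdd (f U) (hk U)
      map_add' := map_add _
      map_smul' := fun r t => fr_induction
        (p := fun t => fliftAdd (f U) (hk U) (r • t) = r • fliftAdd (f U) (hk U) t) t
        (fun a x => by
          rw [← fmk_smul]
          exact mul_smul r a (f U x))
        (by simp) fun s t hs ht => by rw [smul_add, map_add, map_add, hs, ht, smul_add] }
  naturality {U V} h x := fr_induction
    (p := fun x => fliftAdd (f V) (hk V) ((fr M).res h x) = N.res h (fliftAdd (f U) (hk U) x)) x
    (fun a x => by
      change O.res h a • f V (M.res h x) = N.res h (a • f U x)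
      rw [hn, N.res_smul])
    (by simp) fun s t hs ht => by rw [map_add, map_add, map_add, map_add, hs, ht]

@[simp] lemma flift_app {M N : PMod O} (f : ∀ U, M.obj U →+ N.obj U)
    (hk : ∀ U (c : k) (x : M.obj U), f U (c • x) = c • f U x)
    (hn : ∀ {U V : C} (h : V ≤ U) (x : M.obj U), f V (M.res h x) = N.res h (f U x))
    (U : C) (a : O.ring U) (x : M.obj U) :
    (flift f hk hn).app U (fmk M U a x) = a • f U x := rfl

/-- `a ⊗ x ↦ a ⊗ f x`. -/
def frMap {M N : PMod O} (f : M ⟶ N) : fr M ⟶ fr N :=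
  flift (fun U => AddMonoidHom.mk' (fun x => fmk N U 1 (f.app U x))
    fun x y => by rw [map_add, fmk_add_right])
    (fun U c x => by
      simp only [AddMonoidHom.mk'_apply]
      rw [k_smul, map_smul, ← k_smul, fmk_k_smul_right])
    fun h x => by simp [hom_nat]

@[simp] lemma frMap_app {M N : PMod O} (f : M ⟶ N) (U : C) (a : O.ring U) (x : M.obj U) :
    (frMap f).app U (fmk M U a x) = fmk N U a (f.app U x) := fmk_one _ _ _ _

/-- The action map `a ⊗ x ↦ a x`. -/
def act (M : PMod O) : fr M ⟶ M :=
  flift (fun _ => AddMonoidHom.id _) (fun _ _ _ => rfl) fun _ _ => rfl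

@[simp] lemma act_app (M : PMod O) (U : C) (a : O.ring U) (x : M.obj U) :
    (act M).app U (fmk M U a x) = a • x := rfl

/-- Insertion of `w` in the second place, `a ⊗ x ↦ a ⊗ w ⊗ x`. -/
def insW (w : GlobalFun O) (M : PMod O) : fr M ⟶ fr (fr M) :=
  flift (fun U => AddMonoidHom.mk' (fun x => fmk (fr M) U 1 (fmk M U (w.val U) x))
    fun x y => by rw [fmk_add_right, fmk_add_right])
    (fun U c x => by
      simp only [AddMonoidHom.mk'_apply]
      rw [fmk_k_smul_right, fmk_k_smul_right])
    fun h x => by simp [w.res_val]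

@[simp] lemma insW_app (w : GlobalFun O) (M : PMod O) (U : C) (a : O.ring U) (x : M.obj U) :
    (insW w M).app U (fmk M U a x) = fmk (fr M) U a (fmk M U (w.val U) x) := fmk_one _ _ _ _

/-! #### First jets -/

/-- With `I` the kernel of `O ⊗ₖ O → O`, the submodule `I² (O ⊗ₖ M)` of `O ⊗ₖ M`; it is generated
by the elements `(a ⊗ 1 - 1 ⊗ a) (b ⊗ 1 - 1 ⊗ b) (1 ⊗ x)`. -/
def jetSub (M : PMod O) (U : C) : Submodule (O.ring U) ((fr M).obj U) :=
  Submodule.span (O.ring U) {t | ∃ (a b : O.ring U) (x : M.obj U),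
    t = fmk M U (a * b) x - fmk M U a (b • x) - fmk M U b (a • x) + fmk M U 1 ((a * b) • x)}

lemma jetSub_res (M : PMod O) {U V : C} (h : V ≤ U) {t : (fr M).obj U} (ht : t ∈ jetSub M U) :
    (fr M).res h t ∈ jetSub M V := by
  induction ht using Submodule.span_induction with
  | mem t ht =>
    obtain ⟨a, b, x, rfl⟩ := ht
    refine Submodule.subset_span ⟨O.res h a, O.res h b, M.res h x, ?_⟩
    simp only [map_add, map_sub, fr_res, map_mul, M.res_smul, map_one]
  | zero => rw [map_zero]; exact Submodule.zero_mem _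
  | add x y _ _ hx hy => rw [map_add]; exact Submodule.add_mem _ hx hy
  | smul r x _ hx => rw [(fr M).res_smul]; exact Submodule.smul_mem _ _ hx

/-- The additive map induced on jets by restriction. -/
def jetRes (M : PMod O) {U V : C} (h : V ≤ U) :
    ((fr M).obj U ⧸ jetSub M U) →+ ((fr M).obj V ⧸ jetSub M V) :=
  QuotientAddGroup.map (jetSub M U).toAddSubgroup (jetSub M V).toAddSubgroup ((fr M).res h)
    fun _ ht => jetSub_res M h ht

lemma jetRes_mk (M : PMod O) {U V : C} (h : V ≤ U) (t : (fr M).obj U) :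
    jetRes M h (Submodule.Quotient.mk t) = Submodule.Quotient.mk ((fr M).res h t) := rfl

/-- The presheaf of first jets `J¹(M) = (O ⊗ₖ O / I²) ⊗ M`, with the left module structure. -/
def jet (M : PMod O) : PMod O where
  obj U := (fr M).obj U ⧸ jetSub M U
  res h := jetRes M h
  res_smul h a x := by
    obtain ⟨t, rfl⟩ := Submodule.Quotient.mk_surjective _ x
    rw [← Submodule.Quotient.mk_smul, jetRes_mk, jetRes_mk, (fr M).res_smul,
      Submodule.Quotient.mk_smul]
  res_id U x := by
    obtain ⟨t, rfl⟩ := Submodule.Quotient.mk_surjective _ x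
    rw [jetRes_mk, (fr M).res_id]
  res_comp h h' x := by
    obtain ⟨t, rfl⟩ := Submodule.Quotient.mk_surjective _ x
    rw [jetRes_mk, jetRes_mk, jetRes_mk, (fr M).res_comp]

/-- The quotient map `O ⊗ₖ M → J¹(M)`. -/
def jmk (M : PMod O) : fr M ⟶ jet M where
  app U := (jetSub M U).mkQ
  naturality _ _ := rfl

lemma jmk_surjective (M : PMod O) (U : C) (x : (jet M).obj U) :
    ∃ t : (fr M).obj U, (jmk M).app U t = x := Submodule.Quotient.mk_surjective _ x

lemma jmk_rel (M : PMod O) (U : C) (a b : O.ring U) (x : M.obj U) :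
    (jmk M).app U (fmk M U (a * b) x) - (jmk M).app U (fmk M U a (b • x))
      - (jmk M).app U (fmk M U b (a • x)) + (jmk M).app U (fmk M U 1 ((a * b) • x)) = 0 := by
  rw [← map_sub, ← map_sub, ← map_add]
  exact (Submodule.Quotient.mk_eq_zero _).2 (Submodule.subset_span ⟨a, b, x, rfl⟩)

lemma jet_hom_ext {M N : PMod O} {f g : jet M ⟶ N}
    (h : ∀ U a x, f.app U ((jmk M).app U (fmk M U a x)) =
      g.app U ((jmk M).app U (fmk M U a x))) : f = g := by
  have h' : jmk M ≫ f = jmk M ≫ g := fr_hom_ext h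
  refine hom_ext' fun U x => ?_
  obtain ⟨t, rfl⟩ := jmk_surjective M U x
  exact congrArg (fun q : fr M ⟶ N => q.app U t) h'

/-- Morphisms out of the jets. -/
def jlift {M N : PMod O} (f : fr M ⟶ N)
    (hf : ∀ U (a b : O.ring U) (x : M.obj U),
      f.app U (fmk M U (a * b) x - fmk M U a (b • x) - fmk M U b (a • x) +
        fmk M U 1 ((a * b) • x)) = 0) : jet M ⟶ N where
  app U := (jetSub M U).liftQ (f.app U) (Submodule.span_le.2 (by
    rintro _ ⟨a, b, x, rfl⟩
    exact hf U a b x))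
  naturality h x := by
    obtain ⟨t, rfl⟩ := jmk_surjective M _ x
    exact hom_nat f h t

@[simp] lemma jlift_app {M N : PMod O} (f : fr M ⟶ N)
    (hf : ∀ U (a b : O.ring U) (x : M.obj U),
      f.app U (fmk M U (a * b) x - fmk M U a (b • x) - fmk M U b (a • x) +
        fmk M U 1 ((a * b) • x)) = 0) (U : C) (t : (fr M).obj U) :
    (jlift f hf).app U ((jmk M).app U t) = f.app U t := rfl

/-- Functoriality of the jets: `a ⊗ x ↦ a ⊗ f x`. -/
def jetMap {M N : PMod O} (f : M ⟶ N) : jet M ⟶ jet N :=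
  jlift (frMap f ≫ jmk N) fun U a b x => by
    simp only [comp_app, map_add, map_sub, frMap_app, map_smul]
    exact jmk_rel N U a b (f.app U x)

@[simp] lemma jetMap_app {M N : PMod O} (f : M ⟶ N) (U : C) (a : O.ring U) (x : M.obj U) :
    (jetMap f).app U ((jmk M).app U (fmk M U a x)) = (jmk N).app U (fmk N U a (f.app U x)) := by
  rw [jetMap, jlift_app, comp_app, frMap_app]

/-- The projection `ε : J¹(M) → M`, `a ⊗ x ↦ a x`. -/
def eps (M : PMod O) : jet M ⟶ M :=
  jlift (act M) fun U a b x => by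
    simp only [map_add, map_sub, act_app, one_mul, smul_smul, mul_comm b a]
    abel

@[simp] lemma eps_app (M : PMod O) (U : C) (a : O.ring U) (x : M.obj U) :
    (eps M).app U ((jmk M).app U (fmk M U a x)) = a • x := rfl

/-- The `O`-linear map `x ↦ a ⊗ x - 1 ⊗ a x` from `M` to `J¹(M)`. -/
def iotaFun (M : PMod O) (U : C) (a : O.ring U) : M.obj U →ₗ[O.ring U] (jet M).obj U where
  toFun x := (jmk M).app U (fmk M U a x) - (jmk M).app U (fmk M U 1 (a • x))
  map_add' x y := by
    simp only [smul_add, fmk_add_right, map_add]; abel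
  map_smul' c x := by
    have h := jmk_rel M U a c x
    rw [RingHom.id_apply, smul_sub, ← map_smul, ← map_smul, ← fmk_smul, ← fmk_smul, mul_one,
      smul_smul, mul_comm c a]
    rw [← sub_eq_zero, ← neg_eq_zero, ← h]
    abel

/-- The derivation `a ↦ (x ↦ a ⊗ x - 1 ⊗ a x)`. -/
def iotaDer (M : PMod O) (U : C) :
    Derivation k (O.ring U) (M.obj U →ₗ[O.ring U] (jet M).obj U) :=
  Derivation.mk'
    { toFun := iotaFun M U
      map_add' := fun a b => by
        ext x
        simp only [iotaFun, LinearMap.coe_mk, AddHom.coe_mk, LinearMap.add_apply, add_smul,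
          fmk_add_left, fmk_add_right, map_add]
        abel
      map_smul' := fun c a => by
        ext x
        simp only [iotaFun, LinearMap.coe_mk, AddHom.coe_mk, LinearMap.smul_apply,
          RingHom.id_apply, smul_assoc]
        rw [fmk_k_smul_left, fmk_k_smul_right, k_smul, k_smul, map_smul, map_smul, ← smul_sub,
          k_smul] }
    fun a b => by
      ext x
      have h := jmk_rel M U a b x
      simp only [iotaFun, LinearMap.coe_mk, AddHom.coe_mk, LinearMap.add_apply,
        LinearMap.smul_apply, smul_sub, ← map_smul, ← fmk_smul, mul_one, mul_comm b a]
      rw [← sub_eq_zero, ← neg_eq_zero, ← h]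
      abel

/-- The bilinear map `(da, x) ↦ a ⊗ x - 1 ⊗ a x`. -/
def iotaLin (M : PMod O) (U : C) :
    (Om O).obj U →ₗ[O.ring U] M.obj U →ₗ[O.ring U] (jet M).obj U :=
  (iotaDer M U).liftKaehlerDifferential

lemma iotaLin_dd (M : PMod O) (U : C) (a : O.ring U) :
    iotaLin M U (dd U a) = iotaFun M U a := (iotaDer M U).liftKaehlerDifferential_comp_D a

/-- The inclusion `ι : Ω ⊗ M → J¹(M)` of `I / I² ⊗ M`, `da ⊗ x ↦ a ⊗ x - 1 ⊗ a x`. -/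
def iota (M : PMod O) : tens (Om O) M ⟶ jet M :=
  tlift (iotaLin M) fun {U V} h ω x => by
    refine Om_induction (p := fun ω => iotaLin M V ((Om O).res h ω) (M.res h x) =
      (jet M).res h (iotaLin M U ω x)) ω (fun r a => ?_) (by simp) (fun s t hs ht => by
        simp only [map_add, LinearMap.add_apply] at hs ht ⊢
        rw [hs, ht])
    rw [(Om O).res_smul, res_dd, map_smul, map_smul, LinearMap.smul_apply, LinearMap.smul_apply,
      (jet M).res_smul, iotaLin_dd, iotaLin_dd]
    congr 1
    simp only [iotaFun, LinearMap.coe_mk, AddHom.coe_mk, map_sub, ← hom_nat, fr_res, map_one,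
      M.res_smul]

lemma iota_app (M : PMod O) (U : C) (a : O.ring U) (x : M.obj U) :
    (iota M).app U (tmk (Om O) M U (dd U a) x) =
      (jmk M).app U (fmk M U a x) - (jmk M).app U (fmk M U 1 (a • x)) :=
  congrArg (fun f : M.obj U →ₗ[O.ring U] (jet M).obj U => f x) (iotaLin_dd M U a)

lemma tens_Om_hom_ext {M N : PMod O} {f g : tens (Om O) M ⟶ N}
    (h : ∀ U a x, f.app U (tmk (Om O) M U (dd U a) x) = g.app U (tmk (Om O) M U (dd U a) x)) :
    f = g := tens_hom_ext fun U ω x => Om_induction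
      (p := fun ω => f.app U (tmk (Om O) M U ω x) = g.app U (tmk (Om O) M U ω x)) ω
      (fun r a => by rw [tmk_smul_left, map_smul, map_smul, h])
      (by
        have : tmk (Om O) M U 0 x = 0 := TensorProduct.zero_tmul _ x
        rw [this, map_zero, map_zero])
      fun s t hs ht => by rw [tmk_add_left, map_add, map_add, hs, ht]

lemma iota_eps (M : PMod O) : iota M ≫ eps M = 0 := tens_Om_hom_ext fun U a x => by
  rw [comp_app, iota_app, map_sub, eps_app, eps_app, one_smul, sub_self, zero_app]

lemma jetMap_eps {M N : PMod O} (f : M ⟶ N) : jetMap f ≫ eps N = eps M ≫ f :=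
  jet_hom_ext fun U a x => by
    simp only [comp_app, jetMap_app, eps_app, map_smul]

lemma tmap_iota {M N : PMod O} (f : M ⟶ N) :
    tmap (𝟙 (Om O)) f ≫ iota N = iota M ≫ jetMap f := tens_Om_hom_ext fun U a x => by
  simp only [comp_app, tmap_app, id_app, iota_app, map_sub, jetMap_app, map_smul]

end PMod

namespace PMod

/-! #### Mixed complexes -/

lemma to_zero {M : PMod O} (f g : M ⟶ zero O) : f = g := hom_ext' fun _ _ => rfl

/-- The map `ω ⊗ x ↦ ω ⊗ f x` on `Ω ⊗ M`. -/
def om {M N : PMod O} (f : M ⟶ N) : tens (Om O) M ⟶ tens (Om O) N := tmap (𝟙 (Om O)) f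

@[simp] lemma om_app {M N : PMod O} (f : M ⟶ N) (U : C) (a : (Om O).obj U) (b : M.obj U) :
    (om f).app U (tmk _ M U a b) = tmk _ N U a (f.app U b) := rfl

lemma om_id (M : PMod O) : om (𝟙 M) = 𝟙 _ := tens_hom_ext fun U a b => by simp
lemma om_comp {M N P : PMod O} (f : M ⟶ N) (g : N ⟶ P) : om (f ≫ g) = om f ≫ om g :=
  tens_hom_ext fun U a b => by simp
lemma om_zero (M N : PMod O) : om (0 : M ⟶ N) = 0 :=
  tens_hom_ext fun U a b => by simp [tmk_zero_right]
lemma om_neg {M N : PMod O} (f : M ⟶ N) : om (-f) = -om f :=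
  tens_hom_ext fun U a b => by simp [tmk_neg_right]
lemma om_add {M N : PMod O} (f g : M ⟶ N) : om (f + g) = om f + om g :=
  tens_hom_ext fun U a b => by simp [tmk_add_right]
lemma om_sub {M N : PMod O} (f g : M ⟶ N) : om (f - g) = om f - om g :=
  tens_hom_ext fun U a b => by simp [tmk_sub_right]
lemma om_mul (w : GlobalFun O) (M : PMod O) : om (w.mul M) = w.mul (tens (Om O) M) :=
  tens_hom_ext fun U a b => by simp [tmk_smul_right]

lemma dwTens_nat (w : GlobalFun O) {M N : PMod O} (f : M ⟶ N) :
    dwTens w M ≫ om f = f ≫ dwTens w N := hom_ext' fun U x => by simp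

lemma mul_nat (w : GlobalFun O) {M N : PMod O} (f : M ⟶ N) : f ≫ w.mul N = w.mul M ≫ f :=
  hom_ext' fun U x => by simp

lemma frMap_id (M : PMod O) : frMap (𝟙 M) = 𝟙 _ := fr_hom_ext fun U a b => by simp
lemma frMap_comp {M N P : PMod O} (f : M ⟶ N) (g : N ⟶ P) : frMap (f ≫ g) = frMap f ≫ frMap g :=
  fr_hom_ext fun U a b => by simp
lemma jetMap_id (M : PMod O) : jetMap (𝟙 M) = 𝟙 _ := jet_hom_ext fun U a b => by simp
lemma jetMap_comp {M N P : PMod O} (f : M ⟶ N) (g : N ⟶ P) :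
    jetMap (f ≫ g) = jetMap f ≫ jetMap g := jet_hom_ext fun U a b => by simp

end PMod

open PMod

/-- A sequence of endofunctors with operators raising and lowering the degree. The two operators
square to zero, and their anticommutator is the difference between the multiplication by `w` on the
values and the map induced by the multiplication by `w` on the argument. -/
structure Mixed (w : GlobalFun O) where
  obj : ℕ → PMod O → PMod O
  map : ∀ (q : ℕ) {M N : PMod O}, (M ⟶ N) → (obj q M ⟶ obj q N)
  map_id : ∀ (q : ℕ) (M : PMod O), map q (𝟙 M) = 𝟙 _
  map_comp : ∀ (q : ℕ) {M N P : PMod O} (f : M ⟶ N) (g : N ⟶ P),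
    map q (f ≫ g) = map q f ≫ map q g
  up : ∀ q M, obj q M ⟶ obj (q + 1) M
  down : ∀ q M, obj (q + 1) M ⟶ obj q M
  up_nat : ∀ (q : ℕ) {M N : PMod O} (f : M ⟶ N), map q f ≫ up q N = up q M ≫ map (q + 1) f
  down_nat : ∀ (q : ℕ) {M N : PMod O} (f : M ⟶ N),
    map (q + 1) f ≫ down q N = down q M ≫ map q f
  up_up : ∀ q M, up q M ≫ up (q + 1) M = 0
  down_down : ∀ q M, down (q + 1) M ≫ down q M = 0
  comm_zero : ∀ M, up 0 M ≫ down 0 M = w.mul (obj 0 M) - map 0 (w.mul M)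
  comm_succ : ∀ q M, up (q + 1) M ≫ down (q + 1) M + down q M ≫ up q M =
    w.mul (obj (q + 1) M) - map (q + 1) (w.mul M)

/-! ### The Atiyah complex -/

/-- The map `ω ⊗ a ↦ ι (ω ⊗ e a)`. -/
def iotaE {A M : PMod O} (e : A ⟶ M) : tens (Om O) A ⟶ jet M := om e ≫ iota M

/-- The map `x = ω ⊗ a ↦ dw ⊗ t x - ω ⊗ u a`. -/
def upS (w : GlobalFun O) {A B : PMod O} (t : tens (Om O) A ⟶ B) (u : A ⟶ B) :
    tens (Om O) A ⟶ tens (Om O) B := t ≫ dwTens w B - om u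

/-- The term of degree `q` of the Atiyah complex of length `n`: it is `Ω^{⊗ q} ⊗ J¹(M)` if `q < n`,
it is `Ω^{⊗ n} ⊗ M` if `q = n`, and it is zero if `q > n`. -/
def atObj : ℕ → ℕ → PMod O → PMod O
  | 0, 0, M => M
  | 0, _ + 1, _ => zero O
  | _ + 1, 0, M => jet M
  | n + 1, q + 1, M => tens (Om O) (atObj n q M)

/-- Functoriality of the terms of the Atiyah complex. -/
def atMap : ∀ (n q : ℕ) {M N : PMod O}, (M ⟶ N) → (atObj n q M ⟶ atObj n q N)
  | 0, 0, _, _, f => f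
  | 0, _ + 1, _, _, _ => 𝟙 (zero O)
  | _ + 1, 0, _, _, f => jetMap f
  | n + 1, q + 1, _, _, f => om (atMap n q f)

/-- The augmentation of the Atiyah complex. -/
def atEps : ∀ (n : ℕ) (M : PMod O), atObj n 0 M ⟶ M
  | 0, M => 𝟙 M
  | _ + 1, M => eps M

/-- The operator `(-1)^q m`, where
`m (ω₁ ⊗ ⋯ ⊗ ω_{q+1} ⊗ s) = ω₁ ⊗ ⋯ ⊗ ω_q ⊗ ι (ω_{q+1} ⊗ ε s)`. -/
def atDown : ∀ (n q : ℕ) (M : PMod O), atObj n (q + 1) M ⟶ atObj n q M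
  | 0, q, M => (0 : zero O ⟶ atObj 0 q M)
  | n + 1, 0, M => iotaE (atEps n M)
  | n + 1, q + 1, M => -om (atDown n q M)

/-- The projection from the Atiyah complex of length `n + 1` to the one of length `n`: it is the
identity in degrees less than `n`, it is `ε` in degree `n`, and it is zero in degree `n + 1`. -/
def atTrunc : ∀ (n q : ℕ) (M : PMod O), atObj (n + 1) q M ⟶ atObj n q M
  | 0, 0, M => eps M
  | 0, _ + 1, _ => 0
  | _ + 1, 0, M => 𝟙 (jet M)
  | n + 1, q + 1, M => om (atTrunc n q M)

/-- The operator `B_dw`, inserting `dw` in all places with alternating signs: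
`ω₁ ⊗ ⋯ ⊗ ω_q ⊗ s ↦ ∑ j, (-1)^j ω₁ ⊗ ⋯ ⊗ ω_j ⊗ dw ⊗ ω_{j+1} ⊗ ⋯ ⊗ ω_q ⊗ s`, followed by `ε` if it
ends in the degree `n`, and zero on the degree `n`. -/
def atUp (w : GlobalFun O) : ∀ (n q : ℕ) (M : PMod O), atObj n q M ⟶ atObj n (q + 1) M
  | 0, q, M => (0 : atObj 0 q M ⟶ zero O)
  | n + 1, 0, M => atTrunc n 0 M ≫ dwTens w _
  | n + 1, q + 1, M => upS w (atTrunc n (q + 1) M) (atUp w n q M)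

section

variable {w : GlobalFun O} {A B D A' B' D' M N P : PMod O}

lemma om_sq {a : A ⟶ B} {b : B ⟶ D} {c : A ⟶ B'} {d : B' ⟶ D} (h : a ≫ b = c ≫ d) :
    om a ≫ om b = om c ≫ om d := by rw [← om_comp, h, om_comp]

lemma om_sq_neg {a : A ⟶ B} {b : B ⟶ D} {c : A ⟶ B'} {d : B' ⟶ D} (h : a ≫ b = c ≫ d) :
    om a ≫ (-om b) = (-om c) ≫ om d := by
  rw [Preadditive.comp_neg, Preadditive.neg_comp, om_sq h]

lemma om_neg_sq {a : A ⟶ B} {b : B ⟶ D} {c : A ⟶ B'} {d : B' ⟶ D} (h : a ≫ b = c ≫ d) :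
    (-om a) ≫ om b = om c ≫ (-om d) := by
  rw [Preadditive.comp_neg, Preadditive.neg_comp, om_sq h]

lemma iotaE_nat {f' : A ⟶ B} {f : M ⟶ N} {e : A ⟶ M} {e' : B ⟶ N} (h : f' ≫ e' = e ≫ f) :
    om f' ≫ iotaE e' = iotaE e ≫ jetMap f := by
  rw [iotaE, iotaE, ← Category.assoc, ← om_comp, h, om_comp, Category.assoc, Category.assoc]
  exact congrArg _ (tmap_iota f)

lemma iotaE_pre {f : A ⟶ B} {e : B ⟶ M} {e' : A ⟶ M} (h : f ≫ e = e') :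
    om f ≫ iotaE e = iotaE e' := by
  rw [iotaE, iotaE, ← h, om_comp, Category.assoc]

lemma iotaE_eps (e : A ⟶ M) : iotaE e ≫ eps M = 0 := by
  rw [iotaE, Category.assoc, iota_eps, Limits.comp_zero]

lemma om_neg_iotaE {d : B ⟶ A} {e : A ⟶ M} (h : d ≫ e = 0) : (-om d) ≫ iotaE e = 0 := by
  rw [iotaE, Preadditive.neg_comp, ← Category.assoc, ← om_comp, h, om_zero, Limits.zero_comp,
    neg_zero]

lemma dw_nat {j : A ⟶ A'} {t' : A' ⟶ B'} {t : A ⟶ B} {f : B ⟶ B'} (h : j ≫ t' = t ≫ f) :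
    j ≫ t' ≫ dwTens w _ = (t ≫ dwTens w _) ≫ om f := by
  rw [Category.assoc, dwTens_nat, ← Category.assoc, h, Category.assoc]

lemma upS_nat {t : tens (Om O) A ⟶ B} {u : A ⟶ B} {t' : tens (Om O) A' ⟶ B'} {u' : A' ⟶ B'}
    {f : A ⟶ A'} {g : B ⟶ B'} (ht : om f ≫ t' = t ≫ g) (hu : f ≫ u' = u ≫ g) :
    om f ≫ upS w t' u' = upS w t u ≫ om g := by
  rw [upS, upS, Preadditive.comp_sub, Preadditive.sub_comp, Category.assoc, dwTens_nat,
    ← Category.assoc, ht, om_sq hu, Category.assoc]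

lemma upS_trunc {u' : A' ⟶ B'} {u : A ⟶ B} {t : A' ⟶ A} {t' : B' ⟶ B} {s : tens (Om O) A' ⟶ B'}
    {s' : tens (Om O) A ⟶ B} (h : s ≫ t' = om t ≫ s') (hu : u' ≫ t' = t ≫ u) :
    upS w s u' ≫ om t' = om t ≫ upS w s' u := by
  rw [upS, upS, Preadditive.comp_sub, Preadditive.sub_comp, om_sq hu, Category.assoc, dwTens_nat,
    ← Category.assoc, h, Category.assoc]

lemma dw_upS {t : P ⟶ A} {t' : tens (Om O) A ⟶ B} {u : A ⟶ B}
    (h : (t ≫ dwTens w A) ≫ t' = t ≫ u) : (t ≫ dwTens w A) ≫ upS w t' u = 0 := by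
  rw [upS, Preadditive.comp_sub, ← Category.assoc, h, Category.assoc, Category.assoc, dwTens_nat,
    sub_self]

lemma upS_upS {t : tens (Om O) A ⟶ B} {u : A ⟶ B} {t' : tens (Om O) B ⟶ D} {u' : B ⟶ D}
    (h : upS w t u ≫ t' = t ≫ u') (hu : u ≫ u' = 0) : upS w t u ≫ upS w t' u' = 0 := by
  rw [upS.eq_1 w t', Preadditive.comp_sub, ← Category.assoc, h, upS, Preadditive.sub_comp,
    ← om_comp, hu, om_zero, sub_zero, Category.assoc, Category.assoc, dwTens_nat, sub_self]

lemma upS_down_zero {t : tens (Om O) A ⟶ B} {u : A ⟶ B} {d : B ⟶ A} {d' : tens (Om O) A ⟶ P}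
    {s : P ⟶ A} (h : d' ≫ s = t ≫ d) {m : A ⟶ A} (hc : u ≫ d = w.mul A - m) :
    upS w t u ≫ (-om d) + d' ≫ s ≫ dwTens w A = w.mul _ - om m := by
  rw [upS, Preadditive.comp_neg, Preadditive.sub_comp, ← om_comp, hc, om_sub, om_mul,
    ← Category.assoc, h, Category.assoc, Category.assoc, dwTens_nat]
  abel

lemma upS_down_succ {t : tens (Om O) A ⟶ B} {u : A ⟶ B} {d : B ⟶ A} {d' : A ⟶ D}
    {s : tens (Om O) D ⟶ A} {v : D ⟶ A} (h : (-om d') ≫ s = t ≫ d) {m : A ⟶ A}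
    (hc : u ≫ d + d' ≫ v = w.mul A - m) :
    upS w t u ≫ (-om d) + (-om d') ≫ upS w s v = w.mul _ - om m := by
  rw [upS, upS, Preadditive.comp_sub, ← Category.assoc, h, ← om_mul, ← om_sub, ← hc, om_add,
    om_comp, om_comp, Preadditive.comp_neg, Preadditive.sub_comp, Category.assoc, Category.assoc,
    dwTens_nat, Preadditive.neg_comp]
  abel

end

lemma atMap_id : ∀ (n q : ℕ) (M : PMod O), atMap n q (𝟙 M) = 𝟙 _
  | 0, 0, _ => rfl
  | 0, _ + 1, _ => rfl
  | _ + 1, 0, M => jetMap_id M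
  | n + 1, q + 1, M => (congrArg om (atMap_id n q M)).trans (om_id _)

lemma atMap_comp : ∀ (n q : ℕ) {M N P : PMod O} (f : M ⟶ N) (g : N ⟶ P),
    atMap n q (f ≫ g) = atMap n q f ≫ atMap n q g
  | 0, 0, _, _, _, _, _ => rfl
  | 0, _ + 1, _, _, _, _, _ => to_zero _ _
  | _ + 1, 0, _, _, _, f, g => jetMap_comp f g
  | n + 1, q + 1, _, _, _, f, g => (congrArg om (atMap_comp n q f g)).trans (om_comp _ _)

lemma atEps_nat : ∀ (n : ℕ) {M N : PMod O} (f : M ⟶ N),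
    atMap n 0 f ≫ atEps n N = atEps n M ≫ f
  | 0, _, _, f => (Category.comp_id f).trans (Category.id_comp f).symm
  | _ + 1, _, _, f => jetMap_eps f

lemma atDown_nat : ∀ (n q : ℕ) {M N : PMod O} (f : M ⟶ N),
    atMap n (q + 1) f ≫ atDown n q N = atDown n q M ≫ atMap n q f
  | 0, _, _, _, _ => (Limits.comp_zero).trans (Limits.zero_comp).symm
  | n + 1, 0, _, _, f => iotaE_nat (atEps_nat n f)
  | n + 1, q + 1, _, _, f => om_sq_neg (atDown_nat n q f)

lemma atTrunc_nat : ∀ (n q : ℕ) {M N : PMod O} (f : M ⟶ N),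
    atMap (n + 1) q f ≫ atTrunc n q N = atTrunc n q M ≫ atMap n q f
  | 0, 0, _, _, f => jetMap_eps f
  | 0, _ + 1, _, _, _ => to_zero _ _
  | _ + 1, 0, _, _, f => (Category.comp_id (jetMap f)).trans (Category.id_comp (jetMap f)).symm
  | n + 1, q + 1, _, _, f => om_sq (atTrunc_nat n q f)

lemma atUp_nat (w : GlobalFun O) : ∀ (n q : ℕ) {M N : PMod O} (f : M ⟶ N),
    atMap n q f ≫ atUp w n q N = atUp w n q M ≫ atMap n (q + 1) f
  | 0, _, _, _, _ => to_zero _ _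
  | n + 1, 0, _, _, f => dw_nat (atTrunc_nat n 0 f)
  | n + 1, q + 1, _, _, f => upS_nat (atTrunc_nat n (q + 1) f) (atUp_nat w n q f)

lemma atDown_eps : ∀ (n : ℕ) (M : PMod O), atDown n 0 M ≫ atEps n M = 0
  | 0, _ => Limits.zero_comp
  | n + 1, M => iotaE_eps (atEps n M)

lemma atTrunc_eps : ∀ (n : ℕ) (M : PMod O), atTrunc n 0 M ≫ atEps n M = atEps (n + 1) M
  | 0, _ => Category.comp_id _
  | _ + 1, _ => Category.id_comp _

lemma atDown_down : ∀ (n q : ℕ) (M : PMod O), atDown n (q + 1) M ≫ atDown n q M = 0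
  | 0, _, _ => Limits.zero_comp
  | n + 1, 0, M => om_neg_iotaE (atDown_eps n M)
  | n + 1, q + 1, M => by
    have h : (-om (atDown n (q + 1) M)) ≫ (-om (atDown n q M)) = 0 := by
      rw [Preadditive.neg_comp, Preadditive.comp_neg, neg_neg, ← om_comp, atDown_down, om_zero]
    exact h

lemma atDown_trunc : ∀ (n q : ℕ) (M : PMod O),
    atDown (n + 1) q M ≫ atTrunc n q M = atTrunc n (q + 1) M ≫ atDown n q M
  | 0, 0, M => (atDown_eps 1 M).trans (Limits.zero_comp).symm
  | 0, _ + 1, _ => to_zero _ _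
  | n + 1, 0, M => (Category.comp_id (iotaE (atEps (n + 1) M))).trans
      (iotaE_pre (atTrunc_eps n M)).symm
  | n + 1, q + 1, M => om_neg_sq (atDown_trunc n q M)

lemma atUp_trunc (w : GlobalFun O) : ∀ (n q : ℕ) (M : PMod O),
    atUp w (n + 1) q M ≫ atTrunc n (q + 1) M = atTrunc n q M ≫ atUp w n q M
  | 0, _, _ => to_zero _ _
  | n + 1, 0, M => (Category.assoc (𝟙 (jet M)) (dwTens w (jet M)) (om (atTrunc n 0 M))).trans
      (congrArg (𝟙 (jet M) ≫ ·) (dwTens_nat w (atTrunc n 0 M)))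
  | n + 1, q + 1, M => upS_trunc rfl (atUp_trunc w n q M)

lemma atUp_up (w : GlobalFun O) : ∀ (n q : ℕ) (M : PMod O),
    atUp w n q M ≫ atUp w n (q + 1) M = 0
  | 0, _, _ => to_zero _ _
  | n + 1, 0, M => dw_upS (atUp_trunc w n 0 M)
  | n + 1, q + 1, M => upS_upS (atUp_trunc w n (q + 1) M) (atUp_up w n q M)

lemma atComm_zero (w : GlobalFun O) : ∀ (n : ℕ) (M : PMod O),
    atUp w n 0 M ≫ atDown n 0 M = w.mul (atObj n 0 M) - atMap n 0 (w.mul M)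
  | 0, _ => (Limits.zero_comp).trans (sub_self _).symm
  | n + 1, M => by
    have h : (atTrunc n 0 M ≫ dwTens w _) ≫ iotaE (atEps n M) =
        atEps (n + 1) M ≫ dwTens w _ ≫ iota M := by
      rw [iotaE, Category.assoc, ← Category.assoc (dwTens w _), dwTens_nat, ← atTrunc_eps]
      simp only [Category.assoc]
    refine h.trans (jet_hom_ext (f := eps M ≫ dwTens w _ ≫ iota M)
      (g := w.mul (jet M) - jetMap (w.mul M)) fun U a x => ?_)
    simp only [comp_app, sub_app, jetMap_app, GlobalFun.mul_app, eps_app, dwTens_app, dw]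
    rw [tmk_smul_right, map_smul, iota_app, smul_sub, ← map_smul, ← map_smul, ← fmk_smul,
      ← fmk_smul, mul_one, ← map_smul, ← fmk_smul, mul_comm]

lemma atComm_succ (w : GlobalFun O) : ∀ (n q : ℕ) (M : PMod O),
    atUp w n (q + 1) M ≫ atDown n (q + 1) M + atDown n q M ≫ atUp w n q M =
      w.mul (atObj n (q + 1) M) - atMap n (q + 1) (w.mul M)
  | 0, _, _ => to_zero _ _
  | n + 1, 0, M => upS_down_zero (atDown_trunc n 0 M) (atComm_zero w n M)
  | n + 1, q + 1, M => upS_down_succ (atDown_trunc n (q + 1) M) (atComm_succ w n q M)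

/-- The operators of the Atiyah complex of length `n`. -/
def atMixed (w : GlobalFun O) (n : ℕ) : Mixed w where
  obj q M := atObj n q M
  map q _ _ f := atMap n q f
  map_id q M := atMap_id n q M
  map_comp q _ _ _ f g := atMap_comp n q f g
  up q M := atUp w n q M
  down q M := atDown n q M
  up_nat q _ _ f := atUp_nat w n q f
  down_nat q _ _ f := atDown_nat n q f
  up_up q M := atUp_up w n q M
  down_down q M := atDown_down n q M
  comm_zero M := atComm_zero w n M
  comm_succ q M := atComm_succ w n q M

/-! ### The curved bar complex -/

/-- The iterated tensor product `O ⊗ₖ ⋯ ⊗ₖ O ⊗ₖ M` with `q` factors `O`. -/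
def barObj : ℕ → PMod O → PMod O
  | 0, M => M
  | q + 1, M => fr (barObj q M)

/-- Functoriality of the iterated tensor product. -/
def barMap : ∀ (q : ℕ) {M N : PMod O}, (M ⟶ N) → (barObj q M ⟶ barObj q N)
  | 0, _, _, f => f
  | q + 1, _, _, f => frMap (barMap q f)

/-- The map `a ⊗ t ↦ a t - a ⊗ d t`. -/
def bdS {A : PMod O} (d : fr A ⟶ A) : fr (fr A) ⟶ fr A := act (fr A) - frMap d

/-- The map `a ⊗ t ↦ a ⊗ w ⊗ t - a ⊗ u t`. -/
def buS (w : GlobalFun O) {A : PMod O} (u : A ⟶ fr A) : fr A ⟶ fr (fr A) :=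
  insW w A - frMap u

/-- The bar differential
`a₁ ⊗ ⋯ ⊗ a_{q+1} ⊗ x ↦ a₁ a₂ ⊗ ⋯ ⊗ x - a₁ ⊗ a₂ a₃ ⊗ ⋯ ⊗ x + ⋯ ± a₁ ⊗ ⋯ ⊗ a_q ⊗ a_{q+1} x`. -/
def barDown : ∀ (q : ℕ) (M : PMod O), barObj (q + 1) M ⟶ barObj q M
  | 0, M => act M
  | q + 1, M => bdS (barDown q M)

/-- The operator inserting `w`,
`a₁ ⊗ ⋯ ⊗ a_q ⊗ x ↦ a₁ ⊗ w ⊗ a₂ ⊗ ⋯ ⊗ x - a₁ ⊗ a₂ ⊗ w ⊗ ⋯ ⊗ x + ⋯ ± a₁ ⊗ ⋯ ⊗ a_q ⊗ w ⊗ x`. -/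
def barUp (w : GlobalFun O) : ∀ (q : ℕ) (M : PMod O), barObj q M ⟶ barObj (q + 1) M
  | 0, M => (0 : M ⟶ fr M)
  | q + 1, M => buS w (barUp w q M)

section

variable {w : GlobalFun O} {A B D M N P : PMod O}

lemma act_nat (f : M ⟶ N) : frMap f ≫ act N = act M ≫ f := fr_hom_ext fun U a x => by simp

lemma insW_nat (w : GlobalFun O) (f : M ⟶ N) : frMap f ≫ insW w N = insW w M ≫ frMap (frMap f) :=
  fr_hom_ext fun U a x => by simp

lemma frMap_sub (f g : M ⟶ N) : frMap (f - g) = frMap f - frMap g :=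
  fr_hom_ext fun U a x => by simp [fmk_sub_right]

lemma frMap_zero (M N : PMod O) : frMap (0 : M ⟶ N) = 0 :=
  fr_hom_ext fun U a x => by simp [fmk_zero_right]

lemma insW_act (w : GlobalFun O) (M : PMod O) :
    insW w M ≫ act (fr M) = w.mul (fr M) := fr_hom_ext fun U a x => by
  simp only [comp_app, insW_app, act_app, GlobalFun.mul_app]
  rw [← fmk_smul, ← fmk_smul, mul_comm]

lemma insW_frAct (w : GlobalFun O) (M : PMod O) :
    insW w M ≫ frMap (act M) = frMap (w.mul M) := fr_hom_ext fun U a x => by simp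

lemma insW_insW (w : GlobalFun O) (M : PMod O) :
    insW w M ≫ insW w (fr M) = insW w M ≫ frMap (insW w M) := fr_hom_ext fun U a x => by simp

lemma frMap_frMap {f : M ⟶ N} {g : N ⟶ P} (h : f ≫ g = 0) : frMap f ≫ frMap g = 0 := by
  rw [← frMap_comp, h, frMap_zero]

lemma act_act (M : PMod O) : act (fr M) ≫ act M = frMap (act M) ≫ act M :=
  fr_hom_ext fun U a t => fr_induction (p := fun t => (act (fr M) ≫ act M).app U (fmk _ U a t) =
    (frMap (act M) ≫ act M).app U (fmk _ U a t)) t (fun b x => by simp)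
    (by rw [fmk_zero_right, map_zero, map_zero]) fun s t hs ht => by
      rw [fmk_add_right, map_add, map_add, hs, ht]

lemma bdS_nat {d : fr M ⟶ M} {d' : fr N ⟶ N} {f : M ⟶ N} (h : frMap f ≫ d' = d ≫ f) :
    frMap (frMap f) ≫ bdS d' = bdS d ≫ frMap f := by
  rw [bdS, bdS, Preadditive.comp_sub, Preadditive.sub_comp, act_nat, ← frMap_comp, h, frMap_comp]

lemma buS_nat {u : M ⟶ fr M} {u' : N ⟶ fr N} {f : M ⟶ N} (h : f ≫ u' = u ≫ frMap f) :
    frMap f ≫ buS w u' = buS w u ≫ frMap (frMap f) := by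
  rw [buS, buS, Preadditive.comp_sub, Preadditive.sub_comp, insW_nat, ← frMap_comp, h, frMap_comp]

lemma bdS_act (M : PMod O) : bdS (act M) ≫ act M = 0 := by
  rw [bdS, Preadditive.sub_comp, act_act, sub_self]

lemma bdS_bdS {d : fr A ⟶ A} (h : bdS d ≫ d = 0) : bdS (bdS d) ≫ bdS d = 0 := by
  have h2 : frMap (act (fr A)) ≫ frMap d = frMap (frMap d) ≫ frMap d := by
    rw [← frMap_comp, ← frMap_comp, ← sub_eq_zero, ← frMap_sub, ← Preadditive.sub_comp]
    exact (congrArg frMap h).trans (frMap_zero _ _)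
  rw [bdS.eq_1 (bdS d), bdS, frMap_sub, Preadditive.sub_comp, Preadditive.sub_comp,
    Preadditive.comp_sub, Preadditive.comp_sub, Preadditive.comp_sub, h2, act_act, act_nat (frMap d)]
  abel

lemma buS_zero (w : GlobalFun O) (M : PMod O) : (0 : M ⟶ fr M) ≫ buS w (0 : M ⟶ fr M) = 0 :=
  Limits.zero_comp

lemma buS_buS {u : A ⟶ fr A} (h : u ≫ buS w u = 0) : buS w u ≫ buS w (buS w u) = 0 := by
  have h2 : frMap u ≫ frMap (insW w A) = frMap u ≫ frMap (frMap u) := by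
    rw [← frMap_comp, ← frMap_comp, ← sub_eq_zero, ← frMap_sub, ← Preadditive.comp_sub]
    exact (congrArg frMap h).trans (frMap_zero _ _)
  rw [buS.eq_1 w (buS w u), buS, frMap_sub, Preadditive.sub_comp, Preadditive.comp_sub,
    Preadditive.comp_sub, Preadditive.comp_sub, Preadditive.comp_sub, h2, insW_insW, insW_nat]
  abel

lemma bar_comm_zero (w : GlobalFun O) (M : PMod O) :
    buS w (0 : M ⟶ fr M) ≫ bdS (act M) = w.mul (fr M) - frMap (w.mul M) := by
  rw [buS, bdS, frMap_zero, sub_zero, Preadditive.comp_sub, insW_act, insW_frAct]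

lemma bar_comm_succ {A : PMod O} {d : fr A ⟶ A} {u : A ⟶ fr A} {m : fr A ⟶ fr A}
    (h : buS w u ≫ bdS d + d ≫ u = w.mul _ - m) :
    buS w (buS w u) ≫ bdS (bdS d) + bdS d ≫ buS w u = w.mul _ - frMap m := by
  have hm : m = w.mul _ - (buS w u ≫ bdS d + d ≫ u) := by rw [h]; abel
  have h1 : frMap d ≫ buS w u = insW w (fr A) ≫ frMap (frMap d) - frMap (d ≫ u) := by
    rw [buS, Preadditive.comp_sub, insW_nat, frMap_comp]
  have h2 : insW w (fr A) ≫ frMap (bdS d) =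
      frMap (w.mul (fr A)) - insW w (fr A) ≫ frMap (frMap d) := by
    rw [bdS, frMap_sub, Preadditive.comp_sub, insW_frAct]
  have h3 : bdS d ≫ buS w u = act (fr A) ≫ buS w u - frMap d ≫ buS w u := by
    rw [bdS, Preadditive.sub_comp]
  have h4 : buS w (buS w u) ≫ bdS (bdS d) = w.mul (fr (fr A)) - act (fr A) ≫ buS w u -
      insW w (fr A) ≫ frMap (bdS d) + frMap (buS w u ≫ bdS d) := by
    rw [buS.eq_1 w (buS w u), bdS.eq_1 (bdS d), Preadditive.sub_comp, Preadditive.comp_sub,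
      Preadditive.comp_sub, insW_act, act_nat, frMap_comp]
    abel
  have h5 : frMap (buS w u ≫ bdS d + d ≫ u) =
      frMap (buS w u ≫ bdS d) + frMap (d ≫ u) := fr_hom_ext fun U a x => by
    simp [fmk_add_right]
  rw [h3, h4, h1, h2, hm, frMap_sub, h5]
  abel

end

lemma barMap_id : ∀ (q : ℕ) (M : PMod O), barMap q (𝟙 M) = 𝟙 _
  | 0, _ => rfl
  | q + 1, M => (congrArg frMap (barMap_id q M)).trans (frMap_id _)

lemma barMap_comp : ∀ (q : ℕ) {M N P : PMod O} (f : M ⟶ N) (g : N ⟶ P),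
    barMap q (f ≫ g) = barMap q f ≫ barMap q g
  | 0, _, _, _, _, _ => rfl
  | q + 1, _, _, _, f, g => (congrArg frMap (barMap_comp q f g)).trans (frMap_comp _ _)

lemma barDown_nat : ∀ (q : ℕ) {M N : PMod O} (f : M ⟶ N),
    barMap (q + 1) f ≫ barDown q N = barDown q M ≫ barMap q f
  | 0, _, _, f => act_nat f
  | q + 1, _, _, f => bdS_nat (barDown_nat q f)

lemma barUp_nat (w : GlobalFun O) : ∀ (q : ℕ) {M N : PMod O} (f : M ⟶ N),
    barMap q f ≫ barUp w q N = barUp w q M ≫ barMap (q + 1) f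
  | 0, _, _, _ => (Limits.comp_zero).trans (Limits.zero_comp).symm
  | q + 1, _, _, f => buS_nat (barUp_nat w q f)

lemma barDown_down : ∀ (q : ℕ) (M : PMod O), barDown (q + 1) M ≫ barDown q M = 0
  | 0, M => bdS_act M
  | q + 1, M => bdS_bdS (barDown_down q M)

lemma barUp_up (w : GlobalFun O) : ∀ (q : ℕ) (M : PMod O), barUp w q M ≫ barUp w (q + 1) M = 0
  | 0, M => buS_zero w M
  | q + 1, M => buS_buS (barUp_up w q M)

lemma barComm (w : GlobalFun O) : ∀ (q : ℕ) (M : PMod O),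
    barUp w (q + 1) M ≫ barDown (q + 1) M + barDown q M ≫ barUp w q M =
      w.mul (barObj (q + 1) M) - barMap (q + 1) (w.mul M)
  | 0, M => by
    have h : act M ≫ (0 : M ⟶ fr M) = 0 := Limits.comp_zero
    have e := bar_comm_zero w M
    rw [← add_zero (buS w 0 ≫ _), ← h] at e
    exact e
  | q + 1, M => bar_comm_succ (barComm w q M)

/-- The operators of the curved bar complex; the term of degree `q` is `O^{⊗ (q + 1)} ⊗ M`. -/
def barMixed (w : GlobalFun O) : Mixed w where
  obj q M := barObj (q + 1) M
  map q _ _ f := barMap (q + 1) f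
  map_id q M := barMap_id (q + 1) M
  map_comp q _ _ _ f g := barMap_comp (q + 1) f g
  up q M := barUp w (q + 1) M
  down q M := barDown (q + 1) M
  up_nat q _ _ f := barUp_nat w (q + 1) f
  down_nat q _ _ f := barDown_nat (q + 1) f
  up_up q M := barUp_up w (q + 1) M
  down_down q M := barDown_down (q + 1) M
  comm_zero M := bar_comm_zero w M
  comm_succ q M := barComm w (q + 1) M

/-! ### Exterior powers of `Ω` -/

namespace PMod

section ExtMap

variable {R R' M M' : Type u} [CommRing R] [CommRing R'] [AddCommGroup M] [AddCommGroup M']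
  [Module R M] [Module R' M']

/-- The map of exterior powers induced by a semilinear map. -/
def extMap (σ : R →+* R') (g : M →+ M') (hg : ∀ r x, g (r • x) = σ r • g x) (q : ℕ) :
    ⋀[R]^q M →+ ⋀[R']^q M' :=
  letI : Module R (⋀[R']^q M') := Module.compHom _ σ
  (exteriorPower.alternatingMapLinearEquiv
    { toFun := fun v => exteriorPower.ιMulti R' q (fun i => g (v i))
      map_update_add' := fun v i x y => by
        have h : ∀ z, (fun j => g (Function.update v i z j)) =
            Function.update (fun j => g (v j)) i (g z) := fun z => by
          funext j
          by_cases hj : j = i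
          · subst hj; simp
          · simp [hj]
        simp only [h, map_add]
        exact (exteriorPower.ιMulti R' q).map_update_add (fun j => g (v j)) i (g x) (g y)
      map_update_smul' := fun v i r x => by
        have h : ∀ z, (fun j => g (Function.update v i z j)) =
            Function.update (fun j => g (v j)) i (g z) := fun z => by
          funext j
          by_cases hj : j = i
          · subst hj; simp
          · simp [hj]
        simp only [h, hg]
        exact (exteriorPower.ιMulti R' q).map_update_smul (fun j => g (v j)) i (σ r) (g x)
      map_eq_zero_of_eq' := fun v i j h hij =>
        (exteriorPower.ιMulti R' q).map_eq_zero_of_eq _ (congrArg g h) hij }).toAddMonoidHom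

lemma extMap_ιMulti (σ : R →+* R') (g : M →+ M') (hg : ∀ r x, g (r • x) = σ r • g x) (q : ℕ)
    (v : Fin q → M) : extMap σ g hg q (exteriorPower.ιMulti R q v) =
      exteriorPower.ιMulti R' q (fun i => g (v i)) := by
  let _ : Module R (⋀[R']^q M') := Module.compHom _ σ
  exact exteriorPower.alternatingMapLinearEquiv_apply_ιMulti _ v

lemma extMap_smul (σ : R →+* R') (g : M →+ M') (hg : ∀ r x, g (r • x) = σ r • g x) (q : ℕ)
    (r : R) (x : ⋀[R]^q M) : extMap σ g hg q (r • x) = σ r • extMap σ g hg q x := by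
  let _ : Module R (⋀[R']^q M') := Module.compHom _ σ
  exact LinearMap.map_smul (exteriorPower.alternatingMapLinearEquiv _) r x

lemma ext_induction {q : ℕ} {p : ⋀[R]^q M → Prop} (x : ⋀[R]^q M)
    (h : ∀ (r : R) (v : Fin q → M), p (r • exteriorPower.ιMulti R q v)) (h0 : p 0)
    (hadd : ∀ s t, p s → p t → p (s + t)) : p x := by
  have hx : x ∈ Submodule.span R (Set.range (exteriorPower.ιMulti R q (M := M))) := by
    rw [exteriorPower.ιMulti_span]; trivial
  induction hx using Submodule.span_induction with
  | mem x hx => obtain ⟨v, rfl⟩ := hx; simpa using h 1 v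
  | zero => exact h0
  | add x y _ _ hx hy => exact hadd x y hx hy
  | smul r x hx' hx =>
    clear hx
    induction hx' using Submodule.span_induction generalizing r with
    | mem x hx => obtain ⟨v, rfl⟩ := hx; exact h r v
    | zero => simpa using h0
    | add x y _ _ hx hy => rw [smul_add]; exact hadd _ _ (hx r) (hy r)
    | smul s x _ hx => rw [smul_smul]; exact hx _

lemma extMap_id (σ : R →+* R) (g : M →+ M) (hg : ∀ r x, g (r • x) = σ r • g x) (q : ℕ)
    (hσ : ∀ r, σ r = r) (hg' : ∀ x, g x = x) (x : ⋀[R]^q M) : extMap σ g hg q x = x := by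
  refine ext_induction (p := fun x => extMap σ g hg q x = x) x (fun r v => ?_)
    (map_zero _) fun s t hs ht => by rw [map_add, hs, ht]
  simp only [extMap_smul, extMap_ιMulti, hσ, hg']

lemma extMap_comp {R'' M'' : Type u} [CommRing R''] [AddCommGroup M''] [Module R'' M'']
    (σ : R →+* R') (g : M →+ M') (hg : ∀ r x, g (r • x) = σ r • g x)
    (σ' : R' →+* R'') (g' : M' →+ M'') (hg' : ∀ r x, g' (r • x) = σ' r • g' x)
    (σ'' : R →+* R'') (g'' : M →+ M'') (hg'' : ∀ r x, g'' (r • x) = σ'' r • g'' x) (q : ℕ)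
    (hσ : ∀ r, σ' (σ r) = σ'' r) (h : ∀ x, g' (g x) = g'' x) (x : ⋀[R]^q M) :
    extMap σ' g' hg' q (extMap σ g hg q x) = extMap σ'' g'' hg'' q x := by
  refine ext_induction (p := fun x => extMap σ' g' hg' q (extMap σ g hg q x) =
    extMap σ'' g'' hg'' q x) x (fun r v => ?_)
    (by simp only [map_zero]) fun s t hs ht => by rw [map_add, map_add, map_add, hs, ht]
  simp only [extMap_smul, extMap_ιMulti, hσ, h]

/-- The exterior multiplication by elements of degree one. -/
def wedgeLin (R M : Type u) [CommRing R] [AddCommGroup M] [Module R M] (q : ℕ) :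
    M →ₗ[R] ⋀[R]^q M →ₗ[R] ⋀[R]^(q + 1) M :=
  LinearMap.mk₂ R (fun m x => ⟨ExteriorAlgebra.ι R m * x.1, by
      change _ ∈ LinearMap.range (ExteriorAlgebra.ι R) ^ (q + 1)
      rw [pow_succ']
      exact Submodule.mul_mem_mul ⟨m, rfl⟩ x.2⟩)
    (fun _ _ _ => Subtype.ext (by simp [add_mul])) (fun _ _ _ => Subtype.ext (by simp))
    (fun _ _ _ => Subtype.ext (by simp [mul_add])) (fun _ _ _ => Subtype.ext (by simp))

lemma wedgeLin_ιMulti (q : ℕ) (m : M) (v : Fin q → M) :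
    wedgeLin R M q m (exteriorPower.ιMulti R q v) =
      exteriorPower.ιMulti R (q + 1) (Fin.cons m v : Fin (q + 1) → M) := by
  refine Subtype.ext ?_
  change ExteriorAlgebra.ι R m * ExteriorAlgebra.ιMulti R q v = ExteriorAlgebra.ιMulti R (q + 1) _
  rw [ExteriorAlgebra.ιMulti_succ_apply]
  simp [Matrix.vecTail, Function.comp_def]

lemma wedgeLin_self (q : ℕ) (m : M) (x : ⋀[R]^q M) :
    wedgeLin R M (q + 1) m (wedgeLin R M q m x) = 0 := by
  refine Subtype.ext ?_
  change ExteriorAlgebra.ι R m * (ExteriorAlgebra.ι R m * x.1) = 0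
  rw [← mul_assoc, ExteriorAlgebra.ι_sq_zero, zero_mul]

/-- The exterior power as a type. -/
def ExtPow (R M : Type u) [CommRing R] [AddCommGroup M] [Module R M] (q : ℕ) : Type u := ⋀[R]^q M

instance (R M : Type u) [CommRing R] [AddCommGroup M] [Module R M] (q : ℕ) :
    AddCommGroup (ExtPow R M q) := inferInstanceAs (AddCommGroup (⋀[R]^q M))

instance (R M : Type u) [CommRing R] [AddCommGroup M] [Module R M] (q : ℕ) :
    Module R (ExtPow R M q) := inferInstanceAs (Module R (⋀[R]^q M))

/-- The map of exterior powers induced by a semilinear map. -/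
def extRes (σ : R →+* R') (g : M →+ M') (hg : ∀ r x, g (r • x) = σ r • g x) (q : ℕ) :
    ExtPow R M q →+ ExtPow R' M' q := extMap σ g hg q

lemma extRes_smul (σ : R →+* R') (g : M →+ M') (hg : ∀ r x, g (r • x) = σ r • g x) (q : ℕ)
    (r : R) (x : ExtPow R M q) : extRes σ g hg q (r • x) = σ r • extRes σ g hg q x :=
  extMap_smul σ g hg q r x

lemma extRes_id (σ : R →+* R) (g : M →+ M) (hg : ∀ r x, g (r • x) = σ r • g x) (q : ℕ)
    (hσ : ∀ r, σ r = r) (hg' : ∀ x, g x = x) (x : ExtPow R M q) : extRes σ g hg q x = x :=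
  extMap_id σ g hg q hσ hg' x

lemma extRes_comp {R'' M'' : Type u} [CommRing R''] [AddCommGroup M''] [Module R'' M'']
    (σ : R →+* R') (g : M →+ M') (hg : ∀ r x, g (r • x) = σ r • g x)
    (σ' : R' →+* R'') (g' : M' →+ M'') (hg' : ∀ r x, g' (r • x) = σ' r • g' x)
    (σ'' : R →+* R'') (g'' : M →+ M'') (hg'' : ∀ r x, g'' (r • x) = σ'' r • g'' x) (q : ℕ)
    (hσ : ∀ r, σ' (σ r) = σ'' r) (h : ∀ x, g' (g x) = g'' x) (x : ExtPow R M q) :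
    extRes σ' g' hg' q (extRes σ g hg q x) = extRes σ'' g'' hg'' q x :=
  extMap_comp σ g hg σ' g' hg' σ'' g'' hg'' q hσ h x

end ExtMap

/-- The presheaf of exterior powers of a presheaf of modules. -/
def ext (K : PMod O) (q : ℕ) : PMod O where
  obj U := ExtPow (O.ring U) (K.obj U) q
  res h := extRes (O.res h).toRingHom (K.res h) (K.res_smul h) q
  res_smul h a x := extRes_smul (O.res h).toRingHom (K.res h) (K.res_smul h) q a x
  res_id U x := extRes_id (O.res (le_refl U)).toRingHom (K.res (le_refl U))
    (K.res_smul (le_refl U)) q (O.res_id U) (K.res_id U) x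
  res_comp h h' x := extRes_comp (O.res h).toRingHom (K.res h)
    (K.res_smul h) (O.res h').toRingHom (K.res h') (K.res_smul h')
    (O.res (h'.trans h)).toRingHom (K.res (h'.trans h))
    (K.res_smul (h'.trans h)) q (O.res_comp h h') (K.res_comp h h') x

/-- The presheaf of exterior powers `⋀^q Ω`. -/
abbrev lam (O : AlgPresheaf k C) (q : ℕ) : PMod O := ext (Om O) q

section Ext

variable {K : PMod O}

/-- The exterior product of `q` sections. -/
def emk (q : ℕ) (U : C) (v : Fin q → K.obj U) : (ext K q).obj U :=
  exteriorPower.ιMulti (O.ring U) q v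

lemma emk_res (q : ℕ) {U V : C} (h : V ≤ U) (v : Fin q → K.obj U) :
    (ext K q).res h (emk q U v) = emk q V (fun i => K.res h (v i)) :=
  extMap_ιMulti (O.res h).toRingHom (K.res h) (K.res_smul h) q v

lemma emk_induction {q : ℕ} {U : C} {p : (ext K q).obj U → Prop} (x : (ext K q).obj U)
    (h : ∀ (r : O.ring U) (v : Fin q → K.obj U), p (r • emk q U v)) (h0 : p 0)
    (hadd : ∀ s t, p s → p t → p (s + t)) : p x := ext_induction (p := p) x h h0 hadd

/-- The exterior product `(ω, x) ↦ ω ∧ x`. -/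
def ewedge (q : ℕ) (U : C) :
    K.obj U →ₗ[O.ring U] (ext K q).obj U →ₗ[O.ring U] (ext K (q + 1)).obj U :=
  wedgeLin (O.ring U) (K.obj U) q

lemma ewedge_emk (q : ℕ) (U : C) (ω : K.obj U) (v : Fin q → K.obj U) :
    ewedge q U ω (emk q U v) = emk (q + 1) U (Fin.cons ω v : Fin (q + 1) → K.obj U) :=
  wedgeLin_ιMulti q ω v

lemma ewedge_self (q : ℕ) (U : C) (ω : K.obj U) (x : (ext K q).obj U) :
    ewedge (q + 1) U ω (ewedge q U ω x) = 0 := wedgeLin_self q ω x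

lemma ewedge_res (q : ℕ) {U V : C} (h : V ≤ U) (ω : K.obj U) (x : (ext K q).obj U) :
    ewedge q V (K.res h ω) ((ext K q).res h x) =
      (ext K (q + 1)).res h (ewedge q U ω x) := by
  refine emk_induction (p := fun x => ewedge q V (K.res h ω) ((ext K q).res h x) =
      (ext K (q + 1)).res h (ewedge q U ω x)) x (fun r v => ?_) (by simp only [map_zero])
      fun s t hs ht => by simp only [map_add, hs, ht]
  rw [(ext K q).res_smul, map_smul, map_smul, (ext K (q + 1)).res_smul, emk_res, ewedge_emk,
    ewedge_emk, emk_res]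
  congr 2
  funext i
  refine Fin.cases ?_ (fun i => ?_) i
  · simp
  · simp

end Ext

/-- The bilinear map `(ω, x ⊗ y) ↦ (ω ∧ x) ⊗ y`. -/
def wedgeBil (q : ℕ) (M : PMod O) (U : C) : (Om O).obj U →ₗ[O.ring U]
    (tens (lam O q) M).obj U →ₗ[O.ring U] (tens (lam O (q + 1)) M).obj U :=
  (LinearMap.rTensorHom (R := O.ring U) (M.obj U)).comp (ewedge q U)

lemma wedgeBil_tmk (q : ℕ) (M : PMod O) (U : C) (ω : (Om O).obj U) (x : (lam O q).obj U)
    (y : M.obj U) : wedgeBil q M U ω (tmk _ M U x y) = tmk _ M U (ewedge q U ω x) y := rfl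

/-- The map `ω ⊗ (x ⊗ y) ↦ (ω ∧ x) ⊗ y`. -/
def wedge (q : ℕ) (M : PMod O) : tens (Om O) (tens (lam O q) M) ⟶ tens (lam O (q + 1)) M :=
  tlift (wedgeBil q M) fun {U V} h ω t => tens_induction
      (p := fun t => wedgeBil q M V ((Om O).res h ω) ((tens (lam O q) M).res h t) =
        (tens (lam O (q + 1)) M).res h (wedgeBil q M U ω t)) t
      (fun x y => by rw [tens_res, wedgeBil_tmk, wedgeBil_tmk, tens_res, ewedge_res])
      (by simp only [map_zero]) fun s t hs ht => by simp only [map_add, hs, ht]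

@[simp] lemma wedge_app (q : ℕ) (M : PMod O) (U : C) (ω : (Om O).obj U) (x : (lam O q).obj U)
    (y : M.obj U) : (wedge q M).app U (tmk _ _ U ω (tmk _ M U x y)) =
      tmk _ M U (ewedge q U ω x) y := rfl

/-- The map `x ↦ 1 ⊗ x`. -/
def lamOne (M : PMod O) : M ⟶ tens (lam O 0) M where
  app U := tmkₗ (lam O 0) M U (emk 0 U Fin.elim0)
  naturality {U V} h x := by
    simp only [tmkₗ_apply, tens_res, emk_res]
    congr 2
    funext i
    exact i.elim0

@[simp] lemma lamOne_app (M : PMod O) (U : C) (x : M.obj U) :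
    (lamOne M).app U x = tmk _ M U (emk 0 U Fin.elim0) x := rfl

/-- The map `dw ∧ -`. -/
def dwWedge (w : GlobalFun O) (q : ℕ) (M : PMod O) : tens (lam O q) M ⟶ tens (lam O (q + 1)) M :=
  dwTens w _ ≫ wedge q M

@[simp] lemma dwWedge_app (w : GlobalFun O) (q : ℕ) (M : PMod O) (U : C) (x : (lam O q).obj U)
    (y : M.obj U) : (dwWedge w q M).app U (tmk _ M U x y) = tmk _ M U (ewedge q U (dw w U) x) y :=
  rfl

lemma tmk_zero_left (K M : PMod O) (U : C) (b : M.obj U) : tmk K M U 0 b = 0 :=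
  TensorProduct.zero_tmul _ b

/-- The additive map `a ⊗ t ↦ da ⊗ (1 ⊗ t)`. -/
def kapAdd (M : PMod O) (U : C) : (fr M).obj U →+ (tens (Om O) (fr M)).obj U :=
  TensorProduct.liftAddHom (R := k)
    (AddMonoidHom.mk' (fun a : O.ring U => AddMonoidHom.mk'
      (fun t : M.obj U => tmk (Om O) (fr M) U (dd U a) (fmk M U 1 t))
      fun s t => by rw [fmk_add_right, tmk_add_right])
      fun a b => by ext t; simp [dd_add, tmk_add_left])
    fun c a t => by
      simp only [AddMonoidHom.mk'_apply]
      rw [dd_k_smul, fmk_k_smul_right, k_smul, tmk_smul_left, tmk_smul_right]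

lemma kapAdd_fmk (M : PMod O) (U : C) (a : O.ring U) (t : M.obj U) :
    kapAdd M U (fmk M U a t) = tmk (Om O) (fr M) U (dd U a) (fmk M U 1 t) := rfl

/-- The map `a₀ ⊗ (a₁ ⊗ t) ↦ a₀ da₁ ⊗ (1 ⊗ t)`. -/
def kap (M : PMod O) : fr (fr M) ⟶ tens (Om O) (fr M) :=
  flift (kapAdd M)
    (fun U c x => fr_induction (p := fun x => kapAdd M U (c • x) = c • kapAdd M U x) x
      (fun a t => by
        rw [← fmk_k_smul_left, kapAdd_fmk, kapAdd_fmk, dd_k_smul, tmk_smul_left, k_smul])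
      (by rw [smul_zero, map_zero, smul_zero])
      fun s t hs ht => by rw [smul_add, map_add, map_add, hs, ht, smul_add])
    fun {U V} h x => fr_induction
      (p := fun x => kapAdd M V ((fr M).res h x) = (tens (Om O) (fr M)).res h (kapAdd M U x)) x
      (fun a t => by
        rw [fr_res, kapAdd_fmk, kapAdd_fmk, tens_res, res_dd, fr_res, map_one])
      (by simp only [map_zero]) fun s t hs ht => by simp only [map_add, hs, ht]

@[simp] lemma kap_app (M : PMod O) (U : C) (a b : O.ring U) (t : M.obj U) :
    (kap M).app U (fmk (fr M) U a (fmk M U b t)) =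
      a • tmk (Om O) (fr M) U (dd U b) (fmk M U 1 t) := rfl

end PMod

/-- The operators `dw ∧ -` and `0` on `⋀ Ω ⊗ M`. -/
def omegaMixed (w : GlobalFun O) : Mixed w where
  obj q M := tens (lam O q) M
  map q _ _ f := tmap (𝟙 _) f
  map_id q M := tens_hom_ext fun U a b => by simp
  map_comp q _ _ _ f g := tens_hom_ext fun U a b => by simp
  up q M := dwWedge w q M
  down q M := 0
  up_nat q _ _ f := tens_hom_ext fun U a b => by simp
  down_nat q _ _ f := by simp
  up_up q M := tens_hom_ext fun U a b => by simp [ewedge_self, tmk_zero_left]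
  down_down q M := by simp
  comm_zero M := tens_hom_ext fun U a b => by simp [tmk_smul_right]
  comm_succ q M := tens_hom_ext fun U a b => by simp [tmk_smul_right]

namespace PMod

/-! ### Direct sums, products and internal Hom -/

section Prod

variable {A B A' B' A'' B'' M : PMod O}

/-- The first projection. -/
def fst (A B : PMod O) : prod A B ⟶ A :=
  ⟨fun U => LinearMap.fst _ (A.obj U) (B.obj U), fun _ _ => rfl⟩

/-- The second projection. -/
def snd (A B : PMod O) : prod A B ⟶ B :=
  ⟨fun U => LinearMap.snd _ (A.obj U) (B.obj U), fun _ _ => rfl⟩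

/-- The morphism to a direct sum with given components. -/
def pair (f : M ⟶ A) (g : M ⟶ B) : M ⟶ prod A B :=
  ⟨fun U => (f.app U).prod (g.app U), fun h x => Prod.ext (hom_nat f h x) (hom_nat g h x)⟩

lemma pair_fst (f : M ⟶ A) (g : M ⟶ B) : pair f g ≫ fst A B = f := rfl
lemma pair_snd (f : M ⟶ A) (g : M ⟶ B) : pair f g ≫ snd A B = g := rfl

lemma prod_hom_ext {f g : M ⟶ prod A B} (h1 : f ≫ fst A B = g ≫ fst A B)
    (h2 : f ≫ snd A B = g ≫ snd A B) : f = g := hom_ext' fun U x =>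
  Prod.ext (congrArg (fun q : M ⟶ A => q.app U x) h1) (congrArg (fun q : M ⟶ B => q.app U x) h2)

/-- The morphism `(x, y) ↦ (a x + b y, c x + d y)`. -/
def mat (a : A ⟶ A') (b : B ⟶ A') (c : A ⟶ B') (d : B ⟶ B') : prod A B ⟶ prod A' B' :=
  pair (fst A B ≫ a + snd A B ≫ b) (fst A B ≫ c + snd A B ≫ d)

lemma mat_fst (a : A ⟶ A') (b : B ⟶ A') (c : A ⟶ B') (d : B ⟶ B') :
    mat a b c d ≫ fst A' B' = fst A B ≫ a + snd A B ≫ b := rfl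
lemma mat_snd (a : A ⟶ A') (b : B ⟶ A') (c : A ⟶ B') (d : B ⟶ B') :
    mat a b c d ≫ snd A' B' = fst A B ≫ c + snd A B ≫ d := rfl

@[simp] lemma mat_app (a : A ⟶ A') (b : B ⟶ A') (c : A ⟶ B') (d : B ⟶ B') (U : C)
    (x : A.obj U) (y : B.obj U) : (mat a b c d).app U ((x, y) : A.obj U × B.obj U) =
      ((a.app U x + b.app U y, c.app U x + d.app U y) : A'.obj U × B'.obj U) := rfl

lemma mat_comp (a : A ⟶ A') (b : B ⟶ A') (c : A ⟶ B') (d : B ⟶ B') (a' : A' ⟶ A'')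
    (b' : B' ⟶ A'') (c' : A' ⟶ B'') (d' : B' ⟶ B'') :
    mat a b c d ≫ mat a' b' c' d' =
      mat (a ≫ a' + c ≫ b') (b ≫ a' + d ≫ b') (a ≫ c' + c ≫ d') (b ≫ c' + d ≫ d') := by
  refine prod_hom_ext ?_ ?_
  · rw [Category.assoc, mat_fst, mat_fst, Preadditive.comp_add, ← Category.assoc,
      ← Category.assoc, mat_fst, mat_snd]
    simp only [Preadditive.comp_add, Preadditive.add_comp, Category.assoc]
    abel
  · rw [Category.assoc, mat_snd, mat_snd, Preadditive.comp_add, ← Category.assoc,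
      ← Category.assoc, mat_fst, mat_snd]
    simp only [Preadditive.comp_add, Preadditive.add_comp, Category.assoc]
    abel

lemma mul_prod (w : GlobalFun O) (A B : PMod O) :
    w.mul (prod A B) = mat (w.mul A) 0 0 (w.mul B) := hom_ext' fun U x =>
  Prod.ext (add_zero (w.val U • x.1)).symm (zero_add (w.val U • x.2)).symm

lemma mat_zero : mat (0 : A ⟶ A') (0 : B ⟶ A') (0 : A ⟶ B') (0 : B ⟶ B') = 0 :=
  hom_ext' fun _ _ => Prod.ext (add_zero _) (add_zero _)

end Prod

section Pi

variable {F G : ℕ → PMod O} {M : PMod O}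

/-- The projections of a product. -/
def proj (F : ℕ → PMod O) (j : ℕ) : pi F ⟶ F j :=
  ⟨fun _ => LinearMap.proj j, fun _ _ => rfl⟩

@[simp] lemma proj_app (F : ℕ → PMod O) (j : ℕ) (U : C) (x : (pi F).obj U) :
    (proj F j).app U x = x j := rfl

/-- The morphism to a product with given components. -/
def piLift (f : ∀ j, M ⟶ F j) : M ⟶ pi F :=
  ⟨fun U => LinearMap.pi fun j => (f j).app U, fun h x => funext fun j => hom_nat (f j) h x⟩

@[simp] lemma piLift_proj (f : ∀ j, M ⟶ F j) (j : ℕ) : piLift f ≫ proj F j = f j := rfl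

@[simp] lemma piLift_proj_assoc (f : ∀ j, M ⟶ F j) (j : ℕ) {N : PMod O} (g : F j ⟶ N) :
    piLift f ≫ proj F j ≫ g = f j ≫ g := rfl

@[simp] lemma piLift_app (f : ∀ j, M ⟶ F j) (U : C) (x : M.obj U) (j : ℕ) :
    (piLift f).app U x j = (f j).app U x := rfl

lemma pi_hom_ext {f g : M ⟶ pi F} (h : ∀ j, f ≫ proj F j = g ≫ proj F j) : f = g :=
  hom_ext' fun U x => funext fun j => congrArg (fun q : M ⟶ F j => q.app U x) (h j)

end Pi

/-- The additive group of the compatible families of linear maps over the members below `U`. -/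
def ihomSub (K N : PMod O) (U : C) :
    AddSubgroup (∀ V : {V : C // V ≤ U}, K.obj V →ₗ[O.ring V] N.obj V) where
  carrier := {f | ∀ (V W : {V : C // V ≤ U}) (h : (W : C) ≤ V) (x : K.obj V),
    f W (K.res h x) = N.res h (f V x)}
  zero_mem' V W h x := by simp
  add_mem' {f g} hf hg V W h x := by
    simp only [Pi.add_apply, LinearMap.add_apply, map_add, hf V W h x, hg V W h x]
  neg_mem' {f} hf V W h x := by
    simp only [Pi.neg_apply, LinearMap.neg_apply, map_neg, hf V W h x]

instance (K N : PMod O) (U : C) : Module (O.ring U) (ihomSub K N U) where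
  smul a f := ⟨fun V => O.res V.2 a • f.1 V, fun V W h x => by
    have e := f.2 V W h x
    change O.res W.2 a • f.1 W (K.res h x) = N.res h (O.res V.2 a • f.1 V x)
    rw [N.res_smul, O.res_comp, e]⟩
  one_smul f := Subtype.ext (funext fun V => by
    change O.res V.2 1 • f.1 V = f.1 V
    rw [map_one, one_smul])
  mul_smul a b f := Subtype.ext (funext fun V => by
    change O.res V.2 (a * b) • f.1 V = O.res V.2 a • O.res V.2 b • f.1 V
    rw [map_mul, mul_smul])
  smul_zero a := Subtype.ext (funext fun V => smul_zero (O.res V.2 a))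
  smul_add a f g := Subtype.ext (funext fun V => smul_add (O.res V.2 a) (f.1 V) (g.1 V))
  add_smul a b f := Subtype.ext (funext fun V => by
    change O.res V.2 (a + b) • f.1 V = O.res V.2 a • f.1 V + O.res V.2 b • f.1 V
    rw [map_add, add_smul])
  zero_smul f := Subtype.ext (funext fun V => by
    change O.res V.2 0 • f.1 V = 0
    rw [map_zero, zero_smul])

/-- The internal Hom: over `U` it consists of the morphisms of the restrictions to `U`. -/
def ihom (K N : PMod O) : PMod O where
  obj U := ihomSub K N U
  res {_ V} h := AddMonoidHom.mk' (fun f => ⟨fun W => f.1 ⟨W.1, W.2.trans h⟩,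
    fun V' W h' x => f.2 ⟨V'.1, V'.2.trans h⟩ ⟨W.1, W.2.trans h⟩ h' x⟩) fun _ _ => rfl
  res_smul h a f := Subtype.ext (funext fun W =>
    congrArg (· • f.1 ⟨W.1, W.2.trans h⟩) (O.res_comp h W.2 a).symm)
  res_id _ _ := rfl
  res_comp _ _ _ := rfl

/-- The value of a section of the internal Hom. -/
def iapp {K N : PMod O} {U : C} (f : (ihom K N).obj U) (V : C) (h : V ≤ U) :
    K.obj V →ₗ[O.ring V] N.obj V := f.1 ⟨V, h⟩

section IHom

variable {K N K' N' : PMod O}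

lemma iext {U : C} {f g : (ihom K N).obj U} (h : ∀ V (hV : V ≤ U) (x : K.obj V),
    iapp f V hV x = iapp g V hV x) : f = g :=
  Subtype.ext (funext fun V => LinearMap.ext (h V.1 V.2))

lemma iapp_res {U V : C} (h : V ≤ U) (f : (ihom K N).obj U) (W : C) (h' : W ≤ V) :
    iapp ((ihom K N).res h f) W h' = iapp f W (h'.trans h) := rfl

lemma iapp_nat {U : C} (f : (ihom K N).obj U) {V W : C} (h : V ≤ U) (h' : W ≤ V) (x : K.obj V) :
    iapp f W (h'.trans h) (K.res h' x) = N.res h' (iapp f V h x) :=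
  f.2 ⟨V, h⟩ ⟨W, h'.trans h⟩ h' x

lemma iapp_add {U : C} (f g : (ihom K N).obj U) (V : C) (h : V ≤ U) (x : K.obj V) :
    iapp (f + g) V h x = iapp f V h x + iapp g V h x := rfl

lemma iapp_neg {U : C} (f : (ihom K N).obj U) (V : C) (h : V ≤ U) (x : K.obj V) :
    iapp (-f) V h x = -iapp f V h x := rfl

lemma iapp_smul {U : C} (a : O.ring U) (f : (ihom K N).obj U) (V : C) (h : V ≤ U) (x : K.obj V) :
    iapp (a • f) V h x = O.res h a • iapp f V h x := rfl

/-- A section of the internal Hom from its values. -/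
def imk (U : C) (f : ∀ V, V ≤ U → (K.obj V →ₗ[O.ring V] N.obj V))
    (hf : ∀ {V W : C} (h : V ≤ U) (h' : W ≤ V) (x : K.obj V),
      f W (h'.trans h) (K.res h' x) = N.res h' (f V h x)) : (ihom K N).obj U :=
  ⟨fun V => f V.1 V.2, fun V _ h x => hf V.2 h x⟩

lemma iapp_imk (U : C) (f : ∀ V, V ≤ U → (K.obj V →ₗ[O.ring V] N.obj V))
    (hf : ∀ {V W : C} (h : V ≤ U) (h' : W ≤ V) (x : K.obj V),
      f W (h'.trans h) (K.res h' x) = N.res h' (f V h x)) (V : C) (h : V ≤ U) :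
    iapp (imk U f hf) V h = f V h := rfl

/-- Composition with a morphism of the target. -/
def ipost (K : PMod O) (g : N ⟶ N') : ihom K N ⟶ ihom K N' where
  app U :=
    { toFun := fun f => imk U (fun V h => (g.app V).comp (iapp f V h)) fun {V W} h h' x =>
        (congrArg (g.app W) (iapp_nat f h h' x)).trans (hom_nat g h' _)
      map_add' := fun f f' => iext fun V h x => map_add (g.app V) _ _
      map_smul' := fun a f => iext fun V h x => map_smul (g.app V) _ _ }
  naturality _ _ := rfl

/-- Composition with a morphism of the source. -/
def ipre (N : PMod O) (g : K' ⟶ K) : ihom K N ⟶ ihom K' N where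
  app U :=
    { toFun := fun f => imk U (fun V h => (iapp f V h).comp (g.app V)) fun {V W} h h' x =>
        (congrArg (iapp f W (h'.trans h)) (hom_nat g h' x)).trans (iapp_nat f h h' _)
      map_add' := fun _ _ => rfl
      map_smul' := fun _ _ => rfl }
  naturality _ _ := rfl

@[simp] lemma ipost_app (g : N ⟶ N') (U : C) (f : (ihom K N).obj U) (V : C) (h : V ≤ U)
    (x : K.obj V) : iapp ((ipost K g).app U f) V h x = g.app V (iapp f V h x) := rfl

@[simp] lemma ipre_app (g : K' ⟶ K) (U : C) (f : (ihom K N).obj U) (V : C) (h : V ≤ U)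
    (x : K'.obj V) : iapp ((ipre N g).app U f) V h x = iapp f V h (g.app V x) := rfl

lemma ihom_hom_ext {M : PMod O} {f g : M ⟶ ihom K N} (h : ∀ U (m : M.obj U) V (hV : V ≤ U)
    (x : K.obj V), iapp (f.app U m) V hV x = iapp (g.app U m) V hV x) : f = g :=
  hom_ext' fun U m => iext (h U m)

lemma ipost_mul (w : GlobalFun O) (K N : PMod O) : ipost K (w.mul N) = w.mul (ihom K N) :=
  ihom_hom_ext fun U f V h x => by
    rw [ipost_app, GlobalFun.mul_app, GlobalFun.mul_app, iapp_smul, w.res_val]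

lemma ipre_mul (w : GlobalFun O) (K N : PMod O) : ipre N (w.mul K) = w.mul (ihom K N) :=
  ihom_hom_ext fun U f V h x => by
    rw [ipre_app, GlobalFun.mul_app, GlobalFun.mul_app, iapp_smul, w.res_val, map_smul]

lemma ipost_comp {N'' : PMod O} (f : N ⟶ N') (g : N' ⟶ N'') :
    ipost K f ≫ ipost K g = ipost K (f ≫ g) := rfl

lemma ipre_comp {K'' : PMod O} (f : K' ⟶ K) (g : K'' ⟶ K') :
    ipre N f ≫ ipre N g = ipre N (g ≫ f) := rfl

lemma ipre_ipost (f : K' ⟶ K) (g : N ⟶ N') :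
    ipre N f ≫ ipost K' g = ipost K g ≫ ipre N' f := rfl

/-- The value of a section of the dual, as an element of the ring. -/
def dapp {U : C} (ξ : (ihom K (unit O)).obj U) (V : C) (h : V ≤ U) (x : K.obj V) : O.ring V :=
  iapp ξ V h x

lemma dapp_add {U : C} (ξ : (ihom K (unit O)).obj U) (V : C) (h : V ≤ U) (x y : K.obj V) :
    dapp ξ V h (x + y) = dapp ξ V h x + dapp ξ V h y := map_add (iapp ξ V h) x y

lemma dapp_smul {U : C} (ξ : (ihom K (unit O)).obj U) (V : C) (h : V ≤ U) (a : O.ring V)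
    (x : K.obj V) : dapp ξ V h (a • x) = a * dapp ξ V h x := map_smul (iapp ξ V h) a x

lemma dapp_res {U : C} (ξ : (ihom K (unit O)).obj U) {V W : C} (h : V ≤ U) (h' : W ≤ V)
    (x : K.obj V) : dapp ξ W (h'.trans h) (K.res h' x) = O.res h' (dapp ξ V h x) :=
  iapp_nat ξ h h' x

lemma dapp_add' {U : C} (ξ ξ' : (ihom K (unit O)).obj U) (V : C) (h : V ≤ U) (x : K.obj V) :
    dapp (ξ + ξ') V h x = dapp ξ V h x + dapp ξ' V h x := rfl

lemma dapp_smul' {U : C} (a : O.ring U) (ξ : (ihom K (unit O)).obj U) (V : C) (h : V ≤ U)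
    (x : K.obj V) : dapp (a • ξ) V h x = O.res h a * dapp ξ V h x := rfl

/-- The section `x ↦ ξ x • m` of the internal Hom. -/
def canFun (M : PMod O) (U : C) (m : M.obj U) (ξ : (ihom K (unit O)).obj U) :
    (ihom K M).obj U :=
  imk U (fun V h =>
    { toFun := fun x => dapp ξ V h x • M.res h m
      map_add' := fun x y => by rw [dapp_add, add_smul]
      map_smul' := fun a x => by rw [dapp_smul, mul_smul, RingHom.id_apply] }) fun {V W} h h' x => by
        change dapp ξ W _ (K.res h' x) • M.res _ m = M.res h' (dapp ξ V h x • M.res h m)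
        rw [dapp_res, M.res_smul, M.res_comp]

lemma canFun_app (M : PMod O) (U : C) (m : M.obj U) (ξ : (ihom K (unit O)).obj U) (V : C)
    (h : V ≤ U) (x : K.obj V) : iapp (canFun M U m ξ) V h x = dapp ξ V h x • M.res h m := rfl

/-- The morphism `m ⊗ ξ ↦ (x ↦ ξ x • m)`. -/
def canHom (K M : PMod O) : tens M (ihom K (unit O)) ⟶ ihom K M :=
  tlift (fun U => LinearMap.mk₂ _ (canFun M U)
    (fun m m' ξ => iext fun V h x => by
      simp only [iapp_add, canFun_app, map_add, smul_add])
    (fun a m ξ => iext fun V h x => by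
      rw [iapp_smul, canFun_app, canFun_app, M.res_smul, smul_comm])
    (fun m ξ ξ' => iext fun V h x => by
      rw [iapp_add, canFun_app, canFun_app, canFun_app, dapp_add', add_smul])
    (fun a m ξ => iext fun V h x => by
      rw [iapp_smul, canFun_app, canFun_app, dapp_smul', mul_smul]))
    fun {U V} h m ξ => iext fun W h' x => by
      change dapp ξ W _ x • M.res h' (M.res h m) = dapp ξ W _ x • M.res _ m
      rw [M.res_comp]

@[simp] lemma canHom_app (K M : PMod O) (U : C) (m : M.obj U) (ξ : (ihom K (unit O)).obj U)
    (V : C) (h : V ≤ U) (x : K.obj V) :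
    iapp ((canHom K M).app U (tmk M (ihom K (unit O)) U m ξ)) V h x =
      dapp ξ V h x • M.res h m := rfl

/-- For a section `ξ` of the dual of `K`, the map `ω ⊗ x ↦ ξ x • ω`. -/
def contrLin (L K : PMod O) (U : C) (ξ : (ihom K (unit O)).obj U) :
    (tens L K).obj U →ₗ[O.ring U] L.obj U :=
  tliftApp (LinearMap.mk₂ _ (fun ω x => dapp ξ U le_rfl x • ω)
    (fun _ _ _ => smul_add _ _ _) (fun a ω x => smul_comm _ a ω)
    (fun ω x y => by rw [dapp_add, add_smul])
    fun a ω x => by rw [dapp_smul, mul_smul])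

lemma contrLin_tmk (L K : PMod O) (U : C) (ξ : (ihom K (unit O)).obj U) (ω : L.obj U)
    (x : K.obj U) : contrLin L K U ξ (tmk L K U ω x) =
      dapp ξ U le_rfl x • ω := rfl

/-- The contraction `(ω ⊗ x) ⊗ ξ ↦ ξ x • ω`. -/
def contr (L K : PMod O) : tens (tens L K) (ihom K (unit O)) ⟶ L :=
  tlift (fun U => LinearMap.flip
    { toFun := contrLin L K U
      map_add' := fun ξ ξ' => LinearMap.ext fun t => tens_induction
        (p := fun t => contrLin L K U (ξ + ξ') t = contrLin L K U ξ t + contrLin L K U ξ' t) t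
        (fun ω x => add_smul _ _ _) (by simp only [map_zero, add_zero])
        fun s t hs ht => by simp only [map_add, hs, ht]; abel
      map_smul' := fun a ξ => LinearMap.ext fun t => tens_induction
        (p := fun t => contrLin L K U (a • ξ) t = a • contrLin L K U ξ t) t
        (fun ω x => by
          rw [contrLin_tmk, contrLin_tmk, dapp_smul', O.res_id, mul_smul]) (by simp only [map_zero, smul_zero])
        fun s t hs ht => by simp only [map_add, smul_add, hs, ht] })
    fun {U V} h t ξ => tens_induction
      (p := fun t => contrLin L K V ((ihom K (unit O)).res h ξ) ((tens L K).res h t) =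
        L.res h (contrLin L K U ξ t)) t
      (fun ω x => by
        rw [tens_res, contrLin_tmk, contrLin_tmk, L.res_smul, ← dapp_res]
        rfl) (by simp only [map_zero])
      fun s t hs ht => by simp only [map_add, hs, ht]

lemma contr_app (L K : PMod O) (U : C) (t : (tens L K).obj U) (ξ : (ihom K (unit O)).obj U) :
    (contr L K).app U (tmk _ _ U t ξ) = contrLin L K U ξ t := rfl

lemma contrLin_map (L : PMod O) (f : K' ⟶ K) (U : C) (ξ : (ihom K (unit O)).obj U)
    (t : (tens L K').obj U) : contrLin L K U ξ ((tmap (𝟙 L) f).app U t) =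
      contrLin L K' U ((ipre (unit O) f).app U ξ) t :=
  tens_induction (p := fun t => contrLin L K U ξ ((tmap (𝟙 L) f).app U t) =
      contrLin L K' U ((ipre (unit O) f).app U ξ) t) t (fun _ _ => rfl) (by simp only [map_zero])
      fun s t hs ht => by simp only [map_add, hs, ht]

lemma contrLin_neg (L : PMod O) (U : C) (ξ : (ihom K (unit O)).obj U)
    (t : (tens L K).obj U) : contrLin L K U (-ξ) t = -contrLin L K U ξ t := by
  have h := map_neg ((contr L K).app U) (tmk _ _ U t ξ)
  rw [← tmk_neg_right] at h
  exact h

end IHom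

end PMod

/-! ### Curved modules -/

/-- A curved module with curvature `w`: a `ℤ/2`-graded presheaf of modules with an odd
endomorphism whose square is `w`. -/
structure Curved (w : GlobalFun O) where
  M0 : PMod O
  M1 : PMod O
  d0 : M0 ⟶ M1
  d1 : M1 ⟶ M0
  d0_d1 : d0 ≫ d1 = w.mul M0
  d1_d0 : d1 ≫ d0 = w.mul M1

namespace Curved

variable {w : GlobalFun O}

/-- Closed morphisms of degree zero. -/
@[ext]
structure Hom (M N : Curved w) where
  f0 : M.M0 ⟶ N.M0
  f1 : M.M1 ⟶ N.M1
  comm0 : M.d0 ≫ f1 = f0 ≫ N.d0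
  comm1 : M.d1 ≫ f0 = f1 ≫ N.d1

instance : Category (Curved w) where
  Hom M N := Hom M N
  id M := ⟨𝟙 _, 𝟙 _, by simp, by simp⟩
  comp f g := ⟨f.f0 ≫ g.f0, f.f1 ≫ g.f1,
    by rw [← Category.assoc, f.comm0, Category.assoc, g.comm0, Category.assoc],
    by rw [← Category.assoc, f.comm1, Category.assoc, g.comm1, Category.assoc]⟩
  id_comp f := Hom.ext (Category.id_comp _) (Category.id_comp _)
  comp_id f := Hom.ext (Category.comp_id _) (Category.comp_id _)
  assoc f g h := Hom.ext (Category.assoc _ _ _) (Category.assoc _ _ _)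

lemma hom_comm0 {M N : Curved w} (f : M ⟶ N) : M.d0 ≫ f.f1 = f.f0 ≫ N.d0 := Hom.comm0 f
lemma hom_comm1 {M N : Curved w} (f : M ⟶ N) : M.d1 ≫ f.f0 = f.f1 ≫ N.d1 := Hom.comm1 f

/-- Two closed morphisms are homotopic if their difference is the differential of a morphism of
degree one. -/
def Homotopic {M N : Curved w} (f g : M ⟶ N) : Prop :=
  ∃ (h0 : M.M0 ⟶ N.M1) (h1 : M.M1 ⟶ N.M0),
    f.f0 - g.f0 = h0 ≫ N.d1 + M.d0 ≫ h1 ∧ f.f1 - g.f1 = h1 ≫ N.d0 + M.d1 ≫ h0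

/-- The shift. -/
def shift (M : Curved w) : Curved w where
  M0 := M.M1
  M1 := M.M0
  d0 := -M.d1
  d1 := -M.d0
  d0_d1 := by rw [Preadditive.neg_comp, Preadditive.comp_neg, neg_neg, M.d1_d0]
  d1_d0 := by rw [Preadditive.neg_comp, Preadditive.comp_neg, neg_neg, M.d0_d1]

/-- The cone of a closed morphism `f`, with differential `(m, n) ↦ (-d m, f m + d n)`. -/
def cone {M N : Curved w} (f : M ⟶ N) : Curved w where
  M0 := prod M.M1 N.M0
  M1 := prod M.M0 N.M1
  d0 := mat (-M.d1) 0 f.f1 N.d0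
  d1 := mat (-M.d0) 0 f.f0 N.d1
  d0_d1 := by
    rw [mat_comp, mul_prod]
    simp only [Preadditive.neg_comp, Preadditive.comp_neg, neg_neg, M.d1_d0, N.d0_d1,
      Limits.comp_zero, Limits.zero_comp, add_zero, zero_add, hom_comm1, neg_add_cancel, neg_zero]
  d1_d0 := by
    rw [mat_comp, mul_prod]
    simp only [Preadditive.neg_comp, Preadditive.comp_neg, neg_neg, M.d0_d1, N.d1_d0,
      Limits.comp_zero, Limits.zero_comp, add_zero, zero_add, hom_comm0, neg_add_cancel, neg_zero]

/-- A sequence `A → B → D` of presheaves of modules is short exact if it is so on all members of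
`C`. -/
def IsShortExact {A B D : PMod O} (f : A ⟶ B) (g : B ⟶ D) : Prop :=
  ∀ U, Function.Injective (f.app U) ∧ Function.Exact (f.app U) (g.app U) ∧
    Function.Surjective (g.app U)

/-- For `f : A ⟶ B` and `g : B ⟶ D` with `f ≫ g = 0`, the induced morphism from the cone of `f`
to `D`. -/
def coneDesc {A B D : Curved w} (f : A ⟶ B) (g : B ⟶ D) (h0 : f.f0 ≫ g.f0 = 0)
    (h1 : f.f1 ≫ g.f1 = 0) : cone f ⟶ D where
  f0 := snd _ _ ≫ g.f0
  f1 := snd _ _ ≫ g.f1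
  comm0 := by
    have e : mat (-A.d1) 0 f.f1 B.d0 ≫ snd _ _ ≫ g.f1 = snd _ _ ≫ g.f0 ≫ D.d0 := by
      rw [← Category.assoc, mat_snd, Preadditive.add_comp, Category.assoc, Category.assoc, h1,
        Limits.comp_zero, zero_add, hom_comm0]
    exact e
  comm1 := by
    have e : mat (-A.d0) 0 f.f0 B.d1 ≫ snd _ _ ≫ g.f0 = snd _ _ ≫ g.f1 ≫ D.d1 := by
      rw [← Category.assoc, mat_snd, Preadditive.add_comp, Category.assoc, Category.assoc, h0,
        Limits.comp_zero, zero_add, hom_comm1]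
    exact e

/-- Coacyclicity relative to a class `P` of curved modules: the smallest class of members of `P`
containing the total curved modules of the short exact sequences in `P` and closed under shifts,
cones, homotopy equivalences and coproducts. -/
inductive IsCoacyclic (P : Curved w → Prop) : Curved w → Prop
  | tot {A B D : Curved w} (hA : P A) (hB : P B) (hD : P D) (f : A ⟶ B) (g : B ⟶ D)
      (e0 : IsShortExact f.f0 g.f0) (e1 : IsShortExact f.f1 g.f1) (h0 : f.f0 ≫ g.f0 = 0)
      (h1 : f.f1 ≫ g.f1 = 0) : IsCoacyclic P (cone (coneDesc f g h0 h1))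
  | shift {M : Curved w} (hM : IsCoacyclic P M) : IsCoacyclic P (shift M)
  | cone {M N : Curved w} (f : M ⟶ N) (hM : IsCoacyclic P M) (hN : IsCoacyclic P N) :
      IsCoacyclic P (cone f)
  | equiv {M N : Curved w} (hN : P N) (f : M ⟶ N) (g : N ⟶ M) (hfg : Homotopic (f ≫ g) (𝟙 M))
      (hgf : Homotopic (g ≫ f) (𝟙 N)) (hM : IsCoacyclic P M) : IsCoacyclic P N
  | coprod {ι : Type u} (F : ι → Curved w) (c : Limits.Cofan F) (hc : Nonempty (Limits.IsColimit c))
      (hP : P c.pt) (hF : ∀ i, IsCoacyclic P (F i)) : IsCoacyclic P c.pt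

/-- The homotopy relation. -/
def homotopyRel (P : ObjectProperty (Curved w)) : HomRel P.FullSubcategory :=
  fun _ _ f g => Homotopic f.hom g.hom

/-- The homotopy category of the curved modules in `P`. -/
abbrev HoCat (P : ObjectProperty (Curved w)) : Type _ := Quotient (homotopyRel P)

/-- The morphisms of the homotopy category represented by a closed morphism with coacyclic
cone. -/
def coWeq (P : ObjectProperty (Curved w)) : MorphismProperty (HoCat P) := fun X Y φ =>
  ∃ f : X.as ⟶ Y.as, φ = (Quotient.functor (homotopyRel P)).map f ∧
    IsCoacyclic P (Curved.cone f.hom)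

/-- The coderived category: the quotient of the homotopy category by the coacyclic objects. -/
abbrev CoDer (P : ObjectProperty (Curved w)) : Type _ := (coWeq P).Localization

/-- The functor from curved modules in `P` and closed morphisms to the coderived category. -/
def toCoDer (P : ObjectProperty (Curved w)) : P.FullSubcategory ⥤ CoDer P :=
  Quotient.functor (homotopyRel P) ⋙ (coWeq P).Q

lemma toCoDer_isIso (P : ObjectProperty (Curved w)) {X Y : P.FullSubcategory} (f : X ⟶ Y)
    (hf : IsCoacyclic P (Curved.cone f.hom)) : IsIso ((toCoDer P).map f) :=
  MorphismProperty.Q_inverts (coWeq P) _ ⟨f, rfl, hf⟩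

end Curved

/-! ### Totalization -/

namespace Mixed

variable {w : GlobalFun O} (m : Mixed w)

/-- The product of the terms of even degree. -/
abbrev ev (M : PMod O) : PMod O := pi fun j => m.obj (2 * j) M

/-- The product of the terms of odd degree. -/
abbrev od (M : PMod O) : PMod O := pi fun j => m.obj (2 * j + 1) M

/-- Functoriality of the even part. -/
def evMap {M N : PMod O} (f : M ⟶ N) : m.ev M ⟶ m.ev N :=
  piLift fun j => proj _ j ≫ m.map (2 * j) f

/-- Functoriality of the odd part. -/
def odMap {M N : PMod O} (f : M ⟶ N) : m.od M ⟶ m.od N :=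
  piLift fun j => proj _ j ≫ m.map (2 * j + 1) f

/-- The raising operator from degree `2 j + 1` to degree `2 (j + 1)`. -/
def upOd (j : ℕ) (M : PMod O) : m.obj (2 * j + 1) M ⟶ m.obj (2 * (j + 1)) M := m.up (2 * j + 1) M

/-- The lowering operator from degree `2 (j + 1)` to degree `2 j + 1`. -/
def downOd (j : ℕ) (M : PMod O) : m.obj (2 * (j + 1)) M ⟶ m.obj (2 * j + 1) M :=
  m.down (2 * j + 1) M

/-- The sum of the operators, from the even part to the odd part. -/
def evOd (M : PMod O) : m.ev M ⟶ m.od M :=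
  piLift fun j => proj _ j ≫ m.up (2 * j) M + proj _ (j + 1) ≫ m.downOd j M

/-- The components of the sum of the operators, from the odd part to the even part. -/
def odEvComp (M : PMod O) : ∀ j : ℕ, m.od M ⟶ m.obj (2 * j) M
  | 0 => proj _ 0 ≫ m.down 0 M
  | j + 1 => proj _ j ≫ m.upOd j M + proj _ (j + 1) ≫ m.down (2 * (j + 1)) M

/-- The sum of the operators, from the odd part to the even part. -/
def odEv (M : PMod O) : m.od M ⟶ m.ev M := piLift (m.odEvComp M)

lemma evMap_id (M : PMod O) : m.evMap (𝟙 M) = 𝟙 _ := pi_hom_ext fun j => by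
  rw [evMap, piLift_proj, m.map_id, Category.comp_id, Category.id_comp]

lemma odMap_id (M : PMod O) : m.odMap (𝟙 M) = 𝟙 _ := pi_hom_ext fun j => by
  rw [odMap, piLift_proj, m.map_id, Category.comp_id, Category.id_comp]

lemma evMap_comp {M N P : PMod O} (f : M ⟶ N) (g : N ⟶ P) :
    m.evMap f ≫ m.evMap g = m.evMap (f ≫ g) := pi_hom_ext fun j => by
  simp only [evMap, Category.assoc, piLift_proj, piLift_proj_assoc, m.map_comp]

lemma odMap_comp {M N P : PMod O} (f : M ⟶ N) (g : N ⟶ P) :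
    m.odMap f ≫ m.odMap g = m.odMap (f ≫ g) := pi_hom_ext fun j => by
  simp only [odMap, Category.assoc, piLift_proj, piLift_proj_assoc, m.map_comp]

lemma mul_proj (F : ℕ → PMod O) (j : ℕ) :
    w.mul (pi F) ≫ proj F j = proj F j ≫ w.mul (F j) := (mul_nat w (proj F j)).symm

lemma upOd_nat (j : ℕ) {M N : PMod O} (f : M ⟶ N) :
    m.map (2 * j + 1) f ≫ m.upOd j N = m.upOd j M ≫ m.map (2 * (j + 1)) f :=
  m.up_nat (2 * j + 1) f

lemma downOd_nat (j : ℕ) {M N : PMod O} (f : M ⟶ N) :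
    m.map (2 * (j + 1)) f ≫ m.downOd j N = m.downOd j M ≫ m.map (2 * j + 1) f :=
  m.down_nat (2 * j + 1) f

lemma evOd_nat {M N : PMod O} (f : M ⟶ N) : m.evMap f ≫ m.evOd N = m.evOd M ≫ m.odMap f :=
  pi_hom_ext fun j => by
    simp only [evMap, evOd, odMap, Category.assoc, piLift_proj, piLift_proj_assoc,
      Preadditive.comp_add, Preadditive.add_comp, m.up_nat, downOd_nat]

lemma odEv_nat {M N : PMod O} (f : M ⟶ N) : m.odMap f ≫ m.odEv N = m.odEv M ≫ m.evMap f :=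
  pi_hom_ext fun j => by
    cases j with
    | zero =>
      simp only [evMap, odEv, odMap, odEvComp, Category.assoc, piLift_proj, piLift_proj_assoc,
        m.down_nat]
    | succ j =>
      simp only [evMap, odEv, odMap, odEvComp, Category.assoc, piLift_proj, piLift_proj_assoc,
        Preadditive.comp_add, Preadditive.add_comp, m.down_nat, upOd_nat]

lemma evOd_odEv (M : PMod O) :
    m.evOd M ≫ m.odEv M = w.mul (m.ev M) - m.evMap (w.mul M) := pi_hom_ext fun j => by
  rw [Category.assoc, odEv, piLift_proj, Preadditive.sub_comp, mul_proj, evMap, piLift_proj,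
    ← Preadditive.comp_sub]
  cases j with
  | zero =>
    have h1 : m.downOd 0 M ≫ m.down 0 M = 0 := m.down_down 0 M
    have h2 : m.up (2 * 0) M ≫ m.down 0 M = w.mul (m.obj (2 * 0) M) - m.map (2 * 0) (w.mul M) :=
      m.comm_zero M
    rw [odEvComp, evOd, piLift_proj_assoc, Preadditive.add_comp, Category.assoc, Category.assoc,
      h1, h2, Limits.comp_zero, add_zero]
  | succ j =>
    have h1 : m.up (2 * j) M ≫ m.upOd j M = 0 := m.up_up (2 * j) M
    have h2 : m.downOd (j + 1) M ≫ m.down (2 * (j + 1)) M = 0 := m.down_down (2 * (j + 1)) M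
    have h3 : m.up (2 * (j + 1)) M ≫ m.down (2 * (j + 1)) M + m.downOd j M ≫ m.upOd j M =
      w.mul (m.obj (2 * (j + 1)) M) - m.map (2 * (j + 1)) (w.mul M) := m.comm_succ (2 * j + 1) M
    rw [odEvComp, evOd, Preadditive.comp_add, piLift_proj_assoc, piLift_proj_assoc, ← h3]
    simp only [Preadditive.add_comp, Preadditive.comp_add, Category.assoc, h1, h2,
      Limits.comp_zero, zero_add, add_zero]
    exact add_comm _ _

lemma odEv_evOd (M : PMod O) :
    m.odEv M ≫ m.evOd M = w.mul (m.od M) - m.odMap (w.mul M) := pi_hom_ext fun j => by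
  rw [Category.assoc, evOd, piLift_proj, Preadditive.sub_comp, mul_proj, odMap, piLift_proj,
    ← Preadditive.comp_sub, odEv, Preadditive.comp_add, piLift_proj_assoc, piLift_proj_assoc]
  have h3 : m.upOd j M ≫ m.downOd j M + m.down (2 * j) M ≫ m.up (2 * j) M =
    w.mul (m.obj (2 * j + 1) M) - m.map (2 * j + 1) (w.mul M) := m.comm_succ (2 * j) M
  have h2 : m.down (2 * (j + 1)) M ≫ m.downOd j M = 0 := m.down_down (2 * j + 1) M
  cases j with
  | zero =>
    have h3' : m.upOd 0 M ≫ m.downOd 0 M + m.down 0 M ≫ m.up (2 * 0) M =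
      w.mul (m.obj (2 * 0 + 1) M) - m.map (2 * 0 + 1) (w.mul M) := h3
    rw [← h3']
    simp only [odEvComp, Preadditive.add_comp, Preadditive.comp_add, Category.assoc, h2,
      Limits.comp_zero, add_zero]
    exact add_comm _ _
  | succ j =>
    have h1 : m.upOd j M ≫ m.up (2 * (j + 1)) M = 0 := m.up_up (2 * j + 1) M
    rw [← h3]
    simp only [odEvComp, Preadditive.add_comp, Preadditive.comp_add, Category.assoc, h1, h2,
      Limits.comp_zero, zero_add, add_zero]
    exact add_comm _ _

/-- The totalization of the complexes `q ↦ F_q(E₀)` and `q ↦ F_q(E₁)` by products. The differential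
is the sum of the two operators and of `(-1)^q F_q(e)`, where `e` is the differential of `E`. -/
def fold (E : Curved w) : Curved w where
  M0 := prod (m.ev E.M0) (m.od E.M1)
  M1 := prod (m.ev E.M1) (m.od E.M0)
  d0 := mat (m.evMap E.d0) (m.odEv E.M1) (m.evOd E.M0) (-m.odMap E.d1)
  d1 := mat (m.evMap E.d1) (m.odEv E.M0) (m.evOd E.M1) (-m.odMap E.d0)
  d0_d1 := by
    rw [mat_comp, mul_prod, Preadditive.comp_neg, Preadditive.neg_comp, Preadditive.neg_comp,
      Preadditive.comp_neg, neg_neg, evMap_comp, odMap_comp, evOd_odEv, odEv_evOd, E.d0_d1,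
      E.d1_d0, evOd_nat, odEv_nat, add_neg_cancel, add_neg_cancel, add_sub_cancel, sub_add_cancel]
  d1_d0 := by
    rw [mat_comp, mul_prod, Preadditive.comp_neg, Preadditive.neg_comp, Preadditive.neg_comp,
      Preadditive.comp_neg, neg_neg, evMap_comp, odMap_comp, evOd_odEv, odEv_evOd, E.d0_d1,
      E.d1_d0, evOd_nat, odEv_nat, add_neg_cancel, add_neg_cancel, add_sub_cancel, sub_add_cancel]

/-- The augmentation of the totalization induced by an augmentation of the complex. -/
def aug (e : ∀ M, m.obj 0 M ⟶ M) (he : ∀ {M N : PMod O} (f : M ⟶ N), m.map 0 f ≫ e N = e M ≫ f)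
    (hd : ∀ M, m.down 0 M ≫ e M = 0) (E : Curved w) : m.fold E ⟶ E where
  f0 := fst _ _ ≫ proj _ 0 ≫ e E.M0
  f1 := fst _ _ ≫ proj _ 0 ≫ e E.M1
  comm0 := by
    have h : m.evMap E.d0 ≫ proj _ 0 ≫ e E.M1 = proj _ 0 ≫ e E.M0 ≫ E.d0 := by
      rw [evMap, piLift_proj_assoc, Category.assoc]
      exact congrArg (proj _ 0 ≫ ·) (he E.d0)
    have h' : m.odEv E.M1 ≫ proj _ 0 ≫ e E.M1 = 0 := by
      rw [odEv, piLift_proj_assoc, odEvComp, Category.assoc]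
      exact (congrArg (proj _ 0 ≫ ·) (hd E.M1)).trans Limits.comp_zero
    have e : mat (m.evMap E.d0) (m.odEv E.M1) (m.evOd E.M0) (-m.odMap E.d1) ≫ fst _ _ ≫
        proj _ 0 ≫ e E.M1 = fst _ _ ≫ proj _ 0 ≫ e E.M0 ≫ E.d0 := by
      rw [← Category.assoc, mat_fst, Preadditive.add_comp, Category.assoc, Category.assoc, h, h',
        Limits.comp_zero, add_zero]
    exact e
  comm1 := by
    have h : m.evMap E.d1 ≫ proj _ 0 ≫ e E.M0 = proj _ 0 ≫ e E.M1 ≫ E.d1 := by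
      rw [evMap, piLift_proj_assoc, Category.assoc]
      exact congrArg (proj _ 0 ≫ ·) (he E.d1)
    have h' : m.odEv E.M0 ≫ proj _ 0 ≫ e E.M0 = 0 := by
      rw [odEv, piLift_proj_assoc, odEvComp, Category.assoc]
      exact (congrArg (proj _ 0 ≫ ·) (hd E.M0)).trans Limits.comp_zero
    have e : mat (m.evMap E.d1) (m.odEv E.M0) (m.evOd E.M1) (-m.odMap E.d0) ≫ fst _ _ ≫
        proj _ 0 ≫ e E.M0 = fst _ _ ≫ proj _ 0 ≫ e E.M1 ≫ E.d1 := by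
      rw [← Category.assoc, mat_fst, Preadditive.add_comp, Category.assoc, Category.assoc, h, h',
        Limits.comp_zero, add_zero]
    exact e

end Mixed

/-- The morphism on even and odd parts with components `g`. -/
def foldComp {m m' : ℕ → PMod O → PMod O} (g : ∀ q M, m q M ⟶ m' q M) (M N : PMod O) :
    prod (pi fun j => m (2 * j) M) (pi fun j => m (2 * j + 1) N) ⟶
      prod (pi fun j => m' (2 * j) M) (pi fun j => m' (2 * j + 1) N) :=
  mat (piLift fun j => proj _ j ≫ g (2 * j) M) 0 0 (piLift fun j => proj _ j ≫ g (2 * j + 1) N)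

/-- The degreewise morphisms `g` form a closed morphism of totalizations. -/
def IsClosedFamily {w : GlobalFun O} {m m' : Mixed w} (g : ∀ q M, m.obj q M ⟶ m'.obj q M)
    (E : Curved w) : Prop :=
  (m.fold E).d0 ≫ foldComp g E.M1 E.M0 = foldComp g E.M0 E.M1 ≫ (m'.fold E).d0 ∧
    (m.fold E).d1 ≫ foldComp g E.M0 E.M1 = foldComp g E.M1 E.M0 ≫ (m'.fold E).d1

/-- The closed morphism of totalizations with the components `g`. -/
def foldHom {w : GlobalFun O} {m m' : Mixed w} (g : ∀ q M, m.obj q M ⟶ m'.obj q M)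
    (E : Curved w) (h : IsClosedFamily g E) : m.fold E ⟶ m'.fold E where
  f0 := foldComp g E.M0 E.M1
  f1 := foldComp g E.M1 E.M0
  comm0 := h.1
  comm1 := h.2

/-! ### Tensor products, duals and Hom of curved modules -/

namespace PMod

variable {K K' K'' M M' M'' N : PMod O}

lemma tmap_comp (f : K ⟶ K') (g : M ⟶ M') (f' : K' ⟶ K'') (g' : M' ⟶ M'') :
    tmap f g ≫ tmap f' g' = tmap (f ≫ f') (g ≫ g') := tens_hom_ext fun _ _ _ => rfl

lemma tmap_neg_right (f : K ⟶ K') (g : M ⟶ M') : tmap f (-g) = -tmap f g :=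
  tens_hom_ext fun U a b => by simp [tmk_neg_right]

lemma tmap_mul_left (w : GlobalFun O) (K M : PMod O) :
    tmap (w.mul K) (𝟙 M) = w.mul (tens K M) := tens_hom_ext fun U a b => by
  simp [tmk_smul_left]

lemma tmap_mul_right (w : GlobalFun O) (K M : PMod O) :
    tmap (𝟙 K) (w.mul M) = w.mul (tens K M) := tens_hom_ext fun U a b => by
  simp [tmk_smul_right]

lemma mul_neg_fun (w : GlobalFun O) (M : PMod O) : (-w).mul M = -w.mul M :=
  hom_ext' fun U x => by simp

lemma mat_sq {A B A' B' D D' F F' : PMod O} {a : A ⟶ A'} {b : B ⟶ A'} {c : A ⟶ B'} {d : B ⟶ B'}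
    {p : A' ⟶ D'} {q : B' ⟶ F'} {r : A ⟶ D} {s : B ⟶ F} {a' : D ⟶ D'} {b' : F ⟶ D'} {c' : D ⟶ F'}
    {d' : F ⟶ F'} (ha : a ≫ p = r ≫ a') (hb : b ≫ p = s ≫ b') (hc : c ≫ q = r ≫ c')
    (hd : d ≫ q = s ≫ d') : mat a b c d ≫ mat p 0 0 q = mat r 0 0 s ≫ mat a' b' c' d' := by
  simp only [mat_comp, ha, hb, hc, hd, Limits.comp_zero, Limits.zero_comp, add_zero, zero_add]

lemma neg_sq {A B D F : PMod O} {a : A ⟶ B} {b : B ⟶ D} {c : A ⟶ F} {d : F ⟶ D}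
    (h : a ≫ b = c ≫ d) : (-a) ≫ b = c ≫ (-d) := by
  rw [Preadditive.neg_comp, Preadditive.comp_neg, h]

lemma tmap_sq {f : K ⟶ K'} {g : M ⟶ M'} : tmap f (𝟙 M) ≫ tmap (𝟙 K') g =
    tmap (𝟙 K) g ≫ tmap f (𝟙 M') := tens_hom_ext fun _ _ _ => rfl

lemma tmap_id_sq {f : K ⟶ K'} {g : K' ⟶ N} {f' : K ⟶ K''} {g' : K'' ⟶ N} (h : f ≫ g = f' ≫ g')
    (M : PMod O) : tmap f (𝟙 M) ≫ tmap g (𝟙 M) = tmap f' (𝟙 M) ≫ tmap g' (𝟙 M) := by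
  rw [tmap_comp, tmap_comp, h]

lemma mul_zero_fun (M : PMod O) : (0 : GlobalFun O).mul M = 0 := hom_ext' fun U x => by simp

end PMod

namespace Curved

variable {w : GlobalFun O}

/-- The dual of a curved module, with differential `ξ ↦ -(-1)^{|ξ|} ξ ∘ d`. -/
def dual (E : Curved w) : Curved (-w) where
  M0 := ihom E.M0 (unit O)
  M1 := ihom E.M1 (unit O)
  d0 := -ipre (unit O) E.d1
  d1 := ipre (unit O) E.d0
  d0_d1 := by rw [Preadditive.neg_comp, ipre_comp, E.d0_d1, ipre_mul, mul_neg_fun]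
  d1_d0 := by rw [Preadditive.comp_neg, ipre_comp, E.d1_d0, ipre_mul, mul_neg_fun]

/-- The tensor product of curved modules with opposite curvatures, with differential
`m ⊗ ξ ↦ d m ⊗ ξ + (-1)^{|m|} m ⊗ d ξ`. -/
def tensor (M : Curved w) (V : Curved (-w)) : Curved (0 : GlobalFun O) where
  M0 := prod (tens M.M0 V.M0) (tens M.M1 V.M1)
  M1 := prod (tens M.M1 V.M0) (tens M.M0 V.M1)
  d0 := mat (tmap M.d0 (𝟙 _)) (-tmap (𝟙 _) V.d1) (tmap (𝟙 _) V.d0) (tmap M.d1 (𝟙 _))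
  d1 := mat (tmap M.d1 (𝟙 _)) (tmap (𝟙 _) V.d1) (-tmap (𝟙 _) V.d0) (tmap M.d0 (𝟙 _))
  d0_d1 := by
    simp only [mat_comp, mul_zero_fun, Preadditive.neg_comp, Preadditive.comp_neg, tmap_comp,
      Category.comp_id, Category.id_comp, M.d0_d1, M.d1_d0, V.d0_d1, V.d1_d0, mul_neg_fun,
      tmap_neg_right, tmap_mul_left, tmap_mul_right, neg_neg, add_neg_cancel, neg_add_cancel]
    exact mat_zero
  d1_d0 := by
    simp only [mat_comp, mul_zero_fun, Preadditive.neg_comp, Preadditive.comp_neg, tmap_comp,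
      Category.comp_id, Category.id_comp, M.d0_d1, M.d1_d0, V.d0_d1, V.d1_d0, mul_neg_fun,
      tmap_neg_right, tmap_mul_left, tmap_mul_right, neg_neg, add_neg_cancel, neg_add_cancel]
    exact mat_zero

/-- Functoriality of the tensor product in the first variable. -/
def tensorMap {M N : Curved w} (f : M ⟶ N) (V : Curved (-w)) : tensor M V ⟶ tensor N V where
  f0 := mat (tmap f.f0 (𝟙 _)) 0 0 (tmap f.f1 (𝟙 _))
  f1 := mat (tmap f.f1 (𝟙 _)) 0 0 (tmap f.f0 (𝟙 _))
  comm0 := mat_sq (tmap_id_sq (hom_comm0 f) _) (neg_sq tmap_sq.symm) tmap_sq.symm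
    (tmap_id_sq (hom_comm1 f) _)
  comm1 := mat_sq (tmap_id_sq (hom_comm1 f) _) tmap_sq.symm (neg_sq tmap_sq.symm)
    (tmap_id_sq (hom_comm0 f) _)

/-- The complex of morphisms, with differential `f ↦ d ∘ f - (-1)^{|f|} f ∘ d`. -/
def homC (E N : Curved w) : Curved (0 : GlobalFun O) where
  M0 := prod (ihom E.M0 N.M0) (ihom E.M1 N.M1)
  M1 := prod (ihom E.M0 N.M1) (ihom E.M1 N.M0)
  d0 := mat (ipost _ N.d0) (-ipre _ E.d0) (-ipre _ E.d1) (ipost _ N.d1)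
  d1 := mat (ipost _ N.d1) (ipre _ E.d0) (ipre _ E.d1) (ipost _ N.d0)
  d0_d1 := by
    simp only [mat_comp, mul_zero_fun, Preadditive.neg_comp, ipost_comp,
      ipre_comp, ipre_ipost, E.d0_d1, E.d1_d0, N.d0_d1, N.d1_d0, ipost_mul, ipre_mul,
      add_neg_cancel, neg_add_cancel]
    exact mat_zero
  d1_d0 := by
    simp only [mat_comp, mul_zero_fun, Preadditive.comp_neg, ipost_comp,
      ipre_comp, ipre_ipost, E.d0_d1, E.d1_d0, N.d0_d1, N.d1_d0, ipost_mul, ipre_mul,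
      add_neg_cancel, neg_add_cancel]
    exact mat_zero

lemma canHom_post {K M N : PMod O} (g : M ⟶ N) :
    tmap g (𝟙 _) ≫ canHom K N = canHom K M ≫ ipost K g := tens_hom_ext fun U m ξ =>
  iext fun V h x => by
    simp only [comp_app, tmap_app, ipost_app, canHom_app, id_app, map_smul, hom_nat]

lemma canHom_pre {K K' M : PMod O} (g : K' ⟶ K) :
    tmap (𝟙 M) (ipre (unit O) g) ≫ canHom K' M = canHom K M ≫ ipre M g :=
  tens_hom_ext fun _ _ _ => iext fun _ _ _ => rfl

lemma canHom_pre_neg {K K' M : PMod O} (g : K' ⟶ K) :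
    tmap (𝟙 M) (-ipre (unit O) g) ≫ canHom K' M = canHom K M ≫ (-ipre M g) := by
  rw [tmap_neg_right]
  exact neg_sq (canHom_pre g)

lemma canHom_pre_neg_neg {K K' M : PMod O} (g : K' ⟶ K) :
    (-tmap (𝟙 M) (-ipre (unit O) g)) ≫ canHom K' M = canHom K M ≫ ipre M g := by
  rw [tmap_neg_right, neg_neg]
  exact canHom_pre g

/-- The morphism `M ⊗ E^∨ ⟶ Hom(E, M)`. -/
def can (E M : Curved w) : tensor M E.dual ⟶ homC E M where
  f0 := mat (canHom E.M0 M.M0) 0 0 (canHom E.M1 M.M1)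
  f1 := mat (canHom E.M0 M.M1) 0 0 (canHom E.M1 M.M0)
  comm0 := mat_sq (canHom_post _) (neg_sq (canHom_pre _)) (canHom_pre_neg _) (canHom_post _)
  comm1 := mat_sq (canHom_post _) (canHom_pre _) (canHom_pre_neg_neg _) (canHom_post _)

/-- The structure presheaf in degree zero. -/
def unitC (O : AlgPresheaf k C) : Curved (0 : GlobalFun O) where
  M0 := unit O
  M1 := zero O
  d0 := 0
  d1 := 0
  d0_d1 := by rw [mul_zero_fun, Limits.comp_zero]
  d1_d0 := by rw [mul_zero_fun, Limits.comp_zero]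

/-- The morphism of presheaves of modules `a ↦ a • s`. -/
def secHom {N : PMod O} (s : ∀ U, N.obj U) (hs : ∀ {U V : C} (h : V ≤ U), N.res h (s U) = s V) :
    unit O ⟶ N where
  app U := LinearMap.toSpanSingleton (O.ring U) (N.obj U) (s U)
  naturality {U V} h x := by
    have e : N.res h ((@id (O.ring U) x) • s U) = O.res h x • s V := by rw [N.res_smul, hs]; rfl
    exact e.symm

lemma secHom_comp {N P : PMod O} (s : ∀ U, N.obj U)
    (hs : ∀ {U V : C} (h : V ≤ U), N.res h (s U) = s V) (g : N ⟶ P)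
    (hg : ∀ U, g.app U (s U) = 0) : secHom s hs ≫ g = 0 := hom_ext' fun U x => by
  refine ((g.app U).map_smul (@id (O.ring U) x) (s U)).trans ?_
  rw [hg, smul_zero]
  rfl

/-- The morphism from the unit defined by a closed global section of even degree. -/
def ofSection {N : Curved (0 : GlobalFun O)} (s : ∀ U, N.M0.obj U)
    (hs : ∀ {U V : C} (h : V ≤ U), N.M0.res h (s U) = s V) (hd : ∀ U, N.d0.app U (s U) = 0) :
    unitC O ⟶ N where
  f0 := secHom s hs
  f1 := (0 : zero O ⟶ N.M1)
  comm0 := ((secHom_comp s hs N.d0 hd).trans Limits.zero_comp.symm).symm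
  comm1 := (Limits.zero_comp (f := secHom s hs)).trans Limits.zero_comp.symm

end Curved

/-! ### Exponentials -/

section Exponential

variable (O)

/-- The coefficient `1 / q!` for `q ≤ n`, and zero for `q > n`. -/
def ifac (k : Type u) [Field k] (n q : ℕ) : k := if q ≤ n then (Nat.factorial q : k)⁻¹ else 0

variable {O}

/-- The map `ω₁ ⊗ ⋯ ⊗ ω_q ⊗ s ↦ (ω₁ ∧ ⋯ ∧ ω_q) ⊗ ε s`. -/
def atWedge : ∀ (n q : ℕ) (M : PMod O), atObj n q M ⟶ tens (lam O q) M
  | n, 0, M => atEps n M ≫ lamOne M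
  | 0, q + 1, M => (0 : zero O ⟶ tens (lam O (q + 1)) M)
  | n + 1, q + 1, M => om (atWedge n q M) ≫ wedge q M

/-- The map `ω₁ ⊗ ⋯ ⊗ ω_q ⊗ s ↦ (1 / q!) (ω₁ ∧ ⋯ ∧ ω_q) ⊗ ε s`. -/
def atExp (n q : ℕ) (M : PMod O) : atObj n q M ⟶ tens (lam O q) M :=
  csmul (ifac k n q) (atWedge n q M)

/-- The map `a₀ ⊗ ⋯ ⊗ a_q ⊗ x ↦ (a₀ da₁ ∧ ⋯ ∧ da_q) ⊗ x`. -/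
def barWedge : ∀ (q : ℕ) (M : PMod O), barObj (q + 1) M ⟶ tens (lam O q) M
  | 0, M => act M ≫ lamOne M
  | q + 1, M => kap (barObj q M) ≫ om (barWedge q M) ≫ wedge q M

/-- The map `a₀ ⊗ ⋯ ⊗ a_q ⊗ x ↦ (1 / q!) (a₀ da₁ ∧ ⋯ ∧ da_q) ⊗ x`. -/
def barExp (n q : ℕ) (M : PMod O) : barObj (q + 1) M ⟶ tens (lam O q) M :=
  csmul (ifac k n q) (barWedge q M)

end Exponential

/-- The Atiyah curved module of `E`. -/
def atiyah {w : GlobalFun O} (n : ℕ) (E : Curved w) : Curved w := (atMixed w n).fold E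

/-- The curved bar complex of `E`. -/
def bar {w : GlobalFun O} (E : Curved w) : Curved w := (barMixed w).fold E

/-- The curved module `Ω_dw ⊗ E`. -/
def omegaTensor {w : GlobalFun O} (E : Curved w) : Curved w := (omegaMixed w).fold E

/-- The augmentation of the Atiyah curved module. -/
def atiyahAug {w : GlobalFun O} (n : ℕ) (E : Curved w) : atiyah n E ⟶ E :=
  (atMixed w n).aug (atEps n) (atEps_nat n) (atDown_eps n) E

/-- The augmentation of the curved bar complex. -/
def barAug {w : GlobalFun O} (E : Curved w) : bar E ⟶ E :=
  (barMixed w).aug act act_nat bdS_act E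

/-! ### The complex of differential forms with differential `dw ∧ -` -/

namespace PMod

/-- The map `dw ∧ -` on forms. -/
def dwLam (w : GlobalFun O) (q : ℕ) : lam O q ⟶ lam O (q + 1) where
  app U := ewedge q U (dw w U)
  naturality h x := by rw [← ewedge_res, res_dw]

lemma dwLam_dwLam (w : GlobalFun O) (q : ℕ) : dwLam w q ≫ dwLam w (q + 1) = 0 :=
  hom_ext' fun U x => ewedge_self q U (dw w U) x

lemma contrLin_dw (w : GlobalFun O) (K : PMod O) (q : ℕ) (U : C) (ξ : (ihom K (unit O)).obj U)
    (t : (tens (lam O q) K).obj U) : contrLin (lam O (q + 1)) K U ξ ((dwWedge w q K).app U t) =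
      (dwLam w q).app U (contrLin (lam O q) K U ξ t) :=
  tens_induction (p := fun t => contrLin (lam O (q + 1)) K U ξ ((dwWedge w q K).app U t) =
      (dwLam w q).app U (contrLin (lam O q) K U ξ t)) t
    (fun a b => by rw [dwWedge_app, contrLin_tmk, contrLin_tmk, map_smul]; rfl)
    (by simp only [map_zero]) fun s t hs ht => by simp only [map_add, hs, ht]

end PMod

/-- The components of `dw ∧ -` from odd to even forms. -/
def omegaComp (w : GlobalFun O) : ∀ j : ℕ, (pi fun j => lam O (2 * j + 1)) ⟶ lam O (2 * j)
  | 0 => 0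
  | j + 1 => proj _ j ≫ dwLam w (2 * j + 1)

/-- The `ℤ/2`-graded complex of differential forms with differential `dw ∧ -`. -/
def omegaC (w : GlobalFun O) : Curved (0 : GlobalFun O) where
  M0 := pi fun j => lam O (2 * j)
  M1 := pi fun j => lam O (2 * j + 1)
  d0 := piLift fun j => proj _ j ≫ dwLam w (2 * j)
  d1 := piLift (omegaComp w)
  d0_d1 := by
    rw [mul_zero_fun]
    refine pi_hom_ext fun j => ?_
    rw [Category.assoc, piLift_proj, Limits.zero_comp]
    cases j with
    | zero => exact Limits.comp_zero
    | succ j =>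
      have h : dwLam w (2 * j) ≫ (dwLam w (2 * j + 1) : _ ⟶ lam O (2 * (j + 1))) = 0 :=
        dwLam_dwLam w (2 * j)
      rw [omegaComp, piLift_proj_assoc, Category.assoc]
      exact (congrArg (proj _ j ≫ ·) h).trans Limits.comp_zero
  d1_d0 := by
    rw [mul_zero_fun]
    refine pi_hom_ext fun j => ?_
    rw [Category.assoc, piLift_proj, Limits.zero_comp, piLift_proj_assoc]
    cases j with
    | zero => exact Limits.zero_comp
    | succ j =>
      have h : (dwLam w (2 * j + 1) : _ ⟶ lam O (2 * (j + 1))) ≫ dwLam w (2 * (j + 1)) = 0 :=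
        dwLam_dwLam w (2 * j + 1)
      rw [omegaComp, Category.assoc]
      exact (congrArg (proj _ j ≫ ·) h).trans Limits.comp_zero

/-- The componentwise contraction. -/
def contrPi {K M : PMod O} {F : ℕ → PMod O} (h : M ⟶ pi fun j => tens (F j) K) :
    tens M (ihom K (unit O)) ⟶ pi F :=
  piLift fun j => tmap (h ≫ proj _ j) (𝟙 _) ≫ contr (F j) K

lemma contrPi_app {K M : PMod O} {F : ℕ → PMod O} (h : M ⟶ pi fun j => tens (F j) K) (U : C)
    (x : M.obj U) (ξ : (ihom K (unit O)).obj U) (j : ℕ) :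
    (contrPi h).app U (tmk _ _ U x ξ) j = contrLin (F j) K U ξ (h.app U x j) := rfl

lemma sub_sq {A B A' B' P P' : PMod O} {a : A ⟶ A'} {b : B ⟶ A'} {c : A ⟶ B'} {d : B ⟶ B'}
    {f : A' ⟶ P} {g : B' ⟶ P} {f' : A ⟶ P'} {g' : B ⟶ P'} {D : P' ⟶ P}
    (h1 : a ≫ f - c ≫ g = f' ≫ D) (h2 : d ≫ g - b ≫ f = g' ≫ D) :
    mat a b c d ≫ (fst A' B' ≫ f - snd A' B' ≫ g) = (fst A B ≫ f' - snd A B ≫ g') ≫ D := by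
  rw [Preadditive.comp_sub, ← Category.assoc, ← Category.assoc, mat_fst, mat_snd,
    Preadditive.sub_comp, Category.assoc, Category.assoc, ← h1, ← h2]
  simp only [Preadditive.add_comp, Preadditive.comp_sub, Category.assoc]
  abel

section Identities

variable (w : GlobalFun O) (q : ℕ) {K K' : PMod O} (f : K' ⟶ K) (U : C)
  (ξ : (ihom K (unit O)).obj U)

lemma contr_even (p : (tens (lam O q) K).obj U) (r : (tens (lam O (q + 1)) K').obj U) :
    contrLin (lam O (q + 1)) K U ξ ((dwWedge w q K).app U p + 0 +
        -((tmap (𝟙 (lam O (q + 1))) f).app U r)) -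
      contrLin (lam O (q + 1)) K' U (-((ipre (unit O) f).app U ξ)) r =
      (dwLam w q).app U (contrLin (lam O q) K U ξ p) := by
  rw [map_add, map_neg, add_zero, contrLin_map, contrLin_neg, contrLin_dw]
  abel

lemma contr_even_pos (p : (tens (lam O q) K).obj U) (r : (tens (lam O (q + 1)) K').obj U) :
    contrLin (lam O (q + 1)) K U ξ ((dwWedge w q K).app U p + 0 +
        -((tmap (𝟙 (lam O (q + 1))) f).app U r)) +
      contrLin (lam O (q + 1)) K' U ((ipre (unit O) f).app U ξ) r =
      (dwLam w q).app U (contrLin (lam O q) K U ξ p) := by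
  rw [map_add, map_neg, add_zero, contrLin_map, contrLin_dw]
  abel

lemma contr_zero (L : PMod O) (p : (tens L K').obj U) :
    contrLin L K U ξ ((tmap (𝟙 L) f).app U p + 0) +
      contrLin L K' U (-((ipre (unit O) f).app U ξ)) p = 0 := by
  rw [add_zero, contrLin_map, contrLin_neg]
  abel

lemma contr_zero_pos (L : PMod O) (p : (tens L K').obj U) :
    contrLin L K U ξ ((tmap (𝟙 L) f).app U p + 0) -
      contrLin L K' U ((ipre (unit O) f).app U ξ) p = 0 := by
  rw [add_zero, contrLin_map]
  abel

lemma contr_succ (p : (tens (lam O (q + 1)) K').obj U) (r : (tens (lam O q) K).obj U) :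
    contrLin (lam O (q + 1)) K U ξ ((tmap (𝟙 (lam O (q + 1))) f).app U p +
        ((dwWedge w q K).app U r + 0)) +
      contrLin (lam O (q + 1)) K' U (-((ipre (unit O) f).app U ξ)) p =
      (dwLam w q).app U (contrLin (lam O q) K U ξ r) := by
  rw [map_add, add_zero, contrLin_map, contrLin_neg, contrLin_dw]
  abel

lemma contr_succ_pos (p : (tens (lam O (q + 1)) K').obj U) (r : (tens (lam O q) K).obj U) :
    contrLin (lam O (q + 1)) K U ξ ((tmap (𝟙 (lam O (q + 1))) f).app U p +
        ((dwWedge w q K).app U r + 0)) -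
      contrLin (lam O (q + 1)) K' U ((ipre (unit O) f).app U ξ) p =
      (dwLam w q).app U (contrLin (lam O q) K U ξ r) := by
  rw [map_add, add_zero, contrLin_map, contrLin_dw]
  abel

lemma sub_neg_comp {A B P : PMod O} {x y : A ⟶ P} {c : A ⟶ B} {g : B ⟶ P}
    (h : x + c ≫ g = y) : x - (-c) ≫ g = y := by
  rw [Preadditive.neg_comp, sub_neg_eq_add, h]

end Identities

/-- The contraction `(ω ⊗ x) ⊗ ξ ↦ (-1)^{|x|} ξ x • ω`. -/
def contrC {w : GlobalFun O} (E : Curved w) :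
    Curved.tensor (omegaTensor E) E.dual ⟶ omegaC w where
  f0 := fst _ _ ≫ contrPi (fst _ _) - snd _ _ ≫ contrPi (fst _ _)
  f1 := fst _ _ ≫ contrPi (snd _ _) - snd _ _ ≫ contrPi (snd _ _)
  comm0 := by
    refine sub_sq ?_ (sub_neg_comp ?_)
    · exact tens_hom_ext fun U x ξ => funext fun j =>
        contr_even w (2 * j) E.d1 U ξ (x.1 j) (x.2 j)
    · exact tens_hom_ext fun U x ξ => funext fun j =>
        contr_even_pos w (2 * j) E.d0 U ξ (x.1 j) (x.2 j)
  comm1 := by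
    refine sub_sq (sub_neg_comp ?_) ?_
    · refine tens_hom_ext fun U x ξ => funext fun j => ?_
      cases j with
      | zero => exact contr_zero E.d1 U ξ (lam O 0) (x.1 0)
      | succ j => exact contr_succ w (2 * j + 1) E.d1 U ξ (x.1 (j + 1)) (x.2 j)
    · refine tens_hom_ext fun U x ξ => funext fun j => ?_
      cases j with
      | zero => exact contr_zero_pos E.d0 U ξ (lam O 0) (x.1 0)
      | succ j => exact contr_succ_pos w (2 * j + 1) E.d0 U ξ (x.1 (j + 1)) (x.2 j)

/-! ### Connections -/

/-- A connection on a presheaf of modules. -/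
structure Connection (M : PMod O) where
  nabla : ∀ U, M.obj U →+ (tens (Om O) M).obj U
  leibniz : ∀ (U : C) (a : O.ring U) (x : M.obj U),
    nabla U (a • x) = tmk (Om O) M U (dd U a) x + a • nabla U x
  res_nabla : ∀ {U V : C} (h : V ≤ U) (x : M.obj U),
    nabla V (M.res h x) = (tens (Om O) M).res h (nabla U x)

/-- The commutator `∇ ∘ f - (1 ⊗ f) ∘ ∇`, which is `O`-linear. -/
def Connection.comm {M N : PMod O} (a : Connection M) (b : Connection N) (f : M ⟶ N) :
    M ⟶ tens (Om O) N where
  app U :=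
    { toFun := fun x => b.nabla U (f.app U x) - (om f).app U (a.nabla U x)
      map_add' := fun x y => by simp only [map_add]; abel
      map_smul' := fun r x => by
        rw [map_smul, b.leibniz, a.leibniz, map_add, om_app, map_smul, RingHom.id_apply, smul_sub]
        abel }
  naturality h x := by
    change b.nabla _ (f.app _ (M.res h x)) - (om f).app _ (a.nabla _ (M.res h x)) =
      (tens (Om O) N).res h (b.nabla _ (f.app _ x) - (om f).app _ (a.nabla _ x))
    rw [hom_nat, b.res_nabla, a.res_nabla, hom_nat, map_sub]

/-- For `S : M ⟶ Ω ⊗ N` and `T : N ⟶ Ω ⊗ M`, the power of degree `2 j` of the endomorphism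
`(S, T)` of `M ⊕ N`, as a morphism `M ⟶ ⋀^{2 j} Ω ⊗ M`. -/
def powEv {M N : PMod O} (S : M ⟶ tens (Om O) N) (T : N ⟶ tens (Om O) M) :
    ∀ j : ℕ, M ⟶ tens (lam O (2 * j)) M
  | 0 => lamOne M
  | j + 1 => S ≫ om (T ≫ om (powEv S T j) ≫ wedge (2 * j) M) ≫ wedge (2 * j + 1) M

/-- The power of degree `2 j + 1`, as a morphism `M ⟶ ⋀^{2 j + 1} Ω ⊗ N`. -/
def powOd {M N : PMod O} (S : M ⟶ tens (Om O) N) (T : N ⟶ tens (Om O) M) (j : ℕ) :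
    M ⟶ tens (lam O (2 * j + 1)) N := S ≫ om (powEv T S j) ≫ wedge (2 * j) N

/-- The exponential `∑_{i ≤ n} (S, T)^i / i!`, restricted to `M`. -/
def expPow {M N : PMod O} (n : ℕ) (S : M ⟶ tens (Om O) N) (T : N ⟶ tens (Om O) M) :
    M ⟶ prod (pi fun j => tens (lam O (2 * j)) M) (pi fun j => tens (lam O (2 * j + 1)) N) :=
  pair (piLift fun j => csmul (ifac k n (2 * j)) (powEv S T j))
    (piLift fun j => csmul (ifac k n (2 * j + 1)) (powOd S T j))

/-- The components of `∑_{i ≤ n} [∇, e]^i / i!` on the even part of `E`. -/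
def expNabla0 {w : GlobalFun O} (n : ℕ) (E : Curved w) (c0 : Connection E.M0)
    (c1 : Connection E.M1) : E.M0 ⟶ (omegaTensor E).M0 :=
  expPow n (c0.comm c1 E.d0) (c1.comm c0 E.d1)

/-- The components of `∑_{i ≤ n} [∇, e]^i / i!` on the odd part of `E`. -/
def expNabla1 {w : GlobalFun O} (n : ℕ) (E : Curved w) (c0 : Connection E.M0)
    (c1 : Connection E.M1) : E.M1 ⟶ (omegaTensor E).M1 :=
  expPow n (c1.comm c0 E.d1) (c0.comm c1 E.d0)

/-- The trace `(P → L ⊗ P) → L`: the contraction on `P^* ⊗ (L ⊗ P)`, transported along the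
canonical map `P^* ⊗ (L ⊗ P) → Hom(P, L ⊗ P)`, which is bijective if `P` is finite projective. -/
def ptrace {R P L : Type u} [CommRing R] [AddCommGroup P] [AddCommGroup L] [Module R P]
    [Module R L] (f : P →ₗ[R] L ⊗[R] P) : L :=
  TensorProduct.lift (((TensorProduct.rid R L).toLinearMap.compRight R).comp
    (LinearMap.lTensorHom (R := R) (N := P) (P := R) L))
    (Function.invFun (dualTensorHom R P (L ⊗[R] P)) f)

/-- The supertrace over `U` of a pair of morphisms `E_i ⟶ (Ω ⊗ E)_i`; its component in degree
`2 j`. -/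
def strComp {w : GlobalFun O} {E : Curved w} (f0 : E.M0 ⟶ (omegaTensor E).M0)
    (f1 : E.M1 ⟶ (omegaTensor E).M1) (U : C) (j : ℕ) : (lam O (2 * j)).obj U :=
  ptrace (R := O.ring U) (P := E.M0.obj U) (L := (lam O (2 * j)).obj U)
      ((f0 ≫ fst _ _ ≫ proj (fun j => tens (lam O (2 * j)) E.M0) j).app U) -
    ptrace (R := O.ring U) (P := E.M1.obj U) (L := (lam O (2 * j)).obj U)
      ((f1 ≫ fst _ _ ≫ proj (fun j => tens (lam O (2 * j)) E.M1) j).app U)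

/-- The supertrace over `U`, an even differential form. -/
def str {w : GlobalFun O} {E : Curved w} (f0 : E.M0 ⟶ (omegaTensor E).M0)
    (f1 : E.M1 ⟶ (omegaTensor E).M1) (U : C) : (omegaC w).M0.obj U := fun j => strComp f0 f1 U j

/-! ### The exponential of the Atiyah class -/

/-- The morphism `Exp(at(E))` in the coderived category of the class `P`, represented by the roof
`E ← At(E) → Ω_dw ⊗ E`. -/
def expAt {w : GlobalFun O} (P : ObjectProperty (Curved w)) (n : ℕ) (E : Curved w) (hE : P E)
    (hA : P (atiyah n E)) (hT : P (omegaTensor E))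
    (hπ : Curved.IsCoacyclic P (Curved.cone (atiyahAug n E)))
    (hc : IsClosedFamily (m := atMixed w n) (m' := omegaMixed w) (atExp n) E) :
    (Curved.toCoDer P).obj ⟨E, hE⟩ ⟶ (Curved.toCoDer P).obj ⟨omegaTensor E, hT⟩ :=
  let p : (⟨atiyah n E, hA⟩ : P.FullSubcategory) ⟶ ⟨E, hE⟩ := ObjectProperty.homMk (atiyahAug n E)
  let f : (⟨atiyah n E, hA⟩ : P.FullSubcategory) ⟶ ⟨omegaTensor E, hT⟩ :=
    ObjectProperty.homMk (foldHom (m := atMixed w n) (m' := omegaMixed w) (atExp n) E hc)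
  haveI := Curved.toCoDer_isIso P p hπ
  inv ((Curved.toCoDer P).map p) ≫ (Curved.toCoDer P).map f

/-! ### The boundary bulk map -/

/-- The identity of a presheaf of modules as a section of the internal Hom. -/
def idSec (K : PMod O) (U : C) : (ihom K K).obj U := imk U (fun _ _ => LinearMap.id) fun _ _ _ => rfl

/-- The identity of `E`, as a morphism from the unit to the complex of endomorphisms. -/
def idC {w : GlobalFun O} (E : Curved w) : Curved.unitC O ⟶ Curved.homC E E :=
  Curved.ofSection (N := Curved.homC E E) (fun U => (idSec E.M0 U, idSec E.M1 U)) (fun _ => rfl)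
    fun _ => Prod.ext
      (iext fun V _ x => add_neg_cancel (E.d0.app V x))
      (iext fun V _ x => neg_add_cancel (E.d1.app V x))

/-- The morphism `B ⊗ E^∨ ⟶ E ⊗ E^∨ ⟶ Hom(E, E)`, for the curved bar complex `B` of `E`. -/
def barToEnd {w : GlobalFun O} (E : Curved w) :
    Curved.tensor (bar E) E.dual ⟶ Curved.homC E E :=
  Curved.tensorMap (barAug E) E.dual ≫ Curved.can E E

/-- The morphism `B ⊗ E^∨ ⟶ Ω_dw` with components
`(a₀ ⊗ ⋯ ⊗ a_q ⊗ x) ⊗ ξ ↦ (-1)^{|x|} (1 / q!) ξ x • a₀ da₁ ∧ ⋯ ∧ da_q`. -/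
def barToForms {w : GlobalFun O} (n : ℕ) (E : Curved w)
    (hc : IsClosedFamily (m := barMixed w) (m' := omegaMixed w) (barExp n) E) :
    Curved.tensor (bar E) E.dual ⟶ omegaC w :=
  Curved.tensorMap (foldHom (m := barMixed w) (m' := omegaMixed w) (barExp n) E hc) E.dual ≫ contrC E

/-! ### Schemes -/

section Schemes

open AlgebraicGeometry

lemma presheaf_map_map (X : Scheme.{u}) {U V W : X.Opens} (h : V ≤ U) (h' : W ≤ V)
    (a : Γ(X, U)) : (X.presheaf.map (homOfLE h').op).hom ((X.presheaf.map (homOfLE h).op).hom a) =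
      (X.presheaf.map (homOfLE (h'.trans h)).op).hom a := by
  rw [← CommRingCat.comp_apply, ← Functor.map_comp, ← op_comp, homOfLE_comp]

variable (X : Scheme.{u}) [X.Over (Spec (.of k))]

/-- The homomorphism from `k` to the ring of functions on `U`. -/
def scalars (U : X.Opens) : k →+* Γ(X, U) :=
  (X.presheaf.map (homOfLE le_top).op).hom.comp
    ((X ↘ Spec (.of k)).appTop.hom.comp (Scheme.ΓSpecIso (.of k)).inv.hom)

variable (k) in
/-- The structure sheaf of `X` on the affine opens, as a presheaf of `k`-algebras. -/
def affO : AlgPresheaf k X.affineOpens where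
  ring U := Γ(X, U.1)
  algebra U := (scalars X U.1).toAlgebra
  res {U V} h :=
    letI := (scalars (k := k) X U.1).toAlgebra
    letI := (scalars (k := k) X V.1).toAlgebra
    { (X.presheaf.map (homOfLE h).op).hom with
      commutes' := fun c => presheaf_map_map X le_top h
        ((X ↘ Spec (.of k)).appTop.hom ((Scheme.ΓSpecIso (.of k)).inv.hom c)) }
  res_id U a := by
    change (X.presheaf.map (𝟙 (Opposite.op U.1))).hom a = a
    rw [CategoryTheory.Functor.map_id]
    rfl
  res_comp h h' a := presheaf_map_map X h h' a

variable (k) in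
/-- The compatible family of restrictions of a global function of `X`. -/
def globalFun (w : Γ(X, ⊤)) : GlobalFun (affO k X) where
  val _ := (X.presheaf.map (homOfLE le_top).op).hom w
  res_val h := presheaf_map_map X le_top h w

variable {X}

/-- A presheaf of modules on the affine opens is quasi-coherent if, for every affine open `U` and
every function `f` on `U`, the sections over `D(f)` are the localization at `f` of the sections
over `U`. -/
def IsQCoh (M : PMod (affO k X)) : Prop :=
  ∀ (U : X.affineOpens) (f : Γ(X, U.1)),
    (∀ x : M.obj U, M.res (X.affineBasicOpen_le f) x = 0 →
      ∃ m : ℕ, (show (affO k X).ring U from f ^ m) • x = 0) ∧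
    ∀ y : M.obj (X.affineBasicOpen f), ∃ (m : ℕ) (x : M.obj U),
      M.res (X.affineBasicOpen_le f) x =
        (affO k X).res (X.affineBasicOpen_le f) (show (affO k X).ring U from f ^ m) • y

/-- The class of the quasi-coherent curved modules. -/
def qcoh (w : GlobalFun (affO k X)) : ObjectProperty (Curved w) :=
  fun E => IsQCoh E.M0 ∧ IsQCoh E.M1

/-- A presheaf of modules on the affine opens is a vector bundle if it is quasi-coherent and its
modules of sections are finitely generated and projective. -/
def IsVectorBundle (M : PMod (affO k X)) : Prop :=
  IsQCoh M ∧ ∀ U, Module.Finite ((affO k X).ring U) (M.obj U) ∧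
    Module.Projective ((affO k X).ring U) (M.obj U)

/-- A curved module is a matrix factorization if its components are vector bundles. -/
def IsMatrixFactorization {w : GlobalFun (affO k X)} (E : Curved w) : Prop :=
  IsVectorBundle E.M0 ∧ IsVectorBundle E.M1

/-- Every section killed by `g` is locally in the image of `f`. -/
def LocallyExact {A B D : PMod (affO k X)} (f : A ⟶ B) (g : B ⟶ D) : Prop :=
  ∀ (U : X.affineOpens) (s : B.obj U), g.app U s = 0 → ∀ x ∈ U.1,
    ∃ (V : X.affineOpens) (h : V ≤ U) (t : A.obj V), x ∈ V.1 ∧ f.app V t = B.res h s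

/-- A `ℤ/2`-graded complex is locally acyclic if its cohomology sheaves vanish. -/
def LocallyAcyclic (N : Curved (0 : GlobalFun (affO k X))) : Prop :=
  LocallyExact N.d0 N.d1 ∧ LocallyExact N.d1 N.d0

variable (k X) in
/-- The quasi-isomorphisms of `ℤ/2`-graded complexes: the morphisms whose cone is locally acyclic;
equivalently, those which induce isomorphisms of the cohomology sheaves. -/
def quasiIso : MorphismProperty (Curved (0 : GlobalFun (affO k X))) :=
  fun _ _ f => LocallyAcyclic (Curved.cone f)

variable (k X) in
/-- The `ℤ/2`-graded derived category of `X`. -/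
abbrev Derived : Type _ := (quasiIso k X).Localization

variable (k X) in
/-- The functor from complexes to the derived category. -/
abbrev toDerived : Curved (0 : GlobalFun (affO k X)) ⥤ Derived k X := (quasiIso k X).Q

/-- The sheafified boundary bulk map `Hom(E, E) ⟶ Ω_dw` in the derived category, represented by
the roof `Hom(E, E) ← B ⊗ E^∨ → Ω_dw`. -/
def boundaryBulk {w : GlobalFun (affO k X)} (n : ℕ) (E : Curved w)
    (hq : quasiIso k X (barToEnd E))
    (hc : IsClosedFamily (m := barMixed w) (m' := omegaMixed w) (barExp n) E) :
    (toDerived k X).obj (Curved.homC E E) ⟶ (toDerived k X).obj (omegaC w) :=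
  haveI : IsIso ((toDerived k X).map (barToEnd E)) := MorphismProperty.Q_inverts _ _ hq
  inv ((toDerived k X).map (barToEnd E)) ≫ (toDerived k X).map (barToForms n E hc)

/-- The Chern character: the image of the identity of `E` under the boundary bulk map, an element
of the hypercohomology of `Ω_dw` in degree zero, that is, a morphism from the structure sheaf to
`Ω_dw` in the derived category. -/
def chern {w : GlobalFun (affO k X)} (n : ℕ) (E : Curved w) (hq : quasiIso k X (barToEnd E))
    (hc : IsClosedFamily (m := barMixed w) (m' := omegaMixed w) (barExp n) E) :
    (toDerived k X).obj (Curved.unitC (affO k X)) ⟶ (toDerived k X).obj (omegaC w) :=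
  (toDerived k X).map (idC E) ≫ boundaryBulk n E hq hc

end Schemes

end

end CurvedSheaf

open CurvedSheaf AlgebraicGeometry CategoryTheory

/-!
# The Chern character of a matrix factorization with connections

The three parts of the theorem are consequences of one construction: a closed section of the
augmentation `π : At(E) → E` of the Atiyah curved module.

A connection `∇` on `M` splits the sequence `0 → Ω ⊗ M → J¹(M) → M → 0` linearly, by
`x ↦ 1 ⊗ x + ι (∇ x)` (`Connection.sec`). For a matrix factorization `E` with connections on its
components, the iterated commutators `[∇, e]^q`, without antisymmetrization and followed by this
splitting, are the components of a morphism `E → At(E)` (`atiyahSec`). It is closed because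
`[∇, e] e + e [∇, e] = dw ⊗ -` (`Connection.comm_comp`), and it is a section of `π`. The
exponential `Λ = ∑ ∧ / q!` is closed since each of the `q + 1` insertions of `dw` contributes the
same exterior product and the forms of degree `n + 1` vanish (`atExp_isClosedFamily`). The
composite of the section with `Λ` is `φ` (`exists_expNabla`), so `φ` is closed.

The complex underlying `At(E)` without `B_dw` and `e` is contracted onto `E` by the splittings.
The operator `u = d h + h d + s ε`, formed with the full curved differential, is the identity up
to terms raising the degree, hence invertible even on infinite products
(`bijective_of_unitriangular`). Homological perturbation (`Retraction.ofPerturb`) then produces a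
closed section and a homotopy for the full differential. For `At(E)` these data are compatible
with restrictions, so the cone of `π` is contractible and therefore coacyclic
(`isCoacyclic_cone_atiyahAug`); as `π` is invertible in the coderived category, the roof is the
image of `φ` (`expAt_eq`). The quasi-coherence of all terms follows from that of `Ω`, which is a
vector bundle because `X` is smooth (`isVectorBundle_Om`).

The same perturbation applies to the bar complex over each affine open, where the sections of `E`
are projective (`exists_barContraction`), and shows that `λ` is a quasi-isomorphism
(`quasiIso_barToEnd`). The morphism `barToAtiyah` from the bar complex to `At(E)`, based on
`a ⊗ b ⊗ x ↦ a db ⊗ (1 ⊗ x)`, is compatible with the augmentations, and its composite with `Λ` is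
the exponential of the bar complex. So `h` is closed, and the boundary bulk map may be computed
with the resolution `At(E) ⊗ E^∨` of the complex of endomorphisms (`roof_eq`). There the identity
of `E` lifts to the image of the coevaluation under the section of `π`, and its contraction is the
supertrace of `φ` (`chern_eq`, `Curved.traceHom_eq`).
-/

namespace CurvedSheaf

noncomputable section

variable {k : Type u} [Field k] {C : Type u} [Preorder C] {O : AlgPresheaf k C}

open PMod

/-! ### Morphisms of totalizations -/

/-- Natural transformations commuting with both operators induce closed morphisms of
totalizations. -/
lemma isClosedFamily_of_comm {w : GlobalFun O} {m m' : Mixed w}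
    (g : ∀ q M, m.obj q M ⟶ m'.obj q M) (E : Curved w)
    (hn : ∀ (q : ℕ) {M N : PMod O} (f : M ⟶ N), m.map q f ≫ g q N = g q M ≫ m'.map q f)
    (hu : ∀ q M, m.up q M ≫ g (q + 1) M = g q M ≫ m'.up q M)
    (hd : ∀ q M, m.down q M ≫ g q M = g (q + 1) M ≫ m'.down q M) : IsClosedFamily g E := by
  have hev : ∀ {M N : PMod O} (f : M ⟶ N),
      m.evMap f ≫ (piLift fun j => proj _ j ≫ g (2 * j) N) =
        (piLift fun j => proj _ j ≫ g (2 * j) M) ≫ m'.evMap f := fun f => pi_hom_ext fun j => by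
    simp only [Mixed.evMap, Category.assoc, piLift_proj, piLift_proj_assoc, hn]
  have hod : ∀ {M N : PMod O} (f : M ⟶ N),
      m.odMap f ≫ (piLift fun j => proj _ j ≫ g (2 * j + 1) N) =
        (piLift fun j => proj _ j ≫ g (2 * j + 1) M) ≫ m'.odMap f := fun f => pi_hom_ext fun j => by
    simp only [Mixed.odMap, Category.assoc, piLift_proj, piLift_proj_assoc, hn]
  have hdO : ∀ j M, m.downOd j M ≫ g (2 * j + 1) M = g (2 * (j + 1)) M ≫ m'.downOd j M :=
    fun j M => hd (2 * j + 1) M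
  have huO : ∀ j M, m.upOd j M ≫ g (2 * (j + 1)) M = g (2 * j + 1) M ≫ m'.upOd j M :=
    fun j M => hu (2 * j + 1) M
  have heo : ∀ M : PMod O, m.evOd M ≫ (piLift fun j => proj _ j ≫ g (2 * j + 1) M) =
      (piLift fun j => proj _ j ≫ g (2 * j) M) ≫ m'.evOd M := fun M => pi_hom_ext fun j => by
    simp only [Mixed.evOd, Category.assoc, piLift_proj, piLift_proj_assoc, Preadditive.comp_add,
      Preadditive.add_comp, hu, hdO]
  have hoe : ∀ M : PMod O, m.odEv M ≫ (piLift fun j => proj _ j ≫ g (2 * j) M) =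
      (piLift fun j => proj _ j ≫ g (2 * j + 1) M) ≫ m'.odEv M := fun M => pi_hom_ext fun j => by
    cases j with
    | zero =>
      simp only [Mixed.odEv, Mixed.odEvComp, Category.assoc, piLift_proj, piLift_proj_assoc]
      exact congrArg (proj _ 0 ≫ ·) (hd 0 M)
    | succ j =>
      simp only [Mixed.odEv, Mixed.odEvComp, Category.assoc, piLift_proj, piLift_proj_assoc,
        Preadditive.comp_add, Preadditive.add_comp, huO, hd]
  have hneg : ∀ {M N : PMod O} (f : M ⟶ N),
      (-m.odMap f) ≫ (piLift fun j => proj _ j ≫ g (2 * j + 1) N) =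
        (piLift fun j => proj _ j ≫ g (2 * j + 1) M) ≫ (-m'.odMap f) := fun f => by
    rw [Preadditive.neg_comp, Preadditive.comp_neg, hod]
  exact ⟨mat_sq (hev _) (hoe _) (heo _) (hneg _), mat_sq (hev _) (hoe _) (heo _) (hneg _)⟩

/-! ### Contraction data and homological perturbation -/

section Retract

variable {R M0 M1 N0 N1 : Type u} [CommRing R] [AddCommGroup M0] [AddCommGroup M1]
  [AddCommGroup N0] [AddCommGroup N1] [Module R M0] [Module R M1] [Module R N0] [Module R N1]

/-- Contraction data for a morphism `f : M → N` of `2`-periodic curved modules over a ring: `S` is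
a closed section of `f` and `A` is a homotopy from the identity of `M` to `S f`, with `f A = 0`. -/
structure Retraction (d0 : M0 →ₗ[R] M1) (d1 : M1 →ₗ[R] M0) (e0 : N0 →ₗ[R] N1) (e1 : N1 →ₗ[R] N0)
    (f0 : M0 →ₗ[R] N0) (f1 : M1 →ₗ[R] N1) where
  S0 : N0 →ₗ[R] M0
  S1 : N1 →ₗ[R] M1
  A0 : M0 →ₗ[R] M1
  A1 : M1 →ₗ[R] M0
  f_A0 : ∀ x, f1 (A0 x) = 0
  f_A1 : ∀ x, f0 (A1 x) = 0
  f_S0 : ∀ x, f0 (S0 x) = x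
  f_S1 : ∀ x, f1 (S1 x) = x
  S_d0 : ∀ x, S1 (e0 x) = d0 (S0 x)
  S_d1 : ∀ x, S0 (e1 x) = d1 (S1 x)
  htpy0 : ∀ x, d1 (A0 x) + A1 (d0 x) = S0 (f0 x) - x
  htpy1 : ∀ x, d0 (A1 x) + A0 (d1 x) = S1 (f1 x) - x

end Retract

section Perturb

variable {R M0 M1 N0 N1 : Type u} [CommRing R] [AddCommGroup M0] [AddCommGroup M1]
  [AddCommGroup N0] [AddCommGroup N1] [Module R M0] [Module R M1] [Module R N0] [Module R N1]
  {d0 : M0 →ₗ[R] M1} {d1 : M1 →ₗ[R] M0} {e0 : N0 →ₗ[R] N1} {e1 : N1 →ₗ[R] N0}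
  {f0 : M0 →ₗ[R] N0} {f1 : M1 →ₗ[R] N1}
  {s0 : N0 →ₗ[R] M0} {s1 : N1 →ₗ[R] M1} {h0 : M0 →ₗ[R] M1} {h1 : M1 →ₗ[R] M0}
  {u0 : M0 ≃ₗ[R] M0} {u1 : M1 ≃ₗ[R] M1} {r : R}

/-- The inverse of `u = d h + h d + s f` commutes with `d` up to a correction factoring through
`f`. -/
lemma perturb_inv_comm (hd : ∀ x, d1 (d0 x) = r • x) (hd' : ∀ x, d0 (d1 x) = r • x)
    (hfd0 : ∀ x, f1 (d0 x) = e0 (f0 x)) (hfd1 : ∀ x, f0 (d1 x) = e1 (f1 x))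
    (hfh0 : ∀ x, f1 (h0 x) = 0) (hfh1 : ∀ x, f0 (h1 x) = 0) (hfs0 : ∀ x, f0 (s0 x) = x)
    (hu0 : ∀ x, u0 x = d1 (h0 x) + h1 (d0 x) + s0 (f0 x))
    (hu1 : ∀ x, u1 x = d0 (h1 x) + h0 (d1 x) + s1 (f1 x)) (x : M0) :
    d0 (u0.symm x) = u1.symm (d0 x) - u1.symm (d0 (s0 (f0 x)) - s1 (e0 (f0 x))) := by
  apply u1.injective
  obtain ⟨y, rfl⟩ := u0.surjective x
  have hf : f0 (u0 y) = f0 y := by rw [hu0]; simp [hfd1, hfh0, hfh1, hfs0]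
  rw [map_sub, LinearEquiv.apply_symm_apply, LinearEquiv.apply_symm_apply,
    LinearEquiv.symm_apply_apply, hf, hu0, hu1]
  simp only [map_add, hd, hd', hfd0, map_smul]
  abel

/-- The homotopy `-h u⁻¹` exhibits a contraction onto the corrected section. -/
lemma perturb_htpy (hd : ∀ x, d1 (d0 x) = r • x) (hd' : ∀ x, d0 (d1 x) = r • x)
    (hfd0 : ∀ x, f1 (d0 x) = e0 (f0 x)) (hfd1 : ∀ x, f0 (d1 x) = e1 (f1 x))
    (hfh0 : ∀ x, f1 (h0 x) = 0) (hfh1 : ∀ x, f0 (h1 x) = 0) (hfs0 : ∀ x, f0 (s0 x) = x)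
    (hu0 : ∀ x, u0 x = d1 (h0 x) + h1 (d0 x) + s0 (f0 x))
    (hu1 : ∀ x, u1 x = d0 (h1 x) + h0 (d1 x) + s1 (f1 x)) (x : M0) :
    d1 (-h0 (u0.symm x)) + -h1 (u1.symm (d0 x)) =
      s0 (f0 x) + h1 (u1.symm (s1 (e0 (f0 x)) - d0 (s0 (f0 x)))) - x := by
  have hc := perturb_inv_comm hd hd' hfd0 hfd1 hfh0 hfh1 hfs0 hu0 hu1 x
  have hx := hu0 (u0.symm x)
  have hf : f0 (u0.symm x) = f0 x := by
    have := congrArg f0 hx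
    rw [LinearEquiv.apply_symm_apply] at this
    rw [this]; simp [hfd1, hfh0, hfh1, hfs0]
  rw [LinearEquiv.apply_symm_apply, hf, hc] at hx
  have e := congrArg (fun y => s0 (f0 x) + h1 (u1.symm (s1 (e0 (f0 x)) - d0 (s0 (f0 x)))) - y) hx
  refine Eq.trans ?_ e.symm
  simp only [map_sub, map_neg]
  abel

/-- The section `s`, corrected by `h u⁻¹ (s e - d s)`, is closed. -/
lemma perturb_closed (hd : ∀ x, d1 (d0 x) = r • x) (hd' : ∀ x, d0 (d1 x) = r • x)
    (he : ∀ x, e1 (e0 x) = r • x)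
    (hfd0 : ∀ x, f1 (d0 x) = e0 (f0 x)) (hfd1 : ∀ x, f0 (d1 x) = e1 (f1 x))
    (hfh0 : ∀ x, f1 (h0 x) = 0) (hfh1 : ∀ x, f0 (h1 x) = 0) (hfs0 : ∀ x, f0 (s0 x) = x)
    (hfs1 : ∀ x, f1 (s1 x) = x)
    (hu0 : ∀ x, u0 x = d1 (h0 x) + h1 (d0 x) + s0 (f0 x))
    (hu1 : ∀ x, u1 x = d0 (h1 x) + h0 (d1 x) + s1 (f1 x)) (x : N0) :
    s1 (e0 x) + h0 (u0.symm (s0 (e1 (e0 x)) - d1 (s1 (e0 x)))) =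
      d0 (s0 x + h1 (u1.symm (s1 (e0 x) - d0 (s0 x)))) := by
  have hf1 : f1 (s1 (e0 x) - d0 (s0 x)) = 0 := by simp [hfs1, hfd0, hfs0]
  have h := perturb_htpy (r := r) hd' hd hfd1 hfd0 hfh1 hfh0 hfs1 hu1 hu0
    (s1 (e0 x) - d0 (s0 x))
  rw [hf1] at h
  -- The defect `s e - d s` is killed by `f` and closed up to sign, so the homotopy applies to it.
  have e : s0 (e1 (e0 x)) - d1 (s1 (e0 x)) = -d1 (s1 (e0 x) - d0 (s0 x)) := by
    rw [he, map_sub, hd, map_smul]; abel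
  rw [e, map_neg, map_neg, map_add d0]
  simp only [map_zero, sub_zero, add_zero, zero_sub] at h
  rw [map_neg] at h
  have h' : d0 (h1 (u1.symm (s1 (e0 x) - d0 (s0 x)))) = (s1 (e0 x) - d0 (s0 x)) -
    h0 (u0.symm (d1 (s1 (e0 x) - d0 (s0 x)))) := by
    rw [← sub_eq_zero]
    have := sub_eq_zero.2 h
    rw [← neg_eq_zero, ← this]
    abel
  rw [h']
  abel

/-- Homological perturbation for curved differentials, with `d² = e² = r`: if `h` is a homotopy such
that `u = d h + h d + s f` is invertible and `s` is a section of `f` with `f h = 0`, then `f` has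
contraction data. -/
def Retraction.ofPerturb (hd : ∀ x, d1 (d0 x) = r • x) (hd' : ∀ x, d0 (d1 x) = r • x)
    (he : ∀ x, e1 (e0 x) = r • x) (he' : ∀ x, e0 (e1 x) = r • x)
    (hfd0 : ∀ x, f1 (d0 x) = e0 (f0 x)) (hfd1 : ∀ x, f0 (d1 x) = e1 (f1 x))
    (hfh0 : ∀ x, f1 (h0 x) = 0) (hfh1 : ∀ x, f0 (h1 x) = 0) (hfs0 : ∀ x, f0 (s0 x) = x)
    (hfs1 : ∀ x, f1 (s1 x) = x)
    (hu0 : ∀ x, u0 x = d1 (h0 x) + h1 (d0 x) + s0 (f0 x))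
    (hu1 : ∀ x, u1 x = d0 (h1 x) + h0 (d1 x) + s1 (f1 x)) : Retraction d0 d1 e0 e1 f0 f1 where
  S0 := s0 + (h1 ∘ₗ u1.symm.toLinearMap) ∘ₗ (s1 ∘ₗ e0 - d0 ∘ₗ s0)
  S1 := s1 + (h0 ∘ₗ u0.symm.toLinearMap) ∘ₗ (s0 ∘ₗ e1 - d1 ∘ₗ s1)
  A0 := -(h0 ∘ₗ u0.symm.toLinearMap)
  A1 := -(h1 ∘ₗ u1.symm.toLinearMap)
  f_A0 x := by simp [hfh0]
  f_A1 x := by simp [hfh1]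
  f_S0 x := by simp [hfh1, hfs0]
  f_S1 x := by simp [hfh0, hfs1]
  S_d0 x := perturb_closed hd hd' he hfd0 hfd1 hfh0 hfh1 hfs0 hfs1 hu0 hu1 x
  S_d1 x := perturb_closed hd' hd he' hfd1 hfd0 hfh1 hfh0 hfs1 hfs0 hu1 hu0 x
  htpy0 x := perturb_htpy hd hd' hfd0 hfd1 hfh0 hfh1 hfs0 hu0 hu1 x
  htpy1 x := perturb_htpy hd' hd hfd1 hfd0 hfh1 hfh0 hfs1 hu1 hu0 x

end Perturb

section Unitriangular

variable {A B : ℕ → Type u} [∀ j, AddCommGroup (A j)] [∀ j, AddCommGroup (B j)]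

/-- The vanishing of the components of degree less than `t` of a pair of families, where the
members of the first family have the degrees `2 j` and those of the second the degrees
`2 j + 1`. -/
def VanishBelow (t : ℕ) (x : (∀ j, A j) × (∀ j, B j)) : Prop :=
  (∀ j, 2 * j < t → x.1 j = 0) ∧ ∀ j, 2 * j + 1 < t → x.2 j = 0

lemma VanishBelow.sub {t : ℕ} {x y : (∀ j, A j) × (∀ j, B j)} (hx : VanishBelow t x)
    (hy : VanishBelow t y) : VanishBelow t (x - y) :=
  ⟨fun j h => by simp [hx.1 j h, hy.1 j h], fun j h => by simp [hx.2 j h, hy.2 j h]⟩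

lemma VanishBelow.add {t : ℕ} {x y : (∀ j, A j) × (∀ j, B j)} (hx : VanishBelow t x)
    (hy : VanishBelow t y) : VanishBelow t (x + y) :=
  ⟨fun j h => by simp [hx.1 j h, hy.1 j h], fun j h => by simp [hx.2 j h, hy.2 j h]⟩

lemma eq_zero_of_vanishBelow {x : (∀ j, A j) × (∀ j, B j)} (h : ∀ t, VanishBelow t x) : x = 0 :=
  Prod.ext (funext fun j => (h (2 * j + 1)).1 j (Nat.lt_succ_self _))
    (funext fun j => (h (2 * j + 2)).2 j (Nat.lt_succ_self _))

/-- An additive endomorphism of a product which differs from the identity by a map strictly raising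
the degree is bijective; the product may be infinite. -/
lemma bijective_of_unitriangular (u : (∀ j, A j) × (∀ j, B j) →+ (∀ j, A j) × (∀ j, B j))
    (hu : ∀ t x, VanishBelow t x → VanishBelow (t + 1) (u x - x)) : Function.Bijective u := by
  constructor
  · refine (injective_iff_map_eq_zero u).2 fun x hx => eq_zero_of_vanishBelow fun t => ?_
    induction t with
    | zero =>
      exact ⟨fun j h => absurd h (Nat.not_lt_zero _), fun j h => absurd h (Nat.not_lt_zero _)⟩
    | succ t ih =>
      have h := hu t x ih
      rw [hx, zero_sub] at h
      exact ⟨fun j hj => neg_eq_zero.1 (h.1 j hj), fun j hj => neg_eq_zero.1 (h.2 j hj)⟩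
  · intro y
    -- The successive approximations of a preimage of `y`; the `t`-th one is correct below `t`.
    obtain ⟨z, hz⟩ : ∃ z : ℕ → (∀ j, A j) × (∀ j, B j), ∀ t, z (t + 1) = y - (u (z t) - z t) :=
      ⟨fun t => Nat.rec 0 (fun _ x => y - (u x - x)) t, fun t => rfl⟩
    have h1 : ∀ t, VanishBelow t (z (t + 1) - z t) := fun t => by
      induction t with
      | zero =>
        exact ⟨fun j h => absurd h (Nat.not_lt_zero _), fun j h => absurd h (Nat.not_lt_zero _)⟩
      | succ t ih =>
        have h := hu t _ ih
        have e : z (t + 1 + 1) - z (t + 1) =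
            0 - (u (z (t + 1) - z t) - (z (t + 1) - z t)) := by
          have e' : y = z (t + 1) + (u (z t) - z t) := by rw [hz t]; abel
          rw [hz (t + 1), map_sub]
          nth_rewrite 1 [e']
          abel
        rw [e]
        exact VanishBelow.sub ⟨fun _ _ => rfl, fun _ _ => rfl⟩ h
    have h2 : ∀ t s, VanishBelow t (z (t + s) - z t) := fun t s => by
      induction s with
      | zero => rw [add_zero, sub_self]; exact ⟨fun _ _ => rfl, fun _ _ => rfl⟩
      | succ s ih =>
        have h := h1 (t + s)
        have e : z (t + (s + 1)) - z t = (z (t + s + 1) - z (t + s)) + (z (t + s) - z t) := by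
          rw [← add_assoc]; abel
        rw [e]
        exact VanishBelow.add ⟨fun j hj => h.1 j (by omega), fun j hj => h.2 j (by omega)⟩ ih
    let x : (∀ j, A j) × (∀ j, B j) := (fun j => (z (2 * j + 1)).1 j, fun j => (z (2 * j + 2)).2 j)
    have h3 : ∀ t, VanishBelow t (x - z t) := fun t => by
      constructor
      · intro j hj
        obtain ⟨s, rfl⟩ := Nat.exists_eq_add_of_le (show 2 * j + 1 ≤ t by omega)
        have h := (h2 (2 * j + 1) s).1 j (by omega)
        rw [← neg_eq_zero, ← h]
        simp [x]
      · intro j hj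
        obtain ⟨s, rfl⟩ := Nat.exists_eq_add_of_le (show 2 * j + 2 ≤ t by omega)
        have h := (h2 (2 * j + 2) s).2 j (by omega)
        rw [← neg_eq_zero, ← h]
        simp [x]
    refine ⟨x, sub_eq_zero.1 (eq_zero_of_vanishBelow fun t => ?_)⟩
    have e : u x - y = (u (x - z t) - (x - z t)) + (x - z (t + 1)) := by
      rw [hz, map_sub]; abel
    have h := (hu t _ (h3 t)).add (h3 (t + 1))
    rw [e]
    exact ⟨fun j hj => h.1 j (by omega), fun j hj => h.2 j (by omega)⟩

end Unitriangular

/-! ### Contraction of totalizations -/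

section Contraction

variable {w : GlobalFun O} (m : Mixed w)

/-- A contraction over `U` of the complex `⋯ → F₁(M) → F₀(M) → M`, where the differentials are the
lowering operators and the augmentation `e`. It need not be compatible with restrictions. -/
structure Mixed.Contraction (e : ∀ M, m.obj 0 M ⟶ M) (M : PMod O) (U : C) where
  s : M.obj U →ₗ[O.ring U] (m.obj 0 M).obj U
  h : ∀ q, (m.obj q M).obj U →ₗ[O.ring U] (m.obj (q + 1) M).obj U
  aug_s : ∀ x, (e M).app U (s x) = x
  htpy_zero : ∀ x, (m.down 0 M).app U (h 0 x) + s ((e M).app U x) = x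
  htpy_succ : ∀ q x, (m.down (q + 1) M).app U (h (q + 1) x) + h q ((m.down q M).app U x) = x

variable {m} {e : ∀ M, m.obj 0 M ⟶ M} {U : C}

namespace Mixed.Contraction

/-- The homotopy from degree `2 j + 1` to degree `2 (j + 1)`. -/
def hOd {M : PMod O} (c : m.Contraction e M U) (j : ℕ) :
    (m.obj (2 * j + 1) M).obj U →ₗ[O.ring U] (m.obj (2 * (j + 1)) M).obj U := c.h (2 * j + 1)

/-- The components of the homotopy from the odd to the even part. -/
def oddComp {M : PMod O} (c : m.Contraction e M U) :
    ∀ j : ℕ, (m.od M).obj U →ₗ[O.ring U] (m.obj (2 * j) M).obj U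
  | 0 => 0
  | j + 1 => c.hOd j ∘ₗ (proj _ j).app U

/-- The homotopy on the totalization. -/
def total {M N : PMod O} (c : m.Contraction e M U) (c' : m.Contraction e N U) :
    (prod (m.ev M) (m.od N)).obj U →ₗ[O.ring U] (prod (m.ev N) (m.od M)).obj U :=
  LinearMap.prod
    (LinearMap.pi fun j => c'.oddComp j ∘ₗ (snd (m.ev M) (m.od N)).app U :
      (prod (m.ev M) (m.od N)).obj U →ₗ[O.ring U] (m.ev N).obj U)
    (LinearMap.pi fun j => c.h (2 * j) ∘ₗ (fst (m.ev M) (m.od N) ≫ proj _ j).app U :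
      (prod (m.ev M) (m.od N)).obj U →ₗ[O.ring U] (m.od M).obj U)

/-- The section in degree zero. -/
def totalS {M : PMod O} (N : PMod O) (c : m.Contraction e M U) :
    M.obj U →ₗ[O.ring U] (prod (m.ev M) (m.od N)).obj U :=
  LinearMap.prod (LinearMap.pi fun j => Nat.rec (motive := fun j => M.obj U →ₗ[O.ring U]
    (m.obj (2 * j) M).obj U) c.s (fun _ _ => 0) j : M.obj U →ₗ[O.ring U] (m.ev M).obj U) 0

/-- The operator `d h + h d + s ε` on the totalization. -/
def totalU {M N : PMod O} (c : m.Contraction e M U) (c' : m.Contraction e N U) (f : M ⟶ N)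
    (g : N ⟶ M) : (prod (m.ev M) (m.od N)).obj U →ₗ[O.ring U] (prod (m.ev M) (m.od N)).obj U :=
  (mat (m.evMap g) (m.odEv M) (m.evOd N) (-m.odMap f)).app U ∘ₗ c.total c' +
    c'.total c ∘ₗ (mat (m.evMap f) (m.odEv N) (m.evOd M) (-m.odMap g)).app U +
      c.totalS N ∘ₗ (fst (m.ev M) (m.od N) ≫ proj _ 0 ≫ e M).app U

/-- On each component, `d h + h d + s ε` is the identity up to terms containing a raising operator
or the given differential, which come from lower degrees. -/
lemma totalU_bijective {M N : PMod O} (c : m.Contraction e M U) (c' : m.Contraction e N U)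
    (f : M ⟶ N) (g : N ⟶ M) : Function.Bijective (c.totalU c' f g) := by
  refine bijective_of_unitriangular (A := fun j => (m.obj (2 * j) M).obj U)
    (B := fun j => (m.obj (2 * j + 1) N).obj U) (c.totalU c' f g).toAddMonoidHom
    fun t x hx => ⟨fun j hj => ?_, fun j hj => ?_⟩
  · cases j with
    | zero =>
      have e1 : (c.totalU c' f g x).1 0 = ((m.map (2 * 0) g).app U 0 +
          (m.down 0 M).app U (c.h 0 (x.1 0))) + 0 + c.s ((e M).app U (x.1 0)) := rfl
      change (c.totalU c' f g x).1 0 - x.1 0 = 0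
      rw [e1, map_zero, zero_add, add_zero]
      exact sub_eq_zero.2 (c.htpy_zero (x.1 0))
    | succ j =>
      have e1 : (c.totalU c' f g x).1 (j + 1) = ((m.map (2 * (j + 1)) g).app U (c'.hOd j (x.2 j)) +
          ((m.upOd j M).app U (c.h (2 * j) (x.1 j)) +
            (m.down (2 * (j + 1)) M).app U (c.h (2 * (j + 1)) (x.1 (j + 1))))) +
          c.hOd j (((m.up (2 * j) M).app U (x.1 j) + (m.downOd j M).app U (x.1 (j + 1))) +
            -((m.map (2 * j + 1) g).app U (x.2 j))) + 0 := rfl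
      have e2 : (m.down (2 * (j + 1)) M).app U (c.h (2 * (j + 1)) (x.1 (j + 1))) +
          c.hOd j ((m.downOd j M).app U (x.1 (j + 1))) = x.1 (j + 1) := c.htpy_succ (2 * j + 1) _
      change (c.totalU c' f g x).1 (j + 1) - x.1 (j + 1) = 0
      rw [e1, hx.1 j (by omega), hx.2 j (by omega)]
      simp only [map_zero, zero_add, add_zero, neg_zero]
      exact sub_eq_zero.2 e2
  · change (c.totalU c' f g x).2 j - x.2 j = 0
    have h0 := hx.1 j (by omega)
    cases j with
    | zero =>
      have e1 : (c.totalU c' f g x).2 0 = (((m.up (2 * 0) N).app U 0 +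
          (m.downOd 0 N).app U (c'.hOd 0 (x.2 0))) + -((m.map (2 * 0 + 1) f).app U
            (c.h (2 * 0) (x.1 0)))) + c'.h (2 * 0) ((m.map (2 * 0) f).app U (x.1 0) +
              (m.down 0 N).app U (x.2 0)) + 0 := rfl
      have e2 : (m.downOd 0 N).app U (c'.hOd 0 (x.2 0)) + c'.h (2 * 0)
          ((m.down 0 N).app U (x.2 0)) = x.2 0 := c'.htpy_succ 0 _
      rw [e1, h0]
      simp only [map_zero, zero_add, add_zero, neg_zero]
      exact sub_eq_zero.2 e2
    | succ j =>
      have e1 : (c.totalU c' f g x).2 (j + 1) = (((m.up (2 * (j + 1)) N).app U (c'.hOd j (x.2 j)) +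
          (m.downOd (j + 1) N).app U (c'.hOd (j + 1) (x.2 (j + 1)))) +
            -((m.map (2 * (j + 1) + 1) f).app U (c.h (2 * (j + 1)) (x.1 (j + 1))))) +
          c'.h (2 * (j + 1)) ((m.map (2 * (j + 1)) f).app U (x.1 (j + 1)) +
              ((m.upOd j N).app U (x.2 j) + (m.down (2 * (j + 1)) N).app U (x.2 (j + 1)))) + 0 :=
        rfl
      have e2 : (m.downOd (j + 1) N).app U (c'.hOd (j + 1) (x.2 (j + 1))) + c'.h (2 * (j + 1))
          ((m.down (2 * (j + 1)) N).app U (x.2 (j + 1))) = x.2 (j + 1) :=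
        c'.htpy_succ (2 * (j + 1)) _
      rw [e1, h0, hx.2 j (by omega)]
      simp only [map_zero, zero_add, add_zero, neg_zero]
      exact sub_eq_zero.2 e2

end Mixed.Contraction

/-- Contraction data over `U` of the components of the augmented complex yield contraction data of
the augmentation of the totalization. -/
def Mixed.retraction {he : ∀ {M N : PMod O} (f : M ⟶ N), m.map 0 f ≫ e N = e M ≫ f}
    {hd : ∀ M, m.down 0 M ≫ e M = 0} (E : Curved w) (c0 : m.Contraction e E.M0 U)
    (c1 : m.Contraction e E.M1 U) :
    Retraction ((m.fold E).d0.app U) ((m.fold E).d1.app U) (E.d0.app U) (E.d1.app U)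
      ((m.aug e he hd E).f0.app U) ((m.aug e he hd E).f1.app U) :=
  Retraction.ofPerturb (r := w.val U) (s0 := c0.totalS E.M1) (s1 := c1.totalS E.M0)
    (h0 := c0.total c1) (h1 := c1.total c0)
    (u0 := LinearEquiv.ofBijective _ (c0.totalU_bijective c1 E.d0 E.d1))
    (u1 := LinearEquiv.ofBijective _ (c1.totalU_bijective c0 E.d1 E.d0))
    (fun x => congrArg (fun q : (m.fold E).M0 ⟶ (m.fold E).M0 => q.app U x) (m.fold E).d0_d1)
    (fun x => congrArg (fun q : (m.fold E).M1 ⟶ (m.fold E).M1 => q.app U x) (m.fold E).d1_d0)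
    (fun x => congrArg (fun q : E.M0 ⟶ E.M0 => q.app U x) E.d0_d1)
    (fun x => congrArg (fun q : E.M1 ⟶ E.M1 => q.app U x) E.d1_d0)
    (fun x => congrArg (fun q : (m.fold E).M0 ⟶ E.M1 => q.app U x)
      (Curved.hom_comm0 (m.aug e he hd E)))
    (fun x => congrArg (fun q : (m.fold E).M1 ⟶ E.M0 => q.app U x)
      (Curved.hom_comm1 (m.aug e he hd E)))
    (fun x => map_zero ((e E.M1).app U)) (fun x => map_zero ((e E.M0).app U))
    c0.aug_s c1.aug_s (fun x => rfl) (fun x => rfl)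

end Contraction

/-! ### The splitting of the jets defined by a connection -/

lemma smul_jmk {M : PMod O} (U : C) (a : O.ring U) (x : M.obj U) :
    a • (jmk M).app U (fmk M U 1 x) = (jmk M).app U (fmk M U a x) := by
  rw [← map_smul, fmk_one]

lemma jmk_res {M : PMod O} {U V : C} (h : V ≤ U) (a : O.ring U) (x : M.obj U) :
    (jet M).res h ((jmk M).app U (fmk M U a x)) =
      (jmk M).app V (fmk M V (O.res h a) (M.res h x)) := rfl

namespace Connection

variable {M N : PMod O} (c : Connection M)

lemma nabla_k_smul (U : C) (a : k) (x : M.obj U) : c.nabla U (a • x) = a • c.nabla U x := by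
  have h : dd U (algebraMap k (O.ring U) a) = 0 :=
    (KaehlerDifferential.D k (O.ring U)).map_algebraMap a
  rw [k_smul, c.leibniz, h, tmk_zero_left, zero_add, k_smul]

/-- The section `x ↦ 1 ⊗ x + ι (∇ x)` of `ε : J¹(M) → M`; it is linear for the left module
structure. -/
def sec : M ⟶ jet M where
  app U :=
    { toFun := fun x => (jmk M).app U (fmk M U 1 x) + (iota M).app U (c.nabla U x)
      map_add' := fun x y => by simp only [map_add, fmk_add_right]; abel
      map_smul' := fun a x => by
        rw [c.leibniz, map_add, iota_app, map_smul, RingHom.id_apply, smul_add, smul_jmk]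
        abel }
  naturality h x := by
    change (jmk M).app _ (fmk M _ 1 (M.res h x)) + (iota M).app _ (c.nabla _ (M.res h x)) =
      (jet M).res h ((jmk M).app _ (fmk M _ 1 x) + (iota M).app _ (c.nabla _ x))
    rw [map_add, c.res_nabla, hom_nat, jmk_res, map_one]

lemma sec_app (U : C) (x : M.obj U) :
    c.sec.app U x = (jmk M).app U (fmk M U 1 x) + (iota M).app U (c.nabla U x) := rfl

lemma sec_eps : c.sec ≫ eps M = 𝟙 M := hom_ext' fun U x => by
  have h : (eps M).app U ((iota M).app U (c.nabla U x)) = 0 :=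
    congrArg (fun q : tens (Om O) M ⟶ M => q.app U (c.nabla U x)) (iota_eps M)
  rw [comp_app, sec_app, map_add, eps_app, one_smul, h, add_zero, id_app]

/-- The retraction `a ⊗ x ↦ -a ∇ x` of `ι : Ω ⊗ M → J¹(M)`. -/
def retr : jet M ⟶ tens (Om O) M :=
  jlift (flift (fun U => -c.nabla U)
      (fun U a x => by rw [AddMonoidHom.neg_apply, AddMonoidHom.neg_apply, nabla_k_smul, smul_neg])
      fun h x => by
        rw [AddMonoidHom.neg_apply, AddMonoidHom.neg_apply, c.res_nabla, map_neg])
    fun U a b x => by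
      simp only [map_add, map_sub, flift_app, AddMonoidHom.neg_apply, c.leibniz, mul_smul,
        one_smul, smul_add, smul_neg, tmk_smul_right]
      rw [smul_comm b a (c.nabla U x)]
      abel

lemma retr_app (U : C) (a : O.ring U) (x : M.obj U) :
    c.retr.app U ((jmk M).app U (fmk M U a x)) = -(a • c.nabla U x) :=
  smul_neg a (c.nabla U x)

lemma iota_retr : iota M ≫ c.retr = 𝟙 _ := tens_Om_hom_ext fun U a x => by
  rw [comp_app, iota_app, map_sub, retr_app, retr_app, c.leibniz, one_smul, id_app]
  abel

lemma retr_iota : c.retr ≫ iota M + eps M ≫ c.sec = 𝟙 _ := jet_hom_ext fun U a x => by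
  rw [add_app, comp_app, comp_app, retr_app, eps_app, map_neg, map_smul, map_smul, sec_app,
    smul_add, smul_jmk, id_app]
  abel

/-- The sections defined by the connections differ by the commutator with the connections. -/
lemma sec_comm (c' : Connection N) (f : M ⟶ N) :
    f ≫ c'.sec = c.sec ≫ jetMap f + c.comm c' f ≫ iota N := hom_ext' fun U x => by
  have h : (jetMap f).app U ((iota M).app U (c.nabla U x)) =
      (iota N).app U ((om f).app U (c.nabla U x)) :=
    (congrArg (fun q : tens (Om O) M ⟶ jet N => q.app U (c.nabla U x)) (tmap_iota f)).symm
  have h' : (c.comm c' f).app U x = c'.nabla U (f.app U x) - (om f).app U (c.nabla U x) := rfl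
  rw [add_app, comp_app, comp_app, comp_app, sec_app, sec_app, h', map_add, jetMap_app, h, map_sub]
  abel

/-- The commutators with the components of the differential of a curved module satisfy
`[∇, e] e + e [∇, e] = dw ⊗ -`. -/
lemma comm_comp (c' : Connection N) (w : GlobalFun O) (f : M ⟶ N) (g : N ⟶ M)
    (h : f ≫ g = w.mul M) : f ≫ c'.comm c g = dwTens w M - c.comm c' f ≫ om g :=
  hom_ext' fun U x => by
    have h1 : (c.comm c' f).app U x = c'.nabla U (f.app U x) - (om f).app U (c.nabla U x) := rfl
    have h2 : (c'.comm c g).app U (f.app U x) =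
      c.nabla U (g.app U (f.app U x)) - (om g).app U (c'.nabla U (f.app U x)) := rfl
    have h3 : g.app U (f.app U x) = w.val U • x := congrArg (fun q : M ⟶ M => q.app U x) h
    have h4 : (om g).app U ((om f).app U (c.nabla U x)) = w.val U • c.nabla U x := by
      have := congrArg (fun q : tens (Om O) M ⟶ tens (Om O) M => q.app U (c.nabla U x))
        ((om_comp f g).symm.trans ((congrArg om h).trans (om_mul w M)))
      exact this
    rw [comp_app, h2, h3, sub_app, comp_app, h1, map_sub, h4, c.leibniz, dwTens_app, dw]
    abel

end Connection

/-! ### The section of the Atiyah complex defined by connections -/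

/-- The section in degree zero of the augmentation of the Atiyah complex. -/
def atSec : ∀ (n : ℕ) {M : PMod O} (_ : Connection M), M ⟶ atObj n 0 M
  | 0, M, _ => 𝟙 M
  | _ + 1, _, c => c.sec

lemma atSec_eps : ∀ (n : ℕ) {M : PMod O} (c : Connection M), atSec n c ≫ atEps n M = 𝟙 M
  | 0, M, _ => Category.comp_id (𝟙 M)
  | _ + 1, _, c => c.sec_eps

lemma atSec_trunc : ∀ (n : ℕ) {M : PMod O} (c : Connection M),
    atSec (n + 1) c ≫ atTrunc n 0 M = atSec n c
  | 0, _, c => c.sec_eps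
  | _ + 1, _, c => Category.comp_id c.sec

/-- The contracting homotopy of the augmented Atiyah complex defined by a connection. -/
def atHtpy : ∀ (n q : ℕ) {M : PMod O} (_ : Connection M), atObj n q M ⟶ atObj n (q + 1) M
  | 0, q, M, _ => (0 : atObj 0 q M ⟶ zero O)
  | n + 1, 0, M, c => c.retr ≫ om (atSec n c)
  | n + 1, q + 1, M, c => -om (atHtpy n q c)

lemma atHtpy_zero : ∀ (n : ℕ) {M : PMod O} (c : Connection M),
    atHtpy n 0 c ≫ atDown n 0 M + atEps n M ≫ atSec n c = 𝟙 _
  | 0, M, _ => by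
    have h1 : (0 : M ⟶ zero O) ≫ (0 : zero O ⟶ M) + 𝟙 M ≫ 𝟙 M = 𝟙 M := by simp
    exact h1
  | n + 1, M, c => by
    have h : (c.retr ≫ om (atSec n c)) ≫ iotaE (atEps n M) + eps M ≫ c.sec = 𝟙 _ := by
      rw [Category.assoc, iotaE_pre (atSec_eps n c), iotaE, om_id, Category.id_comp, c.retr_iota]
    exact h

lemma atHtpy_succ : ∀ (n q : ℕ) {M : PMod O} (c : Connection M),
    atHtpy n (q + 1) c ≫ atDown n (q + 1) M + atDown n q M ≫ atHtpy n q c = 𝟙 _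
  | 0, _, _, _ => to_zero _ _
  | n + 1, 0, M, c => by
    have h : (-om (atHtpy n 0 c)) ≫ (-om (atDown n 0 M)) +
        iotaE (atEps n M) ≫ c.retr ≫ om (atSec n c) = 𝟙 _ := by
      rw [Preadditive.neg_comp, Preadditive.comp_neg, neg_neg, iotaE, Category.assoc,
        ← Category.assoc (iota M), c.iota_retr, Category.id_comp, ← om_comp, ← om_comp, ← om_add,
        atHtpy_zero, om_id]
    exact h
  | n + 1, q + 1, M, c => by
    have h : (-om (atHtpy n (q + 1) c)) ≫ (-om (atDown n (q + 1) M)) +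
        (-om (atDown n q M)) ≫ (-om (atHtpy n q c)) = 𝟙 _ := by
      simp only [Preadditive.neg_comp, Preadditive.comp_neg, neg_neg, ← om_comp, ← om_add,
        atHtpy_succ, om_id]
    exact h

/-- A connection defines contractions of the augmented Atiyah complex over all members of `C`. -/
def atContraction (w : GlobalFun O) (n : ℕ) {M : PMod O} (c : Connection M) (U : C) :
    (atMixed w n).Contraction (atEps n) M U where
  s := (atSec n c).app U
  h q := (atHtpy n q c).app U
  aug_s x := congrArg (fun q : M ⟶ M => q.app U x) (atSec_eps n c)
  htpy_zero x := congrArg (fun q : atObj n 0 M ⟶ atObj n 0 M => q.app U x) (atHtpy_zero n c)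
  htpy_succ q x := congrArg (fun f : atObj n (q + 1) M ⟶ atObj n (q + 1) M => f.app U x)
    (atHtpy_succ n q c)

section Sigma

-- In the definitions below `S` and `T` stand for the commutators of the differential with the
-- connections; the induction removes the first tensor factor, which exchanges `M` and `N`.
mutual

/-- The component `M → Ω^{⊗ 2j} ⊗ J¹(M)` of the section: the iterated commutator followed by the
splitting of the jets. -/
def sigEv : ∀ (n j : ℕ) {M N : PMod O} (_ : Connection M) (_ : M ⟶ tens (Om O) N)
    (_ : N ⟶ tens (Om O) M) (_ : Connection N), M ⟶ atObj n (2 * j) M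
  | n, 0, _, _, c, _, _, _ => atSec n c
  | 0, _ + 1, M, _, _, _, _, _ => (0 : M ⟶ zero O)
  | n + 1, j + 1, _, _, c, S, T, c' => S ≫ om (sigOd n j c' T S c)

/-- The component `M → Ω^{⊗ 2j+1} ⊗ J¹(N)` of the section. -/
def sigOd : ∀ (n j : ℕ) {M N : PMod O} (_ : Connection M) (_ : M ⟶ tens (Om O) N)
    (_ : N ⟶ tens (Om O) M) (_ : Connection N), M ⟶ atObj n (2 * j + 1) N
  | 0, _, M, _, _, _, _, _ => (0 : M ⟶ zero O)
  | n + 1, j, _, _, c, S, T, c' => S ≫ om (sigEv n j c' T S c)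

end

variable {M N : PMod O}

lemma sigEv_zero (n : ℕ) (c : Connection M) (S : M ⟶ tens (Om O) N) (T : N ⟶ tens (Om O) M)
    (c' : Connection N) : sigEv n 0 c S T c' = atSec n c := by
  cases n <;> rfl

mutual

lemma sigEv_trunc : ∀ (n j : ℕ) {M N : PMod O} (c : Connection M) (S : M ⟶ tens (Om O) N)
    (T : N ⟶ tens (Om O) M) (c' : Connection N),
    sigEv (n + 1) j c S T c' ≫ atTrunc n (2 * j) M = sigEv n j c S T c'
  | n, 0, _, _, c, _, _, _ => by rw [sigEv_zero, sigEv_zero]; exact atSec_trunc n c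
  | 0, _ + 1, _, _, _, _, _, _ => to_zero _ _
  | n + 1, j + 1, M, N, c, S, T, c' => by
    have h : (S ≫ om (sigOd (n + 1) j c' T S c)) ≫ om (atTrunc n (2 * j + 1) M) =
        S ≫ om (sigOd n j c' T S c) := by
      rw [Category.assoc, ← om_comp, sigOd_trunc]
    exact h

lemma sigOd_trunc : ∀ (n j : ℕ) {M N : PMod O} (c : Connection M) (S : M ⟶ tens (Om O) N)
    (T : N ⟶ tens (Om O) M) (c' : Connection N),
    sigOd (n + 1) j c S T c' ≫ atTrunc n (2 * j + 1) N = sigOd n j c S T c'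
  | 0, _, _, _, _, _, _, _ => to_zero _ _
  | n + 1, j, M, N, c, S, T, c' => by
    have h : (S ≫ om (sigEv (n + 1) j c' T S c)) ≫ om (atTrunc n (2 * j) N) =
        S ≫ om (sigEv n j c' T S c) := by
      rw [Category.assoc, ← om_comp, sigEv_trunc]
    exact h

end

/-- The commutation of the section with the differentials, in degree zero. -/
lemma sigEv_closed_zero (n : ℕ) (c : Connection M) (c' : Connection N) (f : M ⟶ N) (g : N ⟶ M) :
    f ≫ sigEv n 0 c' (c'.comm c g) (c.comm c' f) c =
      sigEv n 0 c (c.comm c' f) (c'.comm c g) c' ≫ atMap n 0 f +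
        sigOd n 0 c (c.comm c' f) (c'.comm c g) c' ≫ atDown n 0 N := by
  rw [sigEv_zero, sigEv_zero]
  cases n with
  | zero =>
    have h : f ≫ 𝟙 N = 𝟙 M ≫ f + (0 : M ⟶ zero O) ≫ (0 : zero O ⟶ N) := by simp
    exact h
  | succ n =>
    have h : f ≫ c'.sec = c.sec ≫ jetMap f + (c.comm c' f ≫ om (sigEv n 0 c' (c'.comm c g)
        (c.comm c' f) c)) ≫ iotaE (atEps n N) := by
      rw [sigEv_zero, Category.assoc, iotaE_pre (atSec_eps n c'), iotaE, om_id, Category.id_comp]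
      exact c.sec_comm c' f
    exact h

section Step

variable {w : GlobalFun O} {f : M ⟶ N} {g : N ⟶ M} {S : M ⟶ tens (Om O) N}
  {T : N ⟶ tens (Om O) M} {B X Y Z : PMod O} {x : M ⟶ B} {x' : N ⟶ X} {y : N ⟶ Y} {z : N ⟶ Z}
  {F : X ⟶ B} {V : Y ⟶ B} {D : Z ⟶ B} {t : tens (Om O) Y ⟶ B} {v : M ⟶ Y} {t' : Y ⟶ B}

/-- The induction step of `sigEv_closed`: `f T = dw ⊗ (-) - S g` moves `f` past the first
commutator, and the term with `dw` is the leading insertion of the raising operator. -/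
lemma step_even (hT : f ≫ T = dwTens w M - S ≫ om g) (ht : (S ≫ om y) ≫ t = x)
    (hx : g ≫ x = y ≫ V + z ≫ D - x' ≫ F) : f ≫ T ≫ om x =
      (S ≫ om x') ≫ om F + ((S ≫ om y) ≫ upS w t V + (S ≫ om z) ≫ (-om D)) := by
  rw [← Category.assoc f, hT, Preadditive.sub_comp, dwTens_nat, Category.assoc, ← om_comp, hx, upS,
    Preadditive.comp_sub, ← Category.assoc (S ≫ om y) t, ht]
  simp only [om_add, om_sub, om_comp, Preadditive.comp_add, Preadditive.comp_sub,
    Preadditive.comp_neg, Category.assoc]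
  abel

/-- The induction step of `sigOd_closed`. -/
lemma step_odd (hT : f ≫ T = dwTens w M - S ≫ om g) (ht : (S ≫ om y) ≫ t = x)
    (hx : g ≫ x = x' ≫ F + (y ≫ V + z ≫ D)) : f ≫ T ≫ om x =
      (S ≫ om y) ≫ upS w t V + (S ≫ om z) ≫ (-om D) - (S ≫ om x') ≫ om F := by
  rw [← Category.assoc f, hT, Preadditive.sub_comp, dwTens_nat, Category.assoc, ← om_comp, hx, upS,
    Preadditive.comp_sub, ← Category.assoc (S ≫ om y) t, ht]
  simp only [om_add, om_comp, Preadditive.comp_add, Preadditive.comp_neg, Category.assoc]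
  abel

/-- The first step of `sigOd_closed`, from degree zero, where only the leading insertion of `dw`
occurs. -/
lemma step_one (hT : f ≫ T = dwTens w M - S ≫ om g) (ht : v ≫ t' = x)
    (hx : g ≫ x = x' ≫ F + z ≫ D) : f ≫ T ≫ om x =
      v ≫ (t' ≫ dwTens w B) + (S ≫ om z) ≫ (-om D) - (S ≫ om x') ≫ om F := by
  rw [← Category.assoc f, hT, Preadditive.sub_comp, dwTens_nat, Category.assoc, ← om_comp, hx,
    ← Category.assoc v, ht]
  simp only [om_add, om_comp, Preadditive.comp_add, Preadditive.comp_neg, Category.assoc]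
  abel

end Step

/-- The raising operator of the Atiyah complex from degree `2 j + 1` to degree `2 (j + 1)`. -/
def atUpOd (w : GlobalFun O) (n j : ℕ) (M : PMod O) :
    atObj n (2 * j + 1) M ⟶ atObj n (2 * (j + 1)) M := atUp w n (2 * j + 1) M

/-- The lowering operator of the Atiyah complex from degree `2 (j + 1)` to degree `2 j + 1`. -/
def atDownOd (n j : ℕ) (M : PMod O) :
    atObj n (2 * (j + 1)) M ⟶ atObj n (2 * j + 1) M := atDown n (2 * j + 1) M

mutual

/-- The commutation of the section with the differentials, in positive even degrees. -/
lemma sigEv_closed (w : GlobalFun O) : ∀ (n j : ℕ) {M N : PMod O} (c : Connection M)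
    (c' : Connection N) (f : M ⟶ N) (g : N ⟶ M) (hfg : f ≫ g = w.mul M) (hgf : g ≫ f = w.mul N),
    f ≫ sigEv n (j + 1) c' (c'.comm c g) (c.comm c' f) c =
      sigEv n (j + 1) c (c.comm c' f) (c'.comm c g) c' ≫ atMap n (2 * (j + 1)) f +
      (sigOd n j c (c.comm c' f) (c'.comm c g) c' ≫ atUpOd w n j N +
        sigOd n (j + 1) c (c.comm c' f) (c'.comm c g) c' ≫ atDown n (2 * (j + 1)) N)
  | 0, _, _, _, _, _, _, _, _, _ => to_zero _ _
  | n + 1, j, M, N, c, c', f, g, hfg, hgf =>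
    step_even (c.comm_comp c' w f g hfg) (sigOd_trunc n j c _ _ c')
      (sigOd_closed w n j c' c g f hgf hfg)

/-- The commutation of the section with the differentials, in odd degrees. -/
lemma sigOd_closed (w : GlobalFun O) : ∀ (n j : ℕ) {M N : PMod O} (c : Connection M)
    (c' : Connection N) (f : M ⟶ N) (g : N ⟶ M) (hfg : f ≫ g = w.mul M) (hgf : g ≫ f = w.mul N),
    f ≫ sigOd n j c' (c'.comm c g) (c.comm c' f) c =
      sigEv n j c (c.comm c' f) (c'.comm c g) c' ≫ atUp w n (2 * j) M +
        sigEv n (j + 1) c (c.comm c' f) (c'.comm c g) c' ≫ atDownOd n j M -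
        sigOd n j c (c.comm c' f) (c'.comm c g) c' ≫ atMap n (2 * j + 1) g
  | 0, _, _, _, _, _, _, _, _, _ => to_zero _ _
  | n + 1, 0, M, N, c, c', f, g, hfg, hgf =>
    step_one (v := sigEv (n + 1) 0 c (c.comm c' f) (c'.comm c g) c') (c.comm_comp c' w f g hfg)
      (sigEv_trunc n 0 c _ _ c') (sigEv_closed_zero n c' c g f)
  | n + 1, j + 1, M, N, c, c', f, g, hfg, hgf =>
    step_odd (c.comm_comp c' w f g hfg) (sigEv_trunc n (j + 1) c _ _ c')
      (sigEv_closed w n j c' c g f hgf hfg)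

end

end Sigma

/-- The components of the section on a summand of a curved module. -/
def sigTot (n : ℕ) {M N : PMod O} (c : Connection M) (S : M ⟶ tens (Om O) N)
    (T : N ⟶ tens (Om O) M) (c' : Connection N) :
    M ⟶ prod (pi fun j => atObj n (2 * j) M) (pi fun j => atObj n (2 * j + 1) N) :=
  pair (piLift fun j => sigEv n j c S T c') (piLift fun j => sigOd n j c S T c')

lemma sigTot_closed (w : GlobalFun O) (n : ℕ) {M N : PMod O} (c : Connection M)
    (c' : Connection N) (f : M ⟶ N) (g : N ⟶ M) (hfg : f ≫ g = w.mul M) (hgf : g ≫ f = w.mul N) :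
    f ≫ sigTot n c' (c'.comm c g) (c.comm c' f) c = sigTot n c (c.comm c' f) (c'.comm c g) c' ≫
      mat ((atMixed w n).evMap f) ((atMixed w n).odEv N) ((atMixed w n).evOd M)
        (-(atMixed w n).odMap g) := by
  refine prod_hom_ext (pi_hom_ext fun j => ?_) (pi_hom_ext fun j => ?_)
  · cases j with
    | zero => exact sigEv_closed_zero n c c' f g
    | succ j => exact sigEv_closed w n j c c' f g hfg hgf
  · exact (sigOd_closed w n j c c' f g hfg hgf).trans (sub_eq_add_neg _ _)

/-- The closed section of the augmentation of the Atiyah curved module of `E` defined by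
connections on the components of `E`. -/
def atiyahSec {w : GlobalFun O} (n : ℕ) (E : Curved w) (c0 : Connection E.M0)
    (c1 : Connection E.M1) : E ⟶ atiyah n E where
  f0 := sigTot n c0 (c0.comm c1 E.d0) (c1.comm c0 E.d1) c1
  f1 := sigTot n c1 (c1.comm c0 E.d1) (c0.comm c1 E.d0) c0
  comm0 := sigTot_closed w n c0 c1 E.d0 E.d1 E.d0_d1 E.d1_d0
  comm1 := sigTot_closed w n c1 c0 E.d1 E.d0 E.d1_d0 E.d0_d1

lemma atiyahSec_aug {w : GlobalFun O} (n : ℕ) (E : Curved w) (c0 : Connection E.M0)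
    (c1 : Connection E.M1) : atiyahSec n E c0 c1 ≫ atiyahAug n E = 𝟙 E := by
  have h : ∀ {M N : PMod O} (c : Connection M) (S : M ⟶ tens (Om O) N) (T : N ⟶ tens (Om O) M)
      (c' : Connection N), sigEv n 0 c S T c' ≫ atEps n M = 𝟙 M := fun c S T c' => by
    rw [sigEv_zero]; exact atSec_eps n c
  exact Curved.Hom.ext (h _ _ _ _) (h _ _ _ _)

/-! ### The exterior exponential of the Atiyah complex -/

namespace PMod

variable {M N P : PMod O}

lemma csmul_comp (a : k) (f : M ⟶ N) (g : N ⟶ P) : csmul a f ≫ g = csmul a (f ≫ g) :=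
  hom_ext' fun U x => by simp only [comp_app, csmul_app, k_smul, map_smul]

lemma comp_csmul (a : k) (f : M ⟶ N) (g : N ⟶ P) : f ≫ csmul a g = csmul a (f ≫ g) :=
  hom_ext' fun U x => by simp only [comp_app, csmul_app]

lemma csmul_csmul (a b : k) (f : M ⟶ N) : csmul a (csmul b f) = csmul (a * b) f :=
  hom_ext' fun U x => by simp only [csmul_app, mul_smul]

lemma csmul_zero (a : k) : csmul a (0 : M ⟶ N) = 0 :=
  hom_ext' fun U x => by simp only [csmul_app, zero_app, smul_zero]

lemma zero_csmul (f : M ⟶ N) : csmul (0 : k) f = 0 :=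
  hom_ext' fun U x => by simp only [csmul_app, zero_app, zero_smul]

lemma one_csmul (f : M ⟶ N) : csmul (1 : k) f = f :=
  hom_ext' fun U x => by simp only [csmul_app, one_smul]

lemma csmul_succ (q : ℕ) (f : M ⟶ N) : csmul ((q + 1 : ℕ) : k) f = f + csmul (q : k) f :=
  hom_ext' fun U x => by
    simp only [csmul_app, add_app, Nat.cast_add, Nat.cast_one, add_smul, one_smul, add_comm]

lemma om_csmul (a : k) (f : M ⟶ N) : om (csmul a f) = csmul a (om f) :=
  tens_hom_ext fun U x y => by simp only [om_app, csmul_app, k_smul, tmk_smul_right]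

/-- Exterior multiplications anticommute, by polarization of `ewedge_self`. -/
lemma ewedge_anticomm {K : PMod O} (q : ℕ) (U : C) (a b : K.obj U) (x : (ext K q).obj U) :
    ewedge (q + 1) U a (ewedge q U b x) = -ewedge (q + 1) U b (ewedge q U a x) := by
  have h := ewedge_self q U (a + b) x
  simp only [map_add, LinearMap.add_apply, ewedge_self, zero_add, add_zero] at h
  exact eq_neg_of_add_eq_zero_right h

lemma wedge_nat (q : ℕ) (f : M ⟶ N) :
    om (tmap (𝟙 (lam O q)) f) ≫ wedge q N = wedge q M ≫ tmap (𝟙 _) f :=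
  tens_hom_ext fun U a t => tens_induction
    (p := fun t => (om (tmap (𝟙 (lam O q)) f) ≫ wedge q N).app U (tmk _ _ U a t) =
      (wedge q M ≫ tmap (𝟙 _) f).app U (tmk _ _ U a t)) t (fun x y => by simp)
    (by rw [tmk_zero_right, map_zero, map_zero]) fun s t hs ht => by
      rw [tmk_add_right, map_add, map_add, hs, ht]

lemma wedge_dw (w : GlobalFun O) (q : ℕ) (M : PMod O) :
    om (dwWedge w q M) ≫ wedge (q + 1) M = -(wedge q M ≫ dwWedge w (q + 1) M) :=
  tens_hom_ext fun U a t => tens_induction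
    (p := fun t => (om (dwWedge w q M) ≫ wedge (q + 1) M).app U (tmk _ _ U a t) =
      (-(wedge q M ≫ dwWedge w (q + 1) M)).app U (tmk _ _ U a t)) t
    (fun x y => by
      simp only [comp_app, neg_app, om_app, wedge_app, dwWedge_app]
      rw [ewedge_anticomm]
      exact TensorProduct.neg_tmul _ _)
    (by rw [tmk_zero_right, map_zero, map_zero]) fun s t hs ht => by
      rw [tmk_add_right, map_add, map_add, hs, ht]

lemma lamOne_nat (f : M ⟶ N) : f ≫ lamOne N = lamOne M ≫ tmap (𝟙 _) f :=
  hom_ext' fun U x => by simp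

end PMod

lemma atWedge_nat : ∀ (n q : ℕ) {M N : PMod O} (f : M ⟶ N),
    atMap n q f ≫ atWedge n q N = atWedge n q M ≫ tmap (𝟙 (lam O q)) f
  | n, 0, M, N, f => by
    have h : atMap n 0 f ≫ atEps n N ≫ lamOne N = (atEps n M ≫ lamOne M) ≫ tmap (𝟙 _) f := by
      rw [← Category.assoc, atEps_nat, Category.assoc, Category.assoc, lamOne_nat]
    cases n <;> exact h
  | 0, q + 1, M, N, f => (Limits.comp_zero).trans (Limits.zero_comp).symm
  | n + 1, q + 1, M, N, f => by
    have h : om (atMap n q f) ≫ om (atWedge n q N) ≫ wedge q N =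
        (om (atWedge n q M) ≫ wedge q M) ≫ tmap (𝟙 _) f := by
      rw [← Category.assoc, ← om_comp, atWedge_nat, om_comp, Category.assoc, wedge_nat,
        Category.assoc]
    exact h

/-- The lowering operator is based on `ι`, whose image is killed by `ε`. -/
lemma atDown_wedge : ∀ (n q : ℕ) (M : PMod O), atDown n q M ≫ atWedge n q M = 0
  | 0, _, _ => Limits.zero_comp
  | n + 1, 0, M => by
    have h : iotaE (atEps n M) ≫ eps M ≫ lamOne M = 0 := by
      rw [← Category.assoc, iotaE_eps, Limits.zero_comp]
    exact h
  | n + 1, q + 1, M => by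
    have h : (-om (atDown n q M)) ≫ om (atWedge n q M) ≫ wedge q M = 0 := by
      rw [← Category.assoc, Preadditive.neg_comp, ← om_comp, atDown_wedge, om_zero, neg_zero,
        Limits.zero_comp]
    exact h

lemma atWedge_zero (n : ℕ) (M : PMod O) : atWedge n 0 M = atEps n M ≫ lamOne M := by
  cases n <;> rfl

lemma atTrunc_wedge : ∀ (n q : ℕ) (_ : q ≤ n) (M : PMod O),
    atTrunc n q M ≫ atWedge n q M = atWedge (n + 1) q M
  | n, 0, _, M => by
    rw [atWedge_zero, atWedge_zero, ← Category.assoc, atTrunc_eps]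
  | n + 1, q + 1, hq, M => by
    have h : om (atTrunc n q M) ≫ om (atWedge n q M) ≫ wedge q M =
        om (atWedge (n + 1) q M) ≫ wedge q M := by
      rw [← Category.assoc, ← om_comp, atTrunc_wedge n q (by omega)]
    exact h

lemma om_dwWedge_wedge (w : GlobalFun O) (q : ℕ) {A M : PMod O} (b : A ⟶ tens (lam O q) M) :
    om (b ≫ dwWedge w q M) ≫ wedge (q + 1) M =
      -((om b ≫ wedge q M) ≫ dwWedge w (q + 1) M) := by
  rw [om_comp, Category.assoc, wedge_dw, Preadditive.comp_neg, Category.assoc]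

lemma upS_wedge (w : GlobalFun O) (q : ℕ) {A B M : PMod O} (t : tens (Om O) A ⟶ B) (v : A ⟶ B)
    (b : B ⟶ tens (lam O q) M) : upS w t v ≫ om b ≫ wedge q M =
      (t ≫ b) ≫ dwWedge w q M - om (v ≫ b) ≫ wedge q M := by
  rw [upS, Preadditive.sub_comp, ← Category.assoc (om v), ← om_comp, Category.assoc,
    ← Category.assoc (dwTens w _), dwTens_nat, dwWedge]
  simp only [Category.assoc]

/-- The induction step of `atUp_wedge`. The sign of the recursion for the raising operator cancels
the one of exchanging `dw` with the first form. -/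
lemma upS_wedge_succ (w : GlobalFun O) (q : ℕ) {A B M : PMod O} {t : tens (Om O) A ⟶ B}
    {v : A ⟶ B} {b : B ⟶ tens (lam O (q + 1)) M} {a : A ⟶ tens (lam O q) M}
    (h1 : t ≫ b = om a ≫ wedge q M)
    (h2 : v ≫ b = csmul ((q + 1 : ℕ) : k) (a ≫ dwWedge w q M)) :
    upS w t v ≫ om b ≫ wedge (q + 1) M =
      csmul ((q + 1 + 1 : ℕ) : k) ((om a ≫ wedge q M) ≫ dwWedge w (q + 1) M) := by
  rw [upS_wedge, h1, h2, om_csmul, csmul_comp, om_dwWedge_wedge, csmul_succ (q + 1)]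
  refine hom_ext' fun U x => ?_
  simp only [comp_app, add_app, sub_app, csmul_app, neg_app, smul_neg, sub_neg_eq_add]

/-- Each of the `q + 1` insertions of `dw` contributes the same exterior product. -/
lemma atUp_wedge (w : GlobalFun O) : ∀ (n q : ℕ) (_ : q + 1 ≤ n) (M : PMod O),
    atUp w n q M ≫ atWedge n (q + 1) M =
      csmul ((q + 1 : ℕ) : k) (atWedge n q M ≫ dwWedge w q M)
  | n + 1, 0, _, M => by
    have h1 : ∀ {A B : PMod O} (f : A ⟶ B), csmul ((0 + 1 : ℕ) : k) f = f := fun f => by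
      rw [zero_add, Nat.cast_one, one_csmul]
    have h : (atTrunc n 0 M ≫ dwTens w _) ≫ om (atWedge n 0 M) ≫ wedge 0 M =
        csmul ((0 + 1 : ℕ) : k) (atWedge (n + 1) 0 M ≫ dwWedge w 0 M) := by
      rw [h1, Category.assoc, ← Category.assoc (dwTens w _),
        dwTens_nat, ← atTrunc_wedge n 0 (by omega), dwWedge]
      simp only [Category.assoc]
    exact h
  | n + 1, q + 1, hq, M =>
    upS_wedge_succ w q (atTrunc_wedge n (q + 1) (by omega) M) (atUp_wedge w n q (by omega) M)

lemma ifac_succ (n q : ℕ) (hk : (n.factorial : k) ≠ 0) (hq : q + 1 ≤ n) :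
    ifac k n (q + 1) * ((q + 1 : ℕ) : k) = ifac k n q := by
  have h : ((q + 1).factorial : k) ≠ 0 := fun h => hk (by
    obtain ⟨c, hc⟩ := Nat.factorial_dvd_factorial hq
    rw [hc, Nat.cast_mul, h, zero_mul])
  rw [ifac, ifac, if_pos hq, if_pos (by omega)]
  rw [Nat.factorial_succ, Nat.cast_mul] at h ⊢
  rw [mul_inv, mul_right_comm, inv_mul_cancel₀ (left_ne_zero_of_mul h), one_mul]

lemma hom_eq_of_subsingleton {M K N : PMod O} (h : ∀ U, Subsingleton (K.obj U))
    (f g : M ⟶ tens K N) : f = g := hom_ext' fun U x => by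
  have : ∀ t : (tens K N).obj U, t = 0 := fun t => tens_induction (p := fun t => t = 0) t
    (fun a b => by rw [(h U).elim a 0, tmk_zero_left]) rfl fun s t hs ht => by
      rw [hs, ht, add_zero]
  rw [this (f.app U x), this (g.app U x)]

/-- The exponential of the Atiyah complex is a closed morphism, if `n!` is invertible and the forms
of degree `n + 1` vanish. -/
lemma atExp_isClosedFamily (w : GlobalFun O) (n : ℕ) (hk : (n.factorial : k) ≠ 0)
    (hΩ : ∀ U, Subsingleton ((lam O (n + 1)).obj U)) (E : Curved w) :
    IsClosedFamily (m := atMixed w n) (m' := omegaMixed w) (atExp n) E := by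
  refine isClosedFamily_of_comm (m := atMixed w n) (m' := omegaMixed w) _ E
    (fun q M N f => ?_) (fun q M => ?_) fun q M => ?_
  · change atMap n q f ≫ csmul _ (atWedge n q N) = csmul _ (atWedge n q M) ≫ tmap (𝟙 _) f
    rw [comp_csmul, csmul_comp, atWedge_nat]
  · change atUp w n q M ≫ csmul _ (atWedge n (q + 1) M) =
      csmul _ (atWedge n q M) ≫ dwWedge w q M
    rcases lt_trichotomy q n with hq | rfl | hq
    · rw [comp_csmul, csmul_comp, atUp_wedge w n q hq, csmul_csmul, ifac_succ n q hk hq]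
    · -- In top degree the raising operator of `At(E)` vanishes, and `dw ∧ -` has values in zero.
      exact hom_eq_of_subsingleton hΩ _ _
    · rw [ifac, ifac, if_neg (by omega), if_neg (by omega), zero_csmul, zero_csmul,
        Limits.comp_zero, Limits.zero_comp]
  · change atDown n q M ≫ csmul _ (atWedge n q M) = atExp n (q + 1) M ≫ 0
    rw [comp_csmul, atDown_wedge, csmul_zero]
    exact Limits.comp_zero.symm

mutual

/-- The exterior product turns the section into the exterior powers of the commutator. -/
lemma sigEv_wedge : ∀ (n j : ℕ) (_ : 2 * j ≤ n) {M N : PMod O} (c : Connection M)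
    (S : M ⟶ tens (Om O) N) (T : N ⟶ tens (Om O) M) (c' : Connection N),
    sigEv n j c S T c' ≫ atWedge n (2 * j) M = powEv S T j
  | n, 0, _, M, N, c, S, T, c' => by
    have h : sigEv n 0 c S T c' ≫ atWedge n 0 M = lamOne M := by
      rw [sigEv_zero]
      exact ((congrArg (atSec n c ≫ ·) (atWedge_zero n M)).trans (Category.assoc _ _ _).symm).trans
        ((congrArg (· ≫ lamOne M) (atSec_eps n c)).trans (Category.id_comp _))
    exact h
  | n + 1, j + 1, hj, M, N, c, S, T, c' => by
    have h : (S ≫ om (sigOd n j c' T S c)) ≫ om (atWedge n (2 * j + 1) M) ≫ wedge (2 * j + 1) M =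
        S ≫ om (powOd T S j) ≫ wedge (2 * j + 1) M := by
      rw [Category.assoc, ← Category.assoc (om _) (om _), ← om_comp,
        sigOd_wedge n j (by omega)]
    exact h

lemma sigOd_wedge : ∀ (n j : ℕ) (_ : 2 * j + 1 ≤ n) {M N : PMod O} (c : Connection M)
    (S : M ⟶ tens (Om O) N) (T : N ⟶ tens (Om O) M) (c' : Connection N),
    sigOd n j c S T c' ≫ atWedge n (2 * j + 1) N = powOd S T j
  | n + 1, j, hj, M, N, c, S, T, c' => by
    have h : (S ≫ om (sigEv n j c' T S c)) ≫ om (atWedge n (2 * j) N) ≫ wedge (2 * j) N =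
        S ≫ om (powEv T S j) ≫ wedge (2 * j) N := by
      rw [Category.assoc, ← Category.assoc (om _) (om _), ← om_comp,
        sigEv_wedge n j (by omega)]
    exact h

end

lemma sigTot_exp (n : ℕ) {M N : PMod O} (c : Connection M) (S : M ⟶ tens (Om O) N)
    (T : N ⟶ tens (Om O) M) (c' : Connection N) :
    sigTot n c S T c' ≫ foldComp (m := atObj n) (m' := fun q M => tens (lam O q) M) (atExp n) M N =
      expPow n S T := by
  have h1 : ∀ j, sigEv n j c S T c' ≫ csmul (ifac k n (2 * j)) (atWedge n (2 * j) M) =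
      csmul (ifac k n (2 * j)) (powEv S T j) := fun j => by
    by_cases hj : 2 * j ≤ n
    · rw [comp_csmul, sigEv_wedge n j hj]
    · rw [ifac, if_neg hj, zero_csmul, zero_csmul, Limits.comp_zero]
  have h2 : ∀ j, sigOd n j c S T c' ≫ csmul (ifac k n (2 * j + 1)) (atWedge n (2 * j + 1) N) =
      csmul (ifac k n (2 * j + 1)) (powOd S T j) := fun j => by
    by_cases hj : 2 * j + 1 ≤ n
    · rw [comp_csmul, sigOd_wedge n j hj]
    · rw [ifac, if_neg hj, zero_csmul, zero_csmul, Limits.comp_zero]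
  refine hom_ext' fun U x => Prod.ext (funext fun j => ?_) (funext fun j => ?_)
  · refine Eq.trans ?_ (congrArg (fun q : M ⟶ tens (lam O (2 * j)) M => q.app U x) (h1 j))
    exact add_zero _
  · refine Eq.trans ?_ (congrArg (fun q : M ⟶ tens (lam O (2 * j + 1)) N => q.app U x) (h2 j))
    exact zero_add _

/-- The exponential of the commutator with the connections is the composite of the section of the
Atiyah curved module with its exponential; in particular it is closed. -/
lemma exists_expNabla {w : GlobalFun O} (n : ℕ) (E : Curved w) (c0 : Connection E.M0)
    (c1 : Connection E.M1)
    (hc : IsClosedFamily (m := atMixed w n) (m' := omegaMixed w) (atExp n) E) :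
    ∃ φ : E ⟶ omegaTensor E, φ.f0 = expNabla0 n E c0 c1 ∧ φ.f1 = expNabla1 n E c0 c1 ∧
      φ = atiyahSec n E c0 c1 ≫ foldHom (m := atMixed w n) (m' := omegaMixed w) (atExp n) E hc :=
  ⟨_, sigTot_exp n c0 _ _ c1, sigTot_exp n c1 _ _ c0, rfl⟩

/-! ### From the curved bar complex to the Atiyah complex -/

namespace PMod

variable {A B M N : PMod O}

lemma frfr_hom_ext {f g : fr (fr M) ⟶ N}
    (h : ∀ U a b x, f.app U (fmk (fr M) U a (fmk M U b x)) =
      g.app U (fmk (fr M) U a (fmk M U b x))) : f = g :=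
  fr_hom_ext fun U a t => fr_induction
    (p := fun t => f.app U (fmk (fr M) U a t) = g.app U (fmk (fr M) U a t)) t (h U a)
    (by rw [fmk_zero_right, map_zero, map_zero]) fun s t hs ht => by
      rw [fmk_add_right, map_add, map_add, hs, ht]

lemma frfrfr_hom_ext {f g : fr (fr (fr M)) ⟶ N}
    (h : ∀ U a b c x, f.app U (fmk (fr (fr M)) U a (fmk (fr M) U b (fmk M U c x))) =
      g.app U (fmk (fr (fr M)) U a (fmk (fr M) U b (fmk M U c x)))) : f = g :=
  frfr_hom_ext fun U a b t => fr_induction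
    (p := fun t => f.app U (fmk (fr (fr M)) U a (fmk (fr M) U b t)) =
      g.app U (fmk (fr (fr M)) U a (fmk (fr M) U b t))) t (h U a b)
    (by simp only [fmk_zero_right, map_zero]) fun s t hs ht => by
      simp only [fmk_add_right, map_add, hs, ht]

lemma kap_nat (f : M ⟶ N) : frMap (frMap f) ≫ kap N = kap M ≫ om (frMap f) :=
  frfr_hom_ext fun U a b x => by simp

end PMod

section BarToAtiyah

variable {A M : PMod O}

lemma bdS_app (d : fr A ⟶ A) (U : C) (a : O.ring U) (x : (fr A).obj U) :
    (bdS d).app U (fmk (fr A) U a x) = a • x - fmk A U a (d.app U x) := by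
  rw [bdS, sub_app, act_app, frMap_app]

lemma buS_app (w : GlobalFun O) (v : A ⟶ fr A) (U : C) (a : O.ring U) (x : A.obj U) :
    (buS w v).app U (fmk A U a x) =
      fmk (fr A) U a (fmk A U (w.val U) x) - fmk (fr A) U a (v.app U x) := by
  rw [buS, sub_app, insW_app, frMap_app]

lemma bdS_kap (d : fr A ⟶ A) : bdS (bdS d) ≫ kap A = kap (fr A) ≫ (-om (bdS d)) :=
  frfrfr_hom_ext fun U a b c x => by
    simp only [comp_app, neg_app, bdS_app, kap_app, map_sub, map_smul, fmk_sub_right, om_app,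
      ← fmk_smul, dd_mul, tmk_add_left, tmk_smul_left, tmk_sub_right, one_smul]
    rw [← fmk_one A U c x, tmk_smul_right]
    simp only [smul_add, smul_neg, smul_sub, smul_smul]
    abel

lemma bdS_act_jmk (M : PMod O) : bdS (act M) ≫ jmk M = kap M ≫ iotaE (act M) :=
  frfr_hom_ext fun U a b x => by
    rw [comp_app, comp_app, bdS_app, kap_app, iotaE, comp_app, map_smul, om_app, map_smul,
      act_app, act_app, one_smul, iota_app, map_sub, smul_sub, smul_jmk, map_smul]

lemma buS_kap (w : GlobalFun O) (v : A ⟶ fr A) : buS w (buS w v) ≫ kap (fr A) =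
    dwTens w (fr (fr A)) - kap A ≫ om (buS w v) :=
  frfr_hom_ext fun U a b x => by
    simp only [comp_app, sub_app, buS_app, kap_app, map_sub, om_app, fmk_sub_right, dwTens_app, dw,
      tmk_sub_right, map_smul, smul_sub]
    rw [← fmk_one (fr A) U a (fmk A U b x), tmk_smul_right]

lemma buS_zero_kap (w : GlobalFun O) (M : PMod O) :
    buS w (0 : M ⟶ fr M) ≫ kap M = dwTens w (fr M) := fr_hom_ext fun U a x => by
  rw [comp_app, buS_app, zero_app, fmk_zero_right, sub_zero, kap_app, dwTens_app, dw,
    ← tmk_smul_right, fmk_one]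

section Step

variable {N B X Y : PMod O} {w : GlobalFun O}

/-! The lemmas of this section are the induction steps of the corresponding statements about
`barAt`. -/

lemma kap_sq {f : M ⟶ N} {a : fr M ⟶ X} {b : fr N ⟶ Y} {g : X ⟶ Y}
    (h : frMap f ≫ b = a ≫ g) :
    frMap (frMap f) ≫ kap N ≫ om b = (kap M ≫ om a) ≫ om g := by
  rw [← Category.assoc, kap_nat, Category.assoc, ← om_comp, Category.assoc, ← om_comp, h]

lemma kap_tri {a : fr M ⟶ X} {b : fr M ⟶ Y} {g : X ⟶ Y} (h : a ≫ g = b) :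
    (kap M ≫ om a) ≫ om g = kap M ≫ om b := by
  rw [Category.assoc, ← om_comp, h]

lemma kap_wedge {q : ℕ} {a : fr M ⟶ X} {g : X ⟶ tens (lam O q) N} {b : fr M ⟶ tens (lam O q) N}
    (h : a ≫ g = b) : (kap M ≫ om a) ≫ om g ≫ wedge q N = kap M ≫ om b ≫ wedge q N := by
  rw [← Category.assoc, kap_tri h, Category.assoc]

lemma kap_bd {d : fr A ⟶ A} {b : fr A ⟶ X} {a : fr (fr A) ⟶ Y} {g : Y ⟶ X}
    (h : bdS d ≫ b = a ≫ g) :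
    bdS (bdS d) ≫ kap A ≫ om b = (kap (fr A) ≫ om a) ≫ (-om g) := by
  rw [← Category.assoc, bdS_kap, Category.assoc, Preadditive.neg_comp, ← om_comp, h, om_comp,
    Category.assoc, Preadditive.comp_neg (om _)]

lemma kap_up_zero {b : fr M ⟶ B} {j : fr M ⟶ X} {t : X ⟶ B} (h : j ≫ t = b) :
    buS w (0 : M ⟶ fr M) ≫ kap M ≫ om b = j ≫ t ≫ dwTens w B := by
  rw [← Category.assoc j, h, ← Category.assoc, buS_zero_kap, dwTens_nat]

lemma kap_up {v : A ⟶ fr A} {b : fr (fr A) ⟶ B} {a : fr A ⟶ X} {V : X ⟶ B}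
    {t : tens (Om O) X ⟶ B} (h : buS w v ≫ b = a ≫ V) (ht : (kap A ≫ om a) ≫ t = b) :
    buS w (buS w v) ≫ kap (fr A) ≫ om b = (kap A ≫ om a) ≫ upS w t V := by
  rw [← Category.assoc, buS_kap, upS, Preadditive.comp_sub, Preadditive.sub_comp, dwTens_nat,
    ← Category.assoc _ t, ht, Category.assoc, Category.assoc, ← om_comp, ← om_comp, h]

lemma kap_iota {b : fr M ⟶ X} {e : X ⟶ M} (h : b ≫ e = act M) :
    bdS (act M) ≫ jmk M = (kap M ≫ om b) ≫ iotaE e := by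
  rw [bdS_act_jmk, Category.assoc, iotaE_pre h]

end Step

/-- The map `a₀ ⊗ ⋯ ⊗ a_q ⊗ x ↦ a₀ da₁ ⊗ ⋯ ⊗ da_q ⊗ (1 ⊗ x)` from the bar complex to the Atiyah
complex of length `n`; it is `a₀ ⊗ x ↦ a₀ ⊗ x` in degree zero, it is followed by `ε` in degree `n`,
and it is zero above degree `n`. -/
def barAt : ∀ (n q : ℕ) (M : PMod O), barObj (q + 1) M ⟶ atObj n q M
  | 0, 0, M => act M
  | 0, q + 1, M => (0 : barObj (q + 1 + 1) M ⟶ zero O)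
  | n + 1, 0, M => jmk M
  | n + 1, q + 1, M => kap (barObj q M) ≫ om (barAt n q M)

lemma barAt_nat : ∀ (n q : ℕ) {M N : PMod O} (f : M ⟶ N),
    barMap (q + 1) f ≫ barAt n q N = barAt n q M ≫ atMap n q f
  | 0, 0, _, _, f => act_nat f
  | 0, _ + 1, _, _, _ => to_zero _ _
  | _ + 1, 0, M, N, f => by
    have h : frMap f ≫ jmk N = jmk M ≫ jetMap f := fr_hom_ext fun U a x => by simp
    exact h
  | n + 1, q + 1, M, N, f => kap_sq (barAt_nat n q f)

lemma barAt_eps : ∀ (n : ℕ) (M : PMod O), barAt n 0 M ≫ atEps n M = act M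
  | 0, M => Category.comp_id (act M)
  | _ + 1, M => by
    have h : jmk M ≫ eps M = act M := fr_hom_ext fun U a x => by simp
    exact h

lemma barAt_trunc : ∀ (n q : ℕ) (M : PMod O), barAt (n + 1) q M ≫ atTrunc n q M = barAt n q M
  | 0, 0, M => barAt_eps 1 M
  | 0, _ + 1, _ => to_zero _ _
  | _ + 1, 0, M => Category.comp_id (jmk M)
  | n + 1, q + 1, M => kap_tri (barAt_trunc n q M)

lemma barAt_down : ∀ (n q : ℕ) (M : PMod O),
    barDown (q + 1) M ≫ barAt n q M = barAt n (q + 1) M ≫ atDown n q M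
  | 0, 0, M => by
    have h : bdS (act M) ≫ act M = (0 : barObj 2 M ⟶ zero O) ≫ (0 : zero O ⟶ M) := by
      rw [bdS_act]; exact Limits.comp_zero.symm
    exact h
  | 0, _ + 1, _ => to_zero _ _
  | n + 1, 0, M => kap_iota (barAt_eps n M)
  | n + 1, q + 1, M => kap_bd (barAt_down n q M)

lemma barAt_up (w : GlobalFun O) : ∀ (n q : ℕ) (M : PMod O),
    barUp w (q + 1) M ≫ barAt n (q + 1) M = barAt n q M ≫ atUp w n q M
  | 0, _, _ => to_zero _ _
  | n + 1, 0, M => kap_up_zero (barAt_trunc n 0 M)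
  | n + 1, q + 1, M => kap_up (barAt_up w n q M) (barAt_trunc n (q + 1) M)

lemma barAt_isClosedFamily (w : GlobalFun O) (n : ℕ) (E : Curved w) :
    IsClosedFamily (m := barMixed w) (m' := atMixed w n) (barAt n) E :=
  isClosedFamily_of_comm (m := barMixed w) (m' := atMixed w n) _ E
    (fun q _ _ f => barAt_nat n q f) (fun q M => barAt_up w n q M) fun q M => barAt_down n q M

/-- The closed morphism from the curved bar complex to the Atiyah curved module. -/
def barToAtiyah {w : GlobalFun O} (n : ℕ) (E : Curved w) : bar E ⟶ atiyah n E :=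
  foldHom (m := barMixed w) (m' := atMixed w n) (barAt n) E (barAt_isClosedFamily w n E)

lemma barToAtiyah_aug {w : GlobalFun O} (n : ℕ) (E : Curved w) :
    barToAtiyah n E ≫ atiyahAug n E = barAug E := by
  have h : ∀ (M N : PMod O) (U : C) (x : (prod (pi fun j => barObj (2 * j + 1) M)
      (pi fun j => barObj (2 * j + 1 + 1) N)).obj U),
      (atEps n M).app U ((barAt n 0 M).app U (x.1 0) + 0) = (act M).app U (x.1 0) :=
    fun M N U x => by
      rw [add_zero]
      exact congrArg (fun q : fr M ⟶ M => q.app U (x.1 0)) (barAt_eps n M)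
  exact Curved.Hom.ext (hom_ext' fun U x => h E.M0 E.M1 U x) (hom_ext' fun U x => h E.M1 E.M0 U x)

lemma barAt_wedge : ∀ (n q : ℕ) (_ : q ≤ n) (M : PMod O),
    barAt n q M ≫ atWedge n q M = barWedge q M
  | n, 0, _, M => by
    rw [atWedge_zero]
    exact (Category.assoc _ _ _).symm.trans (congrArg (· ≫ lamOne M) (barAt_eps n M))
  | n + 1, q + 1, hq, M => kap_wedge (barAt_wedge n q (by omega) M)

lemma barAt_exp (n q : ℕ) (M : PMod O) : barAt n q M ≫ atExp n q M = barExp n q M := by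
  rw [atExp, barExp, comp_csmul]
  by_cases hq : q ≤ n
  · rw [barAt_wedge n q hq]
  · rw [ifac, if_neg hq, zero_csmul, zero_csmul]

lemma foldComp_comp {m m' m'' : ℕ → PMod O → PMod O} (g : ∀ q M, m q M ⟶ m' q M)
    (g' : ∀ q M, m' q M ⟶ m'' q M) (M N : PMod O) :
    foldComp g M N ≫ foldComp g' M N = foldComp (fun q M => g q M ≫ g' q M) M N :=
  hom_ext' fun U x => Prod.ext
    (funext fun j => by
      change (g' (2 * j) M).app U ((g (2 * j) M).app U (x.1 j) + 0) + 0 =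
        (g' (2 * j) M).app U ((g (2 * j) M).app U (x.1 j)) + 0
      rw [add_zero, add_zero, add_zero])
    (funext fun j => by
      change 0 + (g' (2 * j + 1) N).app U (0 + (g (2 * j + 1) N).app U (x.2 j)) =
        0 + (g' (2 * j + 1) N).app U ((g (2 * j + 1) N).app U (x.2 j))
      rw [zero_add, zero_add, zero_add])

lemma foldComp_barExp (n : ℕ) (M N : PMod O) :
    foldComp (m := fun q M => barObj (q + 1) M) (barAt n) M N ≫
        foldComp (m' := fun q M => tens (lam O q) M) (atExp n) M N =
      foldComp (m := fun q M => barObj (q + 1) M) (barExp n) M N := by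
  rw [foldComp_comp]
  congr 1
  funext q M
  exact barAt_exp n q M

/-- The exponential of the bar complex factors through the one of the Atiyah complex, hence is
closed. -/
lemma barExp_isClosedFamily {w : GlobalFun O} (n : ℕ) (E : Curved w)
    (hc : IsClosedFamily (m := atMixed w n) (m' := omegaMixed w) (atExp n) E) :
    IsClosedFamily (m := barMixed w) (m' := omegaMixed w) (barExp n) E := by
  have e0 := Curved.hom_comm0 (barToAtiyah n E ≫
    foldHom (m := atMixed w n) (m' := omegaMixed w) (atExp n) E hc)
  have e1 := Curved.hom_comm1 (barToAtiyah n E ≫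
    foldHom (m := atMixed w n) (m' := omegaMixed w) (atExp n) E hc)
  have h0 : (barToAtiyah n E ≫ foldHom (m := atMixed w n) (m' := omegaMixed w)
    (atExp n) E hc).f0 = foldComp (m := fun q M => barObj (q + 1) M) (barExp n) E.M0 E.M1 :=
      foldComp_barExp n E.M0 E.M1
  have h1 : (barToAtiyah n E ≫ foldHom (m := atMixed w n) (m' := omegaMixed w)
    (atExp n) E hc).f1 = foldComp (m := fun q M => barObj (q + 1) M) (barExp n) E.M1 E.M0 :=
      foldComp_barExp n E.M1 E.M0
  rw [h0, h1] at e0 e1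
  exact ⟨e0, e1⟩

lemma barToAtiyah_exp {w : GlobalFun O} (n : ℕ) (E : Curved w)
    (hc : IsClosedFamily (m := atMixed w n) (m' := omegaMixed w) (atExp n) E)
    (hc' : IsClosedFamily (m := barMixed w) (m' := omegaMixed w) (barExp n) E) :
    barToAtiyah n E ≫ foldHom (m := atMixed w n) (m' := omegaMixed w) (atExp n) E hc =
      foldHom (m := barMixed w) (m' := omegaMixed w) (barExp n) E hc' :=
  Curved.Hom.ext (foldComp_barExp n E.M0 E.M1) (foldComp_barExp n E.M1 E.M0)

end BarToAtiyah

/-! ### The contraction of the bar complex of a projective module -/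

section BarContraction

variable {U : C}

/-- The map `a ⊗ x ↦ a ⊗ f x` over `U`, for a linear map `f`. -/
def frLin {M N : PMod O} (f : M.obj U →ₗ[O.ring U] N.obj U) :
    (fr M).obj U →ₗ[O.ring U] (fr N).obj U :=
  AlgebraTensorModule.map (LinearMap.id : O.ring U →ₗ[O.ring U] O.ring U) (f.restrictScalars k)

lemma frLin_fmk {M N : PMod O} (f : M.obj U →ₗ[O.ring U] N.obj U) (a : O.ring U) (x : M.obj U) :
    frLin f (fmk M U a x) = fmk N U a (f x) := rfl

/-- The homotopy `a₁ ⊗ ⋯ ⊗ a_q ⊗ x ↦ (-1)^q a₁ ⊗ ⋯ ⊗ a_q ⊗ s x`. -/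
def barHtpy {M : PMod O} (s : M.obj U →ₗ[O.ring U] (fr M).obj U) :
    ∀ q, (barObj q M).obj U →ₗ[O.ring U] (barObj (q + 1) M).obj U
  | 0 => s
  | q + 1 => -frLin (barHtpy s q)

lemma bdS_act_htpy {M : PMod O} (s : M.obj U →ₗ[O.ring U] (fr M).obj U)
    (hs : ∀ x, (act M).app U (s x) = x) (y : (fr M).obj U) :
    (bdS (act M)).app U ((-frLin s) y) + s ((act M).app U y) = y :=
  fr_induction (p := fun y => (bdS (act M)).app U ((-frLin s) y) + s ((act M).app U y) = y) y
    (fun a x => by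
      rw [LinearMap.neg_apply, frLin_fmk, map_neg, bdS_app, hs, act_app, map_smul]
      abel)
    (by simp only [map_zero, add_zero]) fun x y hx hy => by
      rw [map_add, map_add, map_add, map_add, add_add_add_comm, hx, hy]

lemma bdS_bdS_htpy {A : PMod O} (d : fr A ⟶ A) (h : A.obj U →ₗ[O.ring U] (fr A).obj U)
    (ih : ∀ y, (bdS d).app U ((-frLin h) y) + h (d.app U y) = y) (y : (fr (fr A)).obj U) :
    (bdS (bdS d)).app U ((-frLin (-frLin h)) y) + (-frLin h) ((bdS d).app U y) = y :=
  fr_induction (p := fun y => (bdS (bdS d)).app U ((-frLin (-frLin h)) y) +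
      (-frLin h) ((bdS d).app U y) = y) y
    (fun a x => by
      have e : fmk (fr A) U a x = fmk (fr A) U a ((bdS d).app U ((-frLin h) x)) +
          fmk (fr A) U a (h (d.app U x)) := by rw [← fmk_add_right, ih]
      have e1 : (-frLin (-frLin h)) (fmk (fr A) U a x) = -fmk (fr (fr A)) U a ((-frLin h) x) := by
        rw [LinearMap.neg_apply, frLin_fmk]
      have e2 : (-frLin h) (fmk A U a (d.app U x)) = -fmk (fr A) U a (h (d.app U x)) := by
        rw [LinearMap.neg_apply, frLin_fmk]
      rw [e1, map_neg, bdS_app, bdS_app d, map_sub, e2, map_smul]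
      refine Eq.trans ?_ e.symm
      abel)
    (by simp only [map_zero, add_zero]) fun x y hx hy => by
      rw [map_add, map_add, map_add, map_add, add_add_add_comm, hx, hy]

lemma barHtpy_comm {M : PMod O} (s : M.obj U →ₗ[O.ring U] (fr M).obj U)
    (hs : ∀ x, (act M).app U (s x) = x) : ∀ (q : ℕ) (y : (barObj (q + 1) M).obj U),
    (barDown (q + 1) M).app U (barHtpy s (q + 1) y) + barHtpy s q ((barDown q M).app U y) = y
  | 0, y => bdS_act_htpy s hs y
  | q + 1, y => bdS_bdS_htpy (barDown q M) (barHtpy s q) (barHtpy_comm s hs q) y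

/-- If the module of sections of `M` over `U` is projective, the action `O ⊗ₖ M → M` splits over
`U`, which yields a contraction of the augmented bar complex over `U`. -/
lemma exists_barContraction (w : GlobalFun O) (M : PMod O)
    (hM : Module.Projective (O.ring U) (M.obj U)) :
    Nonempty ((barMixed w).Contraction act M U) := by
  obtain ⟨s, hs⟩ := Module.projective_lifting_property ((act M).app U) LinearMap.id
    fun x => ⟨fmk M U 1 x, one_smul _ x⟩
  have hs' : ∀ x, (act M).app U (s x) = x := fun x => LinearMap.congr_fun hs x
  exact ⟨{
    s := s
    h := fun q => barHtpy s (q + 1)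
    aug_s := hs'
    htpy_zero := barHtpy_comm s hs' 0
    htpy_succ := fun q => barHtpy_comm s hs' (q + 1) }⟩

end BarContraction

/-! ### Naturality of contraction data -/

section Natural

variable {w : GlobalFun O} {m : Mixed w} {e : ∀ M, m.obj 0 M ⟶ M}

/-- Compatibility of a family of contractions with the restrictions. -/
def Mixed.Contraction.IsNatural {M : PMod O} (c : ∀ U, m.Contraction e M U) : Prop :=
  (∀ {U V : C} (h : V ≤ U) (x : M.obj U), (c V).s (M.res h x) = (m.obj 0 M).res h ((c U).s x)) ∧
    ∀ (q : ℕ) {U V : C} (h : V ≤ U) (x : (m.obj q M).obj U),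
      (c V).h q ((m.obj q M).res h x) = (m.obj (q + 1) M).res h ((c U).h q x)

namespace Mixed.Contraction.IsNatural

variable {M N : PMod O} {c : ∀ U, m.Contraction e M U} {c' : ∀ U, m.Contraction e N U}

lemma total (hc : IsNatural c) (hc' : IsNatural c') {U V : C} (h : V ≤ U)
    (x : (prod (m.ev M) (m.od N)).obj U) :
    (c V).total (c' V) ((prod (m.ev M) (m.od N)).res h x) =
      (prod (m.ev N) (m.od M)).res h ((c U).total (c' U) x) := by
  refine Prod.ext (funext fun j => ?_) (funext fun j => hc.2 (2 * j) h (x.1 j))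
  cases j with
  | zero => exact (map_zero ((m.obj (2 * 0) N).res h)).symm
  | succ j => exact hc'.2 (2 * j + 1) h (x.2 j)

lemma totalS (hc : IsNatural c) {U V : C} (h : V ≤ U) (x : M.obj U) :
    (c V).totalS N (M.res h x) = (prod (m.ev M) (m.od N)).res h ((c U).totalS N x) := by
  refine Prod.ext (funext fun j => ?_)
    (funext fun j => (map_zero ((m.obj (2 * j + 1) N).res h)).symm)
  cases j with
  | zero => exact hc.1 h x
  | succ j => exact (map_zero ((m.obj (2 * (j + 1)) M).res h)).symm

lemma totalU (hc : IsNatural c) (hc' : IsNatural c') (f : M ⟶ N) (g : N ⟶ M) {U V : C}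
    (h : V ≤ U) (x : (prod (m.ev M) (m.od N)).obj U) :
    (c V).totalU (c' V) f g ((prod (m.ev M) (m.od N)).res h x) =
      (prod (m.ev M) (m.od N)).res h ((c U).totalU (c' U) f g x) := by
  simp only [Mixed.Contraction.totalU, LinearMap.add_apply, LinearMap.comp_apply, map_add]
  rw [total hc hc', hom_nat, hom_nat, total hc' hc, hom_nat, totalS hc]

end Mixed.Contraction.IsNatural

/-- Compatibility of contraction data of a morphism of curved modules with the restrictions. -/
structure Retraction.IsNatural {M N : Curved w} {f : M ⟶ N}
    (r : ∀ U, Retraction (M.d0.app U) (M.d1.app U) (N.d0.app U) (N.d1.app U) (f.f0.app U)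
      (f.f1.app U)) : Prop where
  S0 : ∀ {U V : C} (h : V ≤ U) (x : N.M0.obj U), (r V).S0 (N.M0.res h x) = M.M0.res h ((r U).S0 x)
  S1 : ∀ {U V : C} (h : V ≤ U) (x : N.M1.obj U), (r V).S1 (N.M1.res h x) = M.M1.res h ((r U).S1 x)
  A0 : ∀ {U V : C} (h : V ≤ U) (x : M.M0.obj U), (r V).A0 (M.M0.res h x) = M.M1.res h ((r U).A0 x)
  A1 : ∀ {U V : C} (h : V ≤ U) (x : M.M1.obj U), (r V).A1 (M.M1.res h x) = M.M0.res h ((r U).A1 x)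

lemma symm_natural {M N : PMod O} {u : ∀ U, M.obj U ≃ₗ[O.ring U] N.obj U}
    (hu : ∀ {U V : C} (h : V ≤ U) (x : M.obj U), u V (M.res h x) = N.res h (u U x)) {U V : C}
    (h : V ≤ U) (y : N.obj U) : (u V).symm (N.res h y) = M.res h ((u U).symm y) := by
  rw [LinearEquiv.symm_apply_eq, hu, LinearEquiv.apply_symm_apply]

lemma perturb_natural {M0 M1 N0 N1 : PMod O} (d : M0 ⟶ M1) (e : N0 ⟶ N1)
    {s0 : ∀ U, N0.obj U →ₗ[O.ring U] M0.obj U} {s1 : ∀ U, N1.obj U →ₗ[O.ring U] M1.obj U}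
    {h1 : ∀ U, M1.obj U →ₗ[O.ring U] M0.obj U} {u : ∀ U, M1.obj U ≃ₗ[O.ring U] M1.obj U}
    (hs0 : ∀ {U V : C} (h : V ≤ U) (x : N0.obj U), s0 V (N0.res h x) = M0.res h (s0 U x))
    (hs1 : ∀ {U V : C} (h : V ≤ U) (x : N1.obj U), s1 V (N1.res h x) = M1.res h (s1 U x))
    (hh : ∀ {U V : C} (h : V ≤ U) (x : M1.obj U), h1 V (M1.res h x) = M0.res h (h1 U x))
    (hu : ∀ {U V : C} (h : V ≤ U) (x : M1.obj U), u V (M1.res h x) = M1.res h (u U x)) {U V : C}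
    (h : V ≤ U) (x : N0.obj U) :
    (s0 V + (h1 V ∘ₗ (u V).symm.toLinearMap) ∘ₗ (s1 V ∘ₗ e.app V - d.app V ∘ₗ s0 V))
        (N0.res h x) = M0.res h
      ((s0 U + (h1 U ∘ₗ (u U).symm.toLinearMap) ∘ₗ (s1 U ∘ₗ e.app U - d.app U ∘ₗ s0 U)) x) := by
  simp only [LinearMap.add_apply, LinearMap.comp_apply, LinearMap.sub_apply, LinearEquiv.coe_coe,
    map_add]
  rw [hs0, hom_nat, hom_nat, hs1, ← map_sub, symm_natural hu, hh]

lemma perturb_htpy_natural {M0 M1 : PMod O} {h1 : ∀ U, M1.obj U →ₗ[O.ring U] M0.obj U}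
    {u : ∀ U, M1.obj U ≃ₗ[O.ring U] M1.obj U}
    (hh : ∀ {U V : C} (h : V ≤ U) (x : M1.obj U), h1 V (M1.res h x) = M0.res h (h1 U x))
    (hu : ∀ {U V : C} (h : V ≤ U) (x : M1.obj U), u V (M1.res h x) = M1.res h (u U x)) {U V : C}
    (h : V ≤ U) (x : M1.obj U) : (-(h1 V ∘ₗ (u V).symm.toLinearMap)) (M1.res h x) =
      M0.res h ((-(h1 U ∘ₗ (u U).symm.toLinearMap)) x) := by
  simp only [LinearMap.neg_apply, LinearMap.comp_apply, LinearEquiv.coe_coe, map_neg]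
  rw [symm_natural hu, hh]

lemma Mixed.retraction_isNatural
    {he : ∀ {M N : PMod O} (f : M ⟶ N), m.map 0 f ≫ e N = e M ≫ f}
    {hd : ∀ M, m.down 0 M ≫ e M = 0} (E : Curved w) {c0 : ∀ U, m.Contraction e E.M0 U}
    {c1 : ∀ U, m.Contraction e E.M1 U} (h0 : Contraction.IsNatural c0)
    (h1 : Contraction.IsNatural c1) :
    Retraction.IsNatural (f := m.aug e he hd E)
      fun U => m.retraction (he := he) (hd := hd) E (c0 U) (c1 U) where
  S0 h x := perturb_natural (M0 := (m.fold E).M0) (M1 := (m.fold E).M1) (m.fold E).d0 E.d0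
    (s0 := fun U => (c0 U).totalS E.M1) (s1 := fun U => (c1 U).totalS E.M0)
    (h1 := fun U => (c1 U).total (c0 U))
    (u := fun U => LinearEquiv.ofBijective _ ((c1 U).totalU_bijective (c0 U) E.d1 E.d0))
    h0.totalS h1.totalS (h1.total h0) (h1.totalU h0 E.d1 E.d0) h x
  S1 h x := perturb_natural (M0 := (m.fold E).M1) (M1 := (m.fold E).M0) (m.fold E).d1 E.d1
    (s0 := fun U => (c1 U).totalS E.M0) (s1 := fun U => (c0 U).totalS E.M1)
    (h1 := fun U => (c0 U).total (c1 U))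
    (u := fun U => LinearEquiv.ofBijective _ ((c0 U).totalU_bijective (c1 U) E.d0 E.d1))
    h1.totalS h0.totalS (h0.total h1) (h0.totalU h1 E.d0 E.d1) h x
  A0 h x := perturb_htpy_natural (M0 := (m.fold E).M1) (M1 := (m.fold E).M0)
    (h1 := fun U => (c0 U).total (c1 U))
    (u := fun U => LinearEquiv.ofBijective _ ((c0 U).totalU_bijective (c1 U) E.d0 E.d1))
    (h0.total h1) (h0.totalU h1 E.d0 E.d1) h x
  A1 h x := perturb_htpy_natural (M0 := (m.fold E).M0) (M1 := (m.fold E).M1)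
    (h1 := fun U => (c1 U).total (c0 U))
    (u := fun U => LinearEquiv.ofBijective _ ((c1 U).totalU_bijective (c0 U) E.d1 E.d0))
    (h1.total h0) (h1.totalU h0 E.d1 E.d0) h x

end Natural

/-! ### Contractible curved modules are coacyclic -/

namespace Curved

variable {w : GlobalFun O}

/-- The zero curved module. -/
def zeroC (w : GlobalFun O) : Curved w where
  M0 := zero O
  M1 := zero O
  d0 := 0
  d1 := 0
  d0_d1 := to_zero _ _
  d1_d0 := to_zero _ _

/-- The zero morphism to a curved module. -/
def zeroHom (N M : Curved w) : N ⟶ M where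
  f0 := 0
  f1 := 0
  comm0 := by rw [Limits.comp_zero, Limits.zero_comp]
  comm1 := by rw [Limits.comp_zero, Limits.zero_comp]

/-- The cone of a morphism with natural contraction data is coacyclic: it is contractible. -/
lemma isCoacyclic_cone (P : Curved w → Prop) {M N : Curved w} (f : M ⟶ N) (hz : P (zeroC w))
    (hP : P (cone f))
    (r : ∀ U, Retraction (M.d0.app U) (M.d1.app U) (N.d0.app U) (N.d1.app U) (f.f0.app U)
      (f.f1.app U)) (hr : Retraction.IsNatural r) : IsCoacyclic P (cone f) := by
  have i0 : (zeroHom (zeroC w) (zeroC w)).f0 ≫ (zeroHom (zeroC w) (zeroC w)).f0 = 0 := to_zero _ _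
  have i1 : (zeroHom (zeroC w) (zeroC w)).f1 ≫ (zeroHom (zeroC w) (zeroC w)).f1 = 0 := to_zero _ _
  have hex : IsShortExact (0 : zero O ⟶ zero O) (0 : zero O ⟶ zero O) := fun U =>
    ⟨fun _ _ _ => rfl, fun _ => ⟨fun _ => ⟨PUnit.unit, rfl⟩, fun _ => rfl⟩,
      fun _ => ⟨PUnit.unit, rfl⟩⟩
  -- The total curved module of the zero sequence is coacyclic, and its components are trivial.
  have hZ := IsCoacyclic.tot (P := P) hz hz hz (zeroHom (zeroC w) (zeroC w))
    (zeroHom (zeroC w) (zeroC w)) hex hex i0 i1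
  refine IsCoacyclic.equiv hP (zeroHom _ _) (zeroHom _ _) ⟨0, 0, ?_, ?_⟩ ?_ hZ
  · exact hom_ext' fun _ _ => rfl
  · exact hom_ext' fun _ _ => rfl
  · let A0 : M.M0 ⟶ M.M1 := ⟨fun U => -(r U).A0, fun h x => by simp [hr.A0 h x]⟩
    let A1 : M.M1 ⟶ M.M0 := ⟨fun U => -(r U).A1, fun h x => by simp [hr.A1 h x]⟩
    let S0 : N.M0 ⟶ M.M0 := ⟨fun U => -(r U).S0, fun h x => by simp [hr.S0 h x]⟩
    let S1 : N.M1 ⟶ M.M1 := ⟨fun U => -(r U).S1, fun h x => by simp [hr.S1 h x]⟩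
    refine ⟨mat A1 S0 0 0, mat A0 S1 0 0, hom_ext' fun U x => ?_, hom_ext' fun U x => ?_⟩
    · have e1 := (r U).htpy1 x.1
      have e2 := (r U).S_d0 x.2
      have e3 := (r U).f_A1 x.1
      have e4 := (r U).f_S0 x.2
      refine Prod.ext ?_ ?_
      · change 0 - x.1 = (-(M.d0.app U (-(r U).A1 x.1 + -(r U).S0 x.2)) + 0) +
          (-(r U).A0 (-(M.d1.app U x.1) + 0) + -(r U).S1 (f.f1.app U x.1 + N.d0.app U x.2))
        simp only [map_add, map_neg, add_zero, neg_neg, e2, neg_add_rev]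
        have e5 : (r U).S1 (f.f1.app U x.1) =
          M.d0.app U ((r U).A1 x.1) + (r U).A0 (M.d1.app U x.1) + x.1 := by rw [e1]; abel
        rw [e5]
        abel
      · change 0 - x.2 = (f.f0.app U (-(r U).A1 x.1 + -(r U).S0 x.2) + N.d1.app U (0 + 0)) + (0 + 0)
        simp only [map_add, map_neg, e3, e4, map_zero]
        abel
    · have e1 := (r U).htpy0 x.1
      have e2 := (r U).S_d1 x.2
      have e3 := (r U).f_A0 x.1
      have e4 := (r U).f_S1 x.2
      refine Prod.ext ?_ ?_
      · change 0 - x.1 = (-(M.d1.app U (-(r U).A0 x.1 + -(r U).S1 x.2)) + 0) +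
          (-(r U).A1 (-(M.d0.app U x.1) + 0) + -(r U).S0 (f.f0.app U x.1 + N.d1.app U x.2))
        simp only [map_add, map_neg, add_zero, neg_neg, e2, neg_add_rev]
        have e5 : (r U).S0 (f.f0.app U x.1) =
          M.d1.app U ((r U).A0 x.1) + (r U).A1 (M.d0.app U x.1) + x.1 := by rw [e1]; abel
        rw [e5]
        abel
      · change 0 - x.2 = (f.f1.app U (-(r U).A0 x.1 + -(r U).S1 x.2) + N.d0.app U (0 + 0)) + (0 + 0)
        simp only [map_add, map_neg, e3, e4, map_zero]
        abel

/-! ### Exactness of cones -/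

section Exact

variable {U : C}

/-- If `f` has contraction data over `U` and the components of `c` are bijective over `U`, then the
cone of `f ≫ c` is exact over `U`. -/
lemma cone_exact0 {w : GlobalFun O} {M N K : Curved w} (f : M ⟶ N) (c : N ⟶ K)
    (r : Retraction (M.d0.app U) (M.d1.app U) (N.d0.app U) (N.d1.app U) (f.f0.app U)
      (f.f1.app U)) (h0 : Function.Bijective (c.f0.app U)) (h1 : Function.Bijective (c.f1.app U))
    (s : (cone (f ≫ c)).M1.obj U) (hs : (cone (f ≫ c)).d1.app U s = 0) :
    ∃ t, (cone (f ≫ c)).d0.app U t = s := by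
  obtain ⟨n, hn⟩ := h1.2 s.2
  have hs1 : -(M.d0.app U s.1) + 0 = 0 := congrArg Prod.fst hs
  have hs2 : c.f0.app U (f.f0.app U s.1) + K.d1.app U s.2 = 0 := congrArg Prod.snd hs
  have hd : M.d0.app U s.1 = 0 := by rw [add_zero] at hs1; exact neg_eq_zero.1 hs1
  have hc1 : c.f0.app U (N.d1.app U n) = K.d1.app U (c.f1.app U n) :=
    congrArg (fun q : N.M1 ⟶ K.M0 => q.app U n) (hom_comm1 c)
  have hm : f.f0.app U s.1 + N.d1.app U n = 0 := h0.1 (by rw [map_add, map_zero, hc1, hn, hs2])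
  refine ⟨(r.A0 s.1 + r.S1 n, 0), Prod.ext ?_ ?_⟩
  · change -(M.d1.app U (r.A0 s.1 + r.S1 n)) + 0 = s.1
    have e1 := r.htpy0 s.1
    rw [hd, map_zero, add_zero] at e1
    rw [map_add, e1, ← r.S_d1, eq_neg_of_add_eq_zero_right hm, map_neg]
    abel
  · change c.f1.app U (f.f1.app U (r.A0 s.1 + r.S1 n)) + K.d0.app U 0 = s.2
    rw [map_add, r.f_A0, r.f_S1, zero_add, map_zero, add_zero, hn]

lemma cone_exact1 {w : GlobalFun O} {M N K : Curved w} (f : M ⟶ N) (c : N ⟶ K)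
    (r : Retraction (M.d0.app U) (M.d1.app U) (N.d0.app U) (N.d1.app U) (f.f0.app U)
      (f.f1.app U)) (h0 : Function.Bijective (c.f0.app U)) (h1 : Function.Bijective (c.f1.app U))
    (s : (cone (f ≫ c)).M0.obj U) (hs : (cone (f ≫ c)).d0.app U s = 0) :
    ∃ t, (cone (f ≫ c)).d1.app U t = s := by
  obtain ⟨n, hn⟩ := h0.2 s.2
  have hs1 : -(M.d1.app U s.1) + 0 = 0 := congrArg Prod.fst hs
  have hs2 : c.f1.app U (f.f1.app U s.1) + K.d0.app U s.2 = 0 := congrArg Prod.snd hs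
  have hd : M.d1.app U s.1 = 0 := by rw [add_zero] at hs1; exact neg_eq_zero.1 hs1
  have hc1 : c.f1.app U (N.d0.app U n) = K.d0.app U (c.f0.app U n) :=
    congrArg (fun q : N.M0 ⟶ K.M1 => q.app U n) (hom_comm0 c)
  have hm : f.f1.app U s.1 + N.d0.app U n = 0 := h1.1 (by rw [map_add, map_zero, hc1, hn, hs2])
  refine ⟨(r.A1 s.1 + r.S0 n, 0), Prod.ext ?_ ?_⟩
  · change -(M.d0.app U (r.A1 s.1 + r.S0 n)) + 0 = s.1
    have e1 := r.htpy1 s.1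
    rw [hd, map_zero, add_zero] at e1
    rw [map_add, e1, ← r.S_d0, eq_neg_of_add_eq_zero_right hm, map_neg]
    abel
  · change c.f0.app U (f.f0.app U (r.A1 s.1 + r.S0 n)) + K.d1.app U 0 = s.2
    rw [map_add, r.f_A1, r.f_S0, zero_add, map_zero, add_zero, hn]

end Exact

/-! ### Contraction data of tensor products -/

section Tensor

variable {U : C}

/-- The map `f ⊗ 1` over `U`. -/
def rTens {K L : PMod O} (f : K.obj U →ₗ[O.ring U] L.obj U) (V : PMod O) :
    (tens K V).obj U →ₗ[O.ring U] (tens L V).obj U := LinearMap.rTensor (V.obj U) f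

lemma rTens_tmk {K L : PMod O} (f : K.obj U →ₗ[O.ring U] L.obj U) (V : PMod O) (a : K.obj U)
    (b : V.obj U) : rTens f V (tmk K V U a b) = tmk L V U (f a) b := rfl

lemma tens_sub_left (K V : PMod O) (a a' : K.obj U) (b : V.obj U) :
    tmk K V U (a - a') b = tmk K V U a b - tmk K V U a' b := TensorProduct.sub_tmul a a' b

lemma rTens_comm {K L V V' : PMod O} (f : K.obj U →ₗ[O.ring U] L.obj U) (g : V ⟶ V')
    (x : (tens K V).obj U) :
    rTens f V' ((tmap (𝟙 K) g).app U x) = (tmap (𝟙 L) g).app U (rTens f V x) :=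
  tens_induction (p := fun x => rTens f V' ((tmap (𝟙 K) g).app U x) =
    (tmap (𝟙 L) g).app U (rTens f V x)) x (fun a b => rfl) (by simp only [map_zero])
    fun s t hs ht => by simp only [map_add, hs, ht]

lemma rTens_zero {K L N : PMod O} {f : K.obj U →ₗ[O.ring U] L.obj U} {g : L ⟶ N}
    (h : ∀ x, g.app U (f x) = 0) (V : PMod O) (x : (tens K V).obj U) :
    (tmap g (𝟙 V)).app U (rTens f V x) = 0 :=
  tens_induction (p := fun x => (tmap g (𝟙 V)).app U (rTens f V x) = 0) x
    (fun a b => by rw [rTens_tmk, tmap_app, h, tmk_zero_left]) (by simp only [map_zero])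
    fun s t hs ht => by rw [map_add, map_add, hs, ht, add_zero]

lemma rTens_sec {K L : PMod O} {f : K.obj U →ₗ[O.ring U] L.obj U} {g : L ⟶ K}
    (h : ∀ x, g.app U (f x) = x) (V : PMod O) (x : (tens K V).obj U) :
    (tmap g (𝟙 V)).app U (rTens f V x) = x :=
  tens_induction (p := fun x => (tmap g (𝟙 V)).app U (rTens f V x) = x) x
    (fun a b => by rw [rTens_tmk, tmap_app, h, id_app]) (by simp only [map_zero])
    fun s t hs ht => by rw [map_add, map_add, hs, ht]

lemma rTens_sq {K L K' L' : PMod O} {f : K.obj U →ₗ[O.ring U] L.obj U} {g : L ⟶ L'} {g' : K ⟶ K'}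
    {f' : K'.obj U →ₗ[O.ring U] L'.obj U} (h : ∀ x, f' (g'.app U x) = g.app U (f x)) (V : PMod O)
    (x : (tens K V).obj U) :
    rTens f' V ((tmap g' (𝟙 V)).app U x) = (tmap g (𝟙 V)).app U (rTens f V x) :=
  tens_induction (p := fun x => rTens f' V ((tmap g' (𝟙 V)).app U x) =
      (tmap g (𝟙 V)).app U (rTens f V x)) x
    (fun a b => by rw [rTens_tmk, tmap_app, tmap_app, rTens_tmk, h]) (by simp only [map_zero])
    fun s t hs ht => by simp only [map_add, hs, ht]

lemma rTens_htpy {K L N : PMod O} {d : L ⟶ K} {A : K.obj U →ₗ[O.ring U] L.obj U} {d' : K ⟶ L}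
    {A' : L.obj U →ₗ[O.ring U] K.obj U} {S : N.obj U →ₗ[O.ring U] K.obj U} {f : K ⟶ N}
    (h : ∀ x, d.app U (A x) + A' (d'.app U x) = S (f.app U x) - x) (V : PMod O)
    (x : (tens K V).obj U) :
    (tmap d (𝟙 V)).app U (rTens A V x) + rTens A' V ((tmap d' (𝟙 V)).app U x) =
      rTens S V ((tmap f (𝟙 V)).app U x) - x :=
  tens_induction (p := fun x => (tmap d (𝟙 V)).app U (rTens A V x) +
      rTens A' V ((tmap d' (𝟙 V)).app U x) = rTens S V ((tmap f (𝟙 V)).app U x) - x) x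
    (fun a b => by
      simp only [rTens_tmk, tmap_app, id_app]
      rw [← tmk_add_left, h, tens_sub_left]) (by simp only [map_zero, add_zero, sub_zero])
    fun s t hs ht => by
      simp only [map_add]
      rw [add_add_add_comm, hs, ht]
      abel

/-- Contraction data for `f ⊗ V` from contraction data for `f`. -/
def _root_.CurvedSheaf.Retraction.tensor {M N : Curved w} {f : M ⟶ N}
    (r : Retraction (M.d0.app U) (M.d1.app U) (N.d0.app U) (N.d1.app U) (f.f0.app U)
      (f.f1.app U)) (V : Curved (-w)) :
    Retraction ((tensor M V).d0.app U) ((tensor M V).d1.app U) ((tensor N V).d0.app U)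
      ((tensor N V).d1.app U) ((tensorMap f V).f0.app U) ((tensorMap f V).f1.app U) where
  S0 := (rTens r.S0 V.M0).prodMap (rTens r.S1 V.M1)
  S1 := (rTens r.S1 V.M0).prodMap (rTens r.S0 V.M1)
  A0 := (rTens r.A0 V.M0).prodMap (rTens r.A1 V.M1)
  A1 := (rTens r.A1 V.M0).prodMap (rTens r.A0 V.M1)
  f_A0 x := Prod.ext ((add_zero _).trans (rTens_zero r.f_A0 V.M0 x.1))
    ((zero_add _).trans (rTens_zero r.f_A1 V.M1 x.2))
  f_A1 x := Prod.ext ((add_zero _).trans (rTens_zero r.f_A1 V.M0 x.1))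
    ((zero_add _).trans (rTens_zero r.f_A0 V.M1 x.2))
  f_S0 x := Prod.ext ((add_zero _).trans (rTens_sec r.f_S0 V.M0 x.1))
    ((zero_add _).trans (rTens_sec r.f_S1 V.M1 x.2))
  f_S1 x := Prod.ext ((add_zero _).trans (rTens_sec r.f_S1 V.M0 x.1))
    ((zero_add _).trans (rTens_sec r.f_S0 V.M1 x.2))
  S_d0 x := by
    refine Prod.ext ?_ ?_
    · change rTens r.S1 V.M0 ((tmap N.d0 (𝟙 _)).app U x.1 + -((tmap (𝟙 _) V.d1).app U x.2)) =
        (tmap M.d0 (𝟙 _)).app U (rTens r.S0 V.M0 x.1) +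
          -((tmap (𝟙 _) V.d1).app U (rTens r.S1 V.M1 x.2))
      rw [map_add, map_neg, rTens_comm, rTens_sq r.S_d0]
    · change rTens r.S0 V.M1 ((tmap (𝟙 _) V.d0).app U x.1 + (tmap N.d1 (𝟙 _)).app U x.2) =
        (tmap (𝟙 _) V.d0).app U (rTens r.S0 V.M0 x.1) +
          (tmap M.d1 (𝟙 _)).app U (rTens r.S1 V.M1 x.2)
      rw [map_add, rTens_comm, rTens_sq r.S_d1]
  S_d1 x := by
    refine Prod.ext ?_ ?_
    · change rTens r.S0 V.M0 ((tmap N.d1 (𝟙 _)).app U x.1 + (tmap (𝟙 _) V.d1).app U x.2) =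
        (tmap M.d1 (𝟙 _)).app U (rTens r.S1 V.M0 x.1) +
          (tmap (𝟙 _) V.d1).app U (rTens r.S0 V.M1 x.2)
      rw [map_add, rTens_comm, rTens_sq r.S_d1]
    · change rTens r.S1 V.M1 (-((tmap (𝟙 _) V.d0).app U x.1) + (tmap N.d0 (𝟙 _)).app U x.2) =
        -((tmap (𝟙 _) V.d0).app U (rTens r.S1 V.M0 x.1)) +
          (tmap M.d0 (𝟙 _)).app U (rTens r.S0 V.M1 x.2)
      rw [map_add, map_neg, rTens_comm, rTens_sq r.S_d0]
  htpy0 x := by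
    refine Prod.ext ?_ ?_
    · change ((tmap M.d1 (𝟙 _)).app U (rTens r.A0 V.M0 x.1) +
          (tmap (𝟙 _) V.d1).app U (rTens r.A1 V.M1 x.2)) +
        rTens r.A1 V.M0 ((tmap M.d0 (𝟙 _)).app U x.1 + -((tmap (𝟙 _) V.d1).app U x.2)) =
        rTens r.S0 V.M0 ((tmap f.f0 (𝟙 _)).app U x.1 + 0) - x.1
      rw [map_add, map_neg, rTens_comm, add_zero, ← rTens_htpy r.htpy0 V.M0 x.1]
      abel
    · change (-((tmap (𝟙 _) V.d0).app U (rTens r.A0 V.M0 x.1)) +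
          (tmap M.d0 (𝟙 _)).app U (rTens r.A1 V.M1 x.2)) +
        rTens r.A0 V.M1 ((tmap (𝟙 _) V.d0).app U x.1 + (tmap M.d1 (𝟙 _)).app U x.2) =
        rTens r.S1 V.M1 (0 + (tmap f.f1 (𝟙 _)).app U x.2) - x.2
      rw [map_add, rTens_comm, zero_add, ← rTens_htpy r.htpy1 V.M1 x.2]
      abel
  htpy1 x := by
    refine Prod.ext ?_ ?_
    · change ((tmap M.d0 (𝟙 _)).app U (rTens r.A1 V.M0 x.1) +
          -((tmap (𝟙 _) V.d1).app U (rTens r.A0 V.M1 x.2))) +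
        rTens r.A0 V.M0 ((tmap M.d1 (𝟙 _)).app U x.1 + (tmap (𝟙 _) V.d1).app U x.2) =
        rTens r.S1 V.M0 ((tmap f.f1 (𝟙 _)).app U x.1 + 0) - x.1
      rw [map_add, rTens_comm, add_zero, ← rTens_htpy r.htpy1 V.M0 x.1]
      abel
    · change ((tmap (𝟙 _) V.d0).app U (rTens r.A1 V.M0 x.1) +
          (tmap M.d1 (𝟙 _)).app U (rTens r.A0 V.M1 x.2)) +
        rTens r.A1 V.M1 (-((tmap (𝟙 _) V.d0).app U x.1) + (tmap M.d0 (𝟙 _)).app U x.2) =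
        rTens r.S0 V.M1 (0 + (tmap f.f0 (𝟙 _)).app U x.2) - x.2
      rw [map_add, map_neg, rTens_comm, zero_add, ← rTens_htpy r.htpy0 V.M1 x.2]
      abel

end Tensor

end Curved

/-! ### The exponential of the Atiyah class -/

lemma atContraction_isNatural (w : GlobalFun O) (n : ℕ) {M : PMod O} (c : Connection M) :
    Mixed.Contraction.IsNatural (m := atMixed w n) (e := atEps n)
      fun U => atContraction w n c U :=
  ⟨fun h x => hom_nat (atSec n c) h x, fun q _ _ h x => hom_nat (atHtpy n q c) h x⟩

/-- Contraction data of the augmentation `At(E) → E`, defined by a pair of connections. -/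
def atiyahRetraction {w : GlobalFun O} (n : ℕ) (E : Curved w) (c0 : Connection E.M0)
    (c1 : Connection E.M1) (U : C) :
    Retraction ((atiyah n E).d0.app U) ((atiyah n E).d1.app U) (E.d0.app U) (E.d1.app U)
      ((atiyahAug n E).f0.app U) ((atiyahAug n E).f1.app U) :=
  (atMixed w n).retraction E (atContraction w n c0 U) (atContraction w n c1 U)

lemma atiyahRetraction_isNatural {w : GlobalFun O} (n : ℕ) (E : Curved w) (c0 : Connection E.M0)
    (c1 : Connection E.M1) : Retraction.IsNatural (f := atiyahAug n E)
      fun U => atiyahRetraction n E c0 c1 U :=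
  (atMixed w n).retraction_isNatural E (atContraction_isNatural w n c0)
    (atContraction_isNatural w n c1)

lemma isCoacyclic_cone_atiyahAug {w : GlobalFun O} (P : Curved w → Prop) (n : ℕ) (E : Curved w)
    (c0 : Connection E.M0) (c1 : Connection E.M1) (hz : P (Curved.zeroC w))
    (hP : P (Curved.cone (atiyahAug n E))) :
    Curved.IsCoacyclic P (Curved.cone (atiyahAug n E)) :=
  Curved.isCoacyclic_cone P (atiyahAug n E) hz hP (fun U => atiyahRetraction n E c0 c1 U)
    (atiyahRetraction_isNatural n E c0 c1)

/-- A closed section `s` of the augmentation `At(E) → E` computes the exponential of the Atiyah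
class: the augmentation is invertible in the coderived category, with inverse `s`. -/
lemma expAt_eq {w : GlobalFun O} (P : ObjectProperty (Curved w)) (n : ℕ) (E : Curved w) (hE : P E)
    (hA : P (atiyah n E)) (hT : P (omegaTensor E))
    (hπ : Curved.IsCoacyclic P (Curved.cone (atiyahAug n E)))
    (hc : IsClosedFamily (m := atMixed w n) (m' := omegaMixed w) (atExp n) E)
    (s : E ⟶ atiyah n E) (hs : s ≫ atiyahAug n E = 𝟙 E) :
    expAt P n E hE hA hT hπ hc = (Curved.toCoDer P).map (X := ⟨E, hE⟩) (Y := ⟨omegaTensor E, hT⟩)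
      (ObjectProperty.homMk
        (s ≫ foldHom (m := atMixed w n) (m' := omegaMixed w) (atExp n) E hc)) := by
  let p : (⟨atiyah n E, hA⟩ : P.FullSubcategory) ⟶ ⟨E, hE⟩ := ObjectProperty.homMk (atiyahAug n E)
  let f : (⟨atiyah n E, hA⟩ : P.FullSubcategory) ⟶ ⟨omegaTensor E, hT⟩ :=
    ObjectProperty.homMk (foldHom (m := atMixed w n) (m' := omegaMixed w) (atExp n) E hc)
  let σ : (⟨E, hE⟩ : P.FullSubcategory) ⟶ ⟨atiyah n E, hA⟩ := ObjectProperty.homMk s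
  have hp := Curved.toCoDer_isIso P p hπ
  have h1 : σ ≫ p = 𝟙 _ := by
    ext1
    exact hs
  have h2 : (Curved.toCoDer P).map σ ≫ (Curved.toCoDer P).map p = 𝟙 _ := by
    rw [← Functor.map_comp, h1, CategoryTheory.Functor.map_id]
  have h3 : inv ((Curved.toCoDer P).map p) ≫ (Curved.toCoDer P).map f =
      (Curved.toCoDer P).map (σ ≫ f) := by
    rw [Functor.map_comp]
    exact congrArg (· ≫ (Curved.toCoDer P).map f) (IsIso.inv_eq_of_inv_hom_id h2)
  exact h3

/-- A roof `e ← b → z` may be replaced by a roof `e ← b' → z` through which it factors along `t`; if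
`i : a → e` lifts to `b'`, its composite with the roof comes from a morphism. -/
lemma roof_eq {A B : Type*} [Category A] [Category B] (L : A ⥤ B) {a b b' e z : A} {i : a ⟶ e}
    {c : a ⟶ b'} {t : b ⟶ b'} {l : b ⟶ e} {l' : b' ⟶ e} {g : b ⟶ z} {g' : b' ⟶ z}
    [IsIso (L.map l)] [IsIso (L.map l')] (hl : t ≫ l' = l) (hi : c ≫ l' = i) (hg : t ≫ g' = g) :
    L.map i ≫ inv (L.map l) ≫ L.map g = L.map (c ≫ g') := by
  subst hl hi hg
  have ht : IsIso (L.map t) := by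
    have : IsIso (L.map t ≫ L.map l') := by rw [← L.map_comp]; infer_instance
    exact IsIso.of_isIso_comp_right (L.map t) (L.map l')
  have e : inv (L.map (t ≫ l')) = inv (L.map l') ≫ inv (L.map t) := by
    rw [← IsIso.inv_comp]
    congr 1
    exact L.map_comp t l'
  rw [e]
  simp only [L.map_comp, Category.assoc, IsIso.hom_inv_id_assoc, IsIso.inv_hom_id_assoc]

namespace PMod

/-! ### Dual bases -/

lemma dualTensorHom_injective_of_dualBasis {R P N : Type u} [CommRing R] [AddCommGroup P]
    [AddCommGroup N] [Module R P] [Module R N] {m : ℕ} (e : Fin m → P)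
    (ξ : Fin m → Module.Dual R P) (h : ∀ x, ∑ i, ξ i x • e i = x) :
    Function.Injective (dualTensorHom R P N) := by
  refine Function.LeftInverse.injective (g := fun g => ∑ i, ξ i ⊗ₜ[R] g (e i)) fun t => ?_
  induction t using TensorProduct.induction_on with
  | zero => simp
  | tmul η p =>
    simp only [dualTensorHom_apply, ← TensorProduct.smul_tmul, ← TensorProduct.sum_tmul]
    congr 1
    refine LinearMap.ext fun x => ?_
    conv_rhs => rw [← h x, map_sum]
    simp [mul_comm]
  | add s t hs ht =>
    simp only [map_add, LinearMap.add_apply, TensorProduct.tmul_add, Finset.sum_add_distrib]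
    exact congrArg₂ (· + ·) hs ht

/-- The trace, defined by an inverse function of `P^∨ ⊗ (L ⊗ P) → Hom(P, L ⊗ P)`, in terms of a
dual basis, whose existence makes this map bijective. -/
lemma ptrace_eq_sum {R P L : Type u} [CommRing R] [AddCommGroup P] [AddCommGroup L] [Module R P]
    [Module R L] {m : ℕ} (e : Fin m → P) (ξ : Fin m → Module.Dual R P)
    (h : ∀ x, ∑ i, ξ i x • e i = x) (f : P →ₗ[R] L ⊗[R] P) :
    ptrace f = ∑ i, TensorProduct.rid R L (LinearMap.lTensor L (ξ i) (f (e i))) := by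
  have hf : dualTensorHom R P (L ⊗[R] P) (∑ i, ξ i ⊗ₜ[R] f (e i)) = f := by
    refine LinearMap.ext fun x => ?_
    conv_rhs => rw [← h x, map_sum]
    simp
  have hinv : Function.invFun (dualTensorHom R P (L ⊗[R] P)) f = ∑ i, ξ i ⊗ₜ[R] f (e i) :=
    (congrArg (Function.invFun _) hf.symm).trans
      (Function.leftInverse_invFun (dualTensorHom_injective_of_dualBasis e ξ h) _)
  rw [ptrace, hinv, map_sum]
  rfl

/-- A finite dual basis of a presheaf of modules over `U`: sections `e i` and compatible
functionals `ξ i` over the members below `U` with `x = ∑ i, ξ i x • e i`. -/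
structure DualBasis (K : PMod O) (U : C) where
  card : ℕ
  e : Fin card → K.obj U
  ξ : Fin card → (ihom K (unit O)).obj U
  sum_eq : ∀ (V : C) (h : V ≤ U) (x : K.obj V), ∑ i, dapp (ξ i) V h x • K.res h (e i) = x

section DualBasis

variable {K : PMod O} {U : C} (b : DualBasis K U)

lemma iapp_sum {ι : Type*} (s : Finset ι) {N : PMod O} (f : ι → (ihom K N).obj U) (V : C)
    (h : V ≤ U) (x : K.obj V) : iapp (∑ i ∈ s, f i) V h x = ∑ i ∈ s, iapp (f i) V h x := by
  classical
  induction s using Finset.induction_on with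
  | empty => rfl
  | insert a s ha ih => rw [Finset.sum_insert ha, Finset.sum_insert ha, iapp_add, ih]

lemma DualBasis.sum_self (x : K.obj U) : ∑ i, dapp (b.ξ i) U le_rfl x • b.e i = x := by
  have h := b.sum_eq U le_rfl x
  simpa only [K.res_id] using h

/-- The element of `M ⊗ K^∨` corresponding to a morphism `K → M` over `U`. -/
def DualBasis.coev (M : PMod O) (f : (ihom K M).obj U) : (tens M (ihom K (unit O))).obj U :=
  ∑ i, tmk M (ihom K (unit O)) U (iapp f U le_rfl (b.e i)) (b.ξ i)

lemma DualBasis.canHom_coev (M : PMod O) (f : (ihom K M).obj U) :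
    (canHom K M).app U (b.coev M f) = f := iext fun V h x => by
  rw [coev, map_sum, iapp_sum]
  have h1 : ∀ i, iapp ((canHom K M).app U (tmk M (ihom K (unit O)) U (iapp f U le_rfl (b.e i))
      (b.ξ i))) V h x = iapp f V h (dapp (b.ξ i) V h x • K.res h (b.e i)) := fun i => by
    rw [canHom_app, map_smul]
    exact congrArg _ (iapp_nat f le_rfl h (b.e i)).symm
  rw [Finset.sum_congr rfl fun i _ => h1 i, ← map_sum, b.sum_eq]

lemma DualBasis.coev_canHom (M : PMod O) (t : (tens M (ihom K (unit O))).obj U) :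
    b.coev M ((canHom K M).app U t) = t := by
  refine tens_induction (p := fun t => b.coev M ((canHom K M).app U t) = t) t (fun m ξ => ?_) ?_
    fun s t hs ht => ?_
  · have h1 : ∀ i, tmk M (ihom K (unit O)) U (iapp ((canHom K M).app U
        (tmk M (ihom K (unit O)) U m ξ)) U le_rfl (b.e i)) (b.ξ i) =
        tmk M (ihom K (unit O)) U m (dapp ξ U le_rfl (b.e i) • b.ξ i) := fun i => by
      rw [canHom_app, M.res_id, tmk_smul_left, tmk_smul_right]
    have h2 : ∑ i, dapp ξ U le_rfl (b.e i) • b.ξ i = ξ := iext fun V h x => by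
      rw [iapp_sum]
      have h3 : ∀ i, iapp (dapp ξ U le_rfl (b.e i) • b.ξ i) V h x =
          iapp ξ V h (dapp (b.ξ i) V h x • K.res h (b.e i)) := fun i => by
        rw [iapp_smul, map_smul, iapp_nat ξ le_rfl h (b.e i)]
        exact mul_comm (G := O.ring V) _ _
      rw [Finset.sum_congr rfl fun i _ => h3 i, ← map_sum, b.sum_eq]
    rw [coev, Finset.sum_congr rfl fun i _ => h1 i]
    change ∑ i, tmkₗ M (ihom K (unit O)) U m (dapp ξ U le_rfl (b.e i) • b.ξ i) = _
    rw [← map_sum, h2, tmkₗ_apply]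
  · rw [map_zero, coev]
    exact Finset.sum_eq_zero fun i _ => TensorProduct.zero_tmul _ _
  · rw [map_add]
    nth_rewrite 2 [← hs]
    nth_rewrite 2 [← ht]
    rw [coev, coev, coev, ← Finset.sum_add_distrib]
    exact Finset.sum_congr rfl fun i _ => by rw [iapp_add, tmk_add_left]

lemma DualBasis.canHom_bijective {K : PMod O} {U : C} (b : DualBasis K U) (M : PMod O) :
    Function.Bijective ((canHom K M).app U) :=
  Function.bijective_iff_has_inverse.2 ⟨b.coev M, b.coev_canHom M, b.canHom_coev M⟩

/-- The trace in terms of a dual basis. -/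
lemma DualBasis.ptrace_eq (L : PMod O)
    (f : K.obj U →ₗ[O.ring U] (tens L K).obj U) :
    ptrace (R := O.ring U) (P := K.obj U) (L := L.obj U) f =
      ∑ i, contrLin L K U (b.ξ i) (f (b.e i)) := by
  refine (ptrace_eq_sum b.e (fun i => iapp (b.ξ i) U le_rfl) b.sum_self f).trans
    (Finset.sum_congr rfl fun i _ => ?_)
  exact tens_induction (p := fun t => TensorProduct.rid (O.ring U) (L.obj U)
    (LinearMap.lTensor (L.obj U) (iapp (b.ξ i) U le_rfl) t) = contrLin L K U (b.ξ i) t) (f (b.e i))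
    (fun ω x => TensorProduct.rid_tmul _ _)
    ((congrArg _ (map_zero _)).trans ((map_zero _).trans (map_zero _).symm))
    fun s t hs ht => ((congrArg _ (map_add _ s t)).trans (map_add _ _ _)).trans
      ((congrArg₂ (· + ·) hs ht).trans (map_add _ s t).symm)

end DualBasis

end PMod

/-! ### Coevaluation and supertrace -/

lemma mat_diag_bijective {A B A' B' : PMod O} {a : A ⟶ A'} {d : B ⟶ B'} {U : C}
    (ha : Function.Bijective (a.app U)) (hd : Function.Bijective (d.app U)) :
    Function.Bijective ((mat a 0 0 d).app U) := by
  have h : ∀ x, (mat a 0 0 d).app U x = (a.app U x.1, d.app U x.2) := fun x =>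
    Prod.ext (add_zero _) (zero_add _)
  refine ⟨fun x y hxy => ?_, fun y => ?_⟩
  · rw [h, h] at hxy
    exact Prod.ext (ha.1 (congrArg Prod.fst hxy)) (hd.1 (congrArg Prod.snd hxy))
  · obtain ⟨x1, h1⟩ := ha.2 y.1
    obtain ⟨x2, h2⟩ := hd.2 y.2
    exact ⟨(x1, x2), (h _).trans (Prod.ext h1 h2)⟩

namespace Curved

variable {w : GlobalFun O} (E : Curved w)

lemma can_f0_bijective {U : C} (b0 : DualBasis E.M0 U) (b1 : DualBasis E.M1 U) (M : Curved w) :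
    Function.Bijective ((can E M).f0.app U) :=
  mat_diag_bijective (b0.canHom_bijective M.M0) (b1.canHom_bijective M.M1)

lemma can_f1_bijective {U : C} (b0 : DualBasis E.M0 U) (b1 : DualBasis E.M1 U) (M : Curved w) :
    Function.Bijective ((can E M).f1.app U) :=
  mat_diag_bijective (b0.canHom_bijective M.M1) (b1.canHom_bijective M.M0)

variable (b0 : ∀ U, DualBasis E.M0 U) (b1 : ∀ U, DualBasis E.M1 U)

/-- The element of `E ⊗ E^∨` over `U` corresponding to the identity of `E`. -/
def coevSec (U : C) : (tensor E E.dual).M0.obj U :=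
  ((b0 U).coev E.M0 (idSec E.M0 U), (b1 U).coev E.M1 (idSec E.M1 U))

lemma can_coevSec (U : C) :
    (can E E).f0.app U (coevSec E b0 b1 U) = (idSec E.M0 U, idSec E.M1 U) :=
  Prod.ext ((add_zero _).trans ((b0 U).canHom_coev E.M0 _))
    ((zero_add _).trans ((b1 U).canHom_coev E.M1 _))

/-- The coevaluation `O → E ⊗ E^∨`. -/
def coevC : unitC O ⟶ tensor E E.dual :=
  ofSection (N := tensor E E.dual) (coevSec E b0 b1)
    (fun {U V} h => (can_f0_bijective E (b0 V) (b1 V) E).1 (by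
      rw [hom_nat, can_coevSec, can_coevSec]
      rfl))
    fun U => (can_f1_bijective E (b0 U) (b1 U) E).1 (by
      have h1 : (can E E).f1.app U ((tensor E E.dual).d0.app U (coevSec E b0 b1 U)) =
          (homC E E).d0.app U ((can E E).f0.app U (coevSec E b0 b1 U)) :=
        congrArg (fun q : (tensor E E.dual).M0 ⟶ (homC E E).M1 => q.app U (coevSec E b0 b1 U))
          (hom_comm0 (can E E))
      rw [h1, can_coevSec, map_zero]
      exact Prod.ext (iext fun V _ x => add_neg_cancel (E.d0.app V x))
        (iext fun V _ x => neg_add_cancel (E.d1.app V x)))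

lemma coevC_can : coevC E b0 b1 ≫ can E E = idC E := by
  refine Hom.ext (hom_ext' fun U x => ?_) (hom_ext' fun U x => ?_)
  · refine ((can E E).f0.app U).map_smul (@id (O.ring U) x) (coevSec E b0 b1 U) |>.trans ?_
    rw [can_coevSec]
    rfl
  · exact map_zero ((can E E).f1.app U)

lemma contrPi_coev {K : PMod O} {U : C} (b : DualBasis K U) {F : ℕ → PMod O} {M : PMod O}
    (g : K ⟶ M) (p : M ⟶ pi fun j => tens (F j) K) (j : ℕ) :
    (contrPi p).app U ((tmap g (𝟙 _)).app U (b.coev K (idSec K U))) j =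
      ptrace (R := O.ring U) (P := K.obj U) (L := (F j).obj U)
        ((g ≫ p ≫ proj (fun j => tens (F j) K) j).app U) := by
  rw [DualBasis.coev, map_sum, map_sum]
  refine (Finset.sum_apply j _ _).trans ?_
  refine (Finset.sum_congr rfl fun i _ => ?_).trans (b.ptrace_eq (F j) _).symm
  rfl

/-- The contraction of `φ ⊗ 1`, applied to the coevaluation, is the supertrace of `φ`. -/
lemma contrC_coevSec (φ : E ⟶ omegaTensor E) (U : C) :
    (contrC E).f0.app U ((tensorMap φ E.dual).f0.app U (coevSec E b0 b1 U)) =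
      str φ.f0 φ.f1 U := funext fun j => by
  have h0 := contrPi_coev (b0 U) (F := fun j => lam O (2 * j)) φ.f0 (fst _ _) j
  have h1 := contrPi_coev (b1 U) (F := fun j => lam O (2 * j)) φ.f1 (fst _ _) j
  refine Eq.trans ?_ (congrArg₂ (· - ·) h0 h1)
  have e : (tensorMap φ E.dual).f0.app U (coevSec E b0 b1 U) =
      ((tmap φ.f0 (𝟙 _)).app U ((b0 U).coev E.M0 (idSec E.M0 U)),
        (tmap φ.f1 (𝟙 _)).app U ((b1 U).coev E.M1 (idSec E.M1 U))) :=
    Prod.ext (add_zero _) (zero_add _)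
  rw [e]
  rfl

/-- The composite `O → E ⊗ E^∨ → (Ω_dw ⊗ E) ⊗ E^∨ → Ω_dw`. -/
def traceHom (φ : E ⟶ omegaTensor E) : unitC O ⟶ omegaC w :=
  coevC E b0 b1 ≫ tensorMap φ E.dual ≫ contrC E

lemma traceHom_f0 (φ : E ⟶ omegaTensor E) (U : C) (a : O.ring U) :
    (traceHom E b0 b1 φ).f0.app U a = a • str φ.f0 φ.f1 U := by
  rw [← contrC_coevSec E b0 b1 φ U]
  refine (congrArg ((contrC E).f0.app U) (((tensorMap φ E.dual).f0.app U).map_smul a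
    (coevSec E b0 b1 U))).trans ?_
  exact ((contrC E).f0.app U).map_smul a _

include b0 b1 in
/-- The supertrace is compatible with restrictions, being the image of `1` under a morphism. -/
lemma str_res (φ : E ⟶ omegaTensor E) {U V : C} (h : V ≤ U) :
    (omegaC w).M0.res h (str φ.f0 φ.f1 U) = str φ.f0 φ.f1 V := by
  have h1 := hom_nat (traceHom E b0 b1 φ).f0 h (1 : O.ring U)
  have h2 : (unitC O).M0.res h (1 : O.ring U) = (1 : O.ring V) := map_one (O.res h)
  rw [h2, traceHom_f0, one_smul] at h1
  rw [h1]
  congr 1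
  exact ((traceHom_f0 E b0 b1 φ U 1).trans (one_smul _ _)).symm

include b0 b1 in
/-- The supertrace is closed, being the image of the closed section `1` under a closed morphism. -/
lemma str_closed (φ : E ⟶ omegaTensor E) (U : C) :
    (omegaC w).d0.app U (str φ.f0 φ.f1 U) = 0 := by
  have h1 : (traceHom E b0 b1 φ).f1.app U ((unitC O).d0.app U (1 : O.ring U)) =
      (omegaC w).d0.app U ((traceHom E b0 b1 φ).f0.app U (1 : O.ring U)) :=
    congrArg (fun q : (unitC O).M0 ⟶ (omegaC w).M1 => q.app U (1 : O.ring U))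
      (hom_comm0 (traceHom E b0 b1 φ))
  have h2 : (traceHom E b0 b1 φ).f0.app U (1 : O.ring U) = str φ.f0 φ.f1 U :=
    (traceHom_f0 E b0 b1 φ U 1).trans (one_smul _ _)
  rw [h2] at h1
  rw [← h1]
  exact map_zero ((traceHom E b0 b1 φ).f1.app U)

lemma traceHom_eq (φ : E ⟶ omegaTensor E)
    (hs : ∀ {U V : C} (h : V ≤ U), (omegaC w).M0.res h (str φ.f0 φ.f1 U) = str φ.f0 φ.f1 V)
    (hd : ∀ U, (omegaC w).d0.app U (str φ.f0 φ.f1 U) = 0) :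
    traceHom E b0 b1 φ = ofSection (N := omegaC w) (str φ.f0 φ.f1) hs hd :=
  Hom.ext (hom_ext' fun U a => traceHom_f0 E b0 b1 φ U a)
    (hom_ext' fun U a => map_zero ((traceHom E b0 b1 φ).f1.app U))

lemma tensorMap_comp {M N P : Curved w} (f : M ⟶ N) (g : N ⟶ P) (V : Curved (-w)) :
    tensorMap (f ≫ g) V = tensorMap f V ≫ tensorMap g V := by
  have h : ∀ {A B D A' B' D' K L : PMod O} (f : A ⟶ B) (g : B ⟶ D) (f' : A' ⟶ B') (g' : B' ⟶ D'),
      mat (tmap (f ≫ g) (𝟙 K)) 0 0 (tmap (f' ≫ g') (𝟙 L)) =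
        mat (tmap f (𝟙 K)) 0 0 (tmap f' (𝟙 L)) ≫ mat (tmap g (𝟙 K)) 0 0 (tmap g' (𝟙 L)) :=
    fun f g f' g' => by
      rw [mat_comp, tmap_comp, tmap_comp]
      simp
  exact Hom.ext (h _ _ _ _) (h _ _ _ _)

lemma tensorMap_id (M : Curved w) (V : Curved (-w)) : tensorMap (𝟙 M) V = 𝟙 _ := by
  have h : ∀ {A B K L : PMod O}, mat (tmap (𝟙 A) (𝟙 K)) 0 0 (tmap (𝟙 B) (𝟙 L)) =
      𝟙 (prod (tens A K) (tens B L)) := fun {A B K L} => by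
    have e : ∀ A K : PMod O, tmap (𝟙 A) (𝟙 K) = 𝟙 _ := fun A K => tens_hom_ext fun _ _ _ => rfl
    rw [e, e]
    exact hom_ext' fun U x => Prod.ext (add_zero _) (zero_add _)
  exact Hom.ext h h

end Curved

/-! ### The Atiyah resolution of the complex of endomorphisms -/

/-- The morphism `At(E) ⊗ E^∨ → Hom(E, E)` induced by the augmentation. -/
def atiyahToEnd {w : GlobalFun O} (n : ℕ) (E : Curved w) :
    Curved.tensor (atiyah n E) E.dual ⟶ Curved.homC E E :=
  Curved.tensorMap (atiyahAug n E) E.dual ≫ Curved.can E E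

lemma barToAtiyah_toEnd {w : GlobalFun O} (n : ℕ) (E : Curved w) :
    Curved.tensorMap (barToAtiyah n E) E.dual ≫ atiyahToEnd n E = barToEnd E := by
  rw [atiyahToEnd, ← Category.assoc, ← Curved.tensorMap_comp, barToAtiyah_aug]
  rfl

lemma atiyahSec_toEnd {w : GlobalFun O} (n : ℕ) (E : Curved w) (s : E ⟶ atiyah n E)
    (hs : s ≫ atiyahAug n E = 𝟙 E) :
    Curved.tensorMap s E.dual ≫ atiyahToEnd n E = Curved.can E E := by
  rw [atiyahToEnd, ← Category.assoc, ← Curved.tensorMap_comp, hs, Curved.tensorMap_id,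
    Category.id_comp]

end

end CurvedSheaf

namespace CurvedSheaf

noncomputable section

open PMod AlgebraicGeometry

/-! ### Localization of modules -/

section Algebra

variable {R : Type u} [CommRing R]

lemma ideal_eq_top_of_pow_mem {I : Ideal R} {s : Set R} (hs : Ideal.span s = ⊤)
    (h : ∀ f ∈ s, ∃ m : ℕ, f ^ m ∈ I) : I = ⊤ := by
  rw [← Ideal.radical_eq_top, ← top_le_iff, ← hs, Ideal.span_le]
  exact h

lemma mem_of_pow_smul_mem {M : Type u} [AddCommGroup M] [Module R M] (P : Submodule R M)
    {s : Set R} (hs : Ideal.span s = ⊤) (x : M) (h : ∀ f ∈ s, ∃ m : ℕ, f ^ m • x ∈ P) : x ∈ P := by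
  have h1 : (1 : R) ∈ P.comap (LinearMap.toSpanSingleton R M x) := by
    rw [ideal_eq_top_of_pow_mem (I := P.comap (LinearMap.toSpanSingleton R M x)) hs h]
    trivial
  simpa using h1

variable {R' M M' : Type u} [CommRing R'] [Algebra R R'] [AddCommGroup M] [AddCommGroup M']
  [Module R M] [Module R M'] [Module R' M'] [IsScalarTower R R' M']

/-- A map which is locally a localization, on source and target, is a base change. -/
lemma liftBaseChange_bijective (g : M →ₗ[R] M') (s : Set R)
    (hs : Ideal.span (algebraMap R R' '' s) = ⊤)
    (ha : ∀ a : R', ∀ f ∈ s, ∃ (m : ℕ) (r : R), algebraMap R R' r = f ^ m • a)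
    (hb : ∀ y : M', ∀ f ∈ s, ∃ (m : ℕ) (x : M), g x = f ^ m • y)
    (hc : ∀ x : M, g x = 0 → ∀ f ∈ s, ∃ m : ℕ, f ^ m • x = 0) :
    Function.Bijective (g.liftBaseChange R') := by
  have hpow : ∀ (f : R) (m : ℕ) (N : Type u) [AddCommGroup N] [Module R N] [Module R' N]
      [IsScalarTower R R' N] (y : N), algebraMap R R' f ^ m • y = f ^ m • y :=
    fun f m N _ _ _ _ y => by rw [← map_pow, algebraMap_smul]
  constructor
  · refine (injective_iff_map_eq_zero _).2 fun t ht => ?_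
    have key : ∀ f ∈ s, ∃ (m : ℕ) (x : M), f ^ m • t = 1 ⊗ₜ[R] x := by
      intro f hf
      clear ht
      induction t using TensorProduct.induction_on with
      | zero => exact ⟨0, 0, by simp⟩
      | tmul a x =>
        obtain ⟨m, r, hr⟩ := ha a f hf
        refine ⟨m, r • x, ?_⟩
        rw [TensorProduct.smul_tmul', ← hr, ← TensorProduct.smul_tmul, Algebra.smul_def, mul_one]
      | add t t' h h' =>
        obtain ⟨m, x, hx⟩ := h
        obtain ⟨m', x', hx'⟩ := h'
        refine ⟨m + m', f ^ m' • x + f ^ m • x', ?_⟩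
        rw [smul_add, add_comm m m', pow_add, mul_smul, hx, mul_comm, mul_smul, hx',
          TensorProduct.tmul_add, TensorProduct.tmul_smul, TensorProduct.tmul_smul]
    refine mem_of_pow_smul_mem ⊥ hs t ?_
    rintro _ ⟨f, hf, rfl⟩
    obtain ⟨m, x, hx⟩ := key f hf
    have h1 : g x = 0 := by
      have h2 : g.liftBaseChange R' (algebraMap R R' f ^ m • t) = 0 := by
        rw [map_smul, ht, smul_zero]
      rw [show algebraMap R R' f ^ m • t = f ^ m • t from hpow f m _ t, hx,
        LinearMap.liftBaseChange_tmul, one_smul] at h2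
      exact h2
    obtain ⟨l, hl⟩ := hc x h1 f hf
    refine ⟨l + m, ?_⟩
    rw [show algebraMap R R' f ^ (l + m) • t = f ^ (l + m) • t from hpow f _ _ t, pow_add, mul_smul,
      hx, ← TensorProduct.tmul_smul, hl, TensorProduct.tmul_zero]
    exact Submodule.zero_mem _
  · intro y
    refine mem_of_pow_smul_mem (LinearMap.range (g.liftBaseChange R')) hs y ?_
    rintro _ ⟨f, hf, rfl⟩
    obtain ⟨m, x, hx⟩ := hb y f hf
    exact ⟨m, 1 ⊗ₜ x, by rw [LinearMap.liftBaseChange_tmul, one_smul, hx, hpow]⟩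

/-- Localization commutes with tensor products: the kernel of `M ⊗ N → M_f ⊗ N_f`. -/
lemma exists_pow_smul_tensor_eq_zero {N N' : Type u} [AddCommGroup N] [AddCommGroup N']
    [Module R N] [Module R N'] [Module R' N'] [IsScalarTower R R' N'] (f : R)
    [IsLocalization.Away f R'] (g : M →ₗ[R] M') (h : N →ₗ[R] N')
    [IsLocalizedModule (Submonoid.powers f) g] [IsLocalizedModule (Submonoid.powers f) h]
    (T : M ⊗[R] N →+ M' ⊗[R'] N') (hT : ∀ a b, T (a ⊗ₜ b) = g a ⊗ₜ h b) (t : M ⊗[R] N)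
    (ht : T t = 0) : ∃ m : ℕ, f ^ m • t = 0 := by
  have e : (IsLocalization.moduleTensorEquiv (Submonoid.powers f) R' M' N') (T t) =
      TensorProduct.map g h t := by
    clear ht
    induction t using TensorProduct.induction_on with
    | zero => simp
    | tmul a b => rw [hT]; rfl
    | add a b ha hb => rw [map_add, map_add, map_add, ha, hb]
  rw [ht, map_zero] at e
  obtain ⟨⟨_, m, rfl⟩, hc⟩ :=
    (IsLocalizedModule.eq_zero_iff (Submonoid.powers f) (TensorProduct.map g h)).1 e.symm
  exact ⟨m, hc⟩

/-- Elements of an exterior power are detected by the determinants of a dual basis. -/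
lemma exteriorPower_eq_zero {m : ℕ} (e : Fin m → M) (ξ : Fin m → Module.Dual R M)
    (h : ∀ x, ∑ i, ξ i x • e i = x) (q : ℕ) (x : ⋀[R]^q M)
    (hx : ∀ I : Fin q → Fin m,
      exteriorPower.pairingDual R M q (exteriorPower.ιMulti R q (ξ ∘ I)) x = 0) : x = 0 := by
  let s : M →ₗ[R] (Fin m → R) := LinearMap.pi ξ
  let p : (Fin m → R) →ₗ[R] M := Fintype.linearCombination R e
  have hps : p ∘ₗ s = LinearMap.id := LinearMap.ext fun y => by
    simpa [p, s, Fintype.linearCombination_apply] using h y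
  have h1 : exteriorPower.map q p (exteriorPower.map q s x) = x := by
    rw [← LinearMap.comp_apply, ← exteriorPower.map_comp, hps, exteriorPower.map_id]
    rfl
  have h2 : exteriorPower.map q s x = 0 := by
    refine ((Pi.basisFun R (Fin m)).exteriorPower q).ext_elem fun I => ?_
    rw [map_zero, Finsupp.zero_apply, exteriorPower.basis_repr_apply,
      ← hx (Set.powersetCard.ofFinEmbEquiv.symm I)]
    refine LinearMap.congr_fun (f := (exteriorPower.ιMultiDual R q (Pi.basisFun R (Fin m)) I) ∘ₗ
      exteriorPower.map q s) ?_ x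
    refine exteriorPower.linearMap_ext (AlternatingMap.ext fun v => ?_)
    simp [s, exteriorPower.pairingDual_ιMulti_ιMulti]
  rw [← h1, h2, map_zero]

/-- An exterior product of more elements than there are generators vanishes. -/
lemma ιMulti_eq_zero_of_span {q d : ℕ} (hd : d < q) (v : Fin q → M) (g : Fin d → M)
    (hv : ∀ i, v i ∈ Submodule.span R (Set.range g)) : exteriorPower.ιMulti R q v = 0 := by
  let p : (Fin d → R) →ₗ[R] M := Fintype.linearCombination R g
  have hp : ∀ i, ∃ y, p y = v i := fun i => by
    have h := hv i
    rw [← Fintype.range_linearCombination R g] at h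
    exact h
  choose y hy using hp
  have h1 : exteriorPower.ιMulti R q v = exteriorPower.map q p (exteriorPower.ιMulti R q y) := by
    rw [exteriorPower.map_apply_ιMulti]
    congr 1
    exact funext fun i => (hy i).symm
  have h2 : exteriorPower.ιMulti R q y = 0 := by
    refine ((Pi.basisFun R (Fin d)).exteriorPower q).ext_elem fun I => ?_
    exfalso
    have h3 := Finset.card_le_univ (I : Finset (Fin d))
    have h4 := I.2
    rw [Set.powersetCard.mem_iff] at h4
    rw [h4, Fintype.card_fin] at h3
    omega
  rw [h1, h2, map_zero]

end Algebra

variable {k : Type u} [Field k] {X : Scheme.{u}} [X.Over (Spec (.of k))]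

/-! ### Quasi-coherent presheaves of modules on the affine opens -/

/-- The open `D(f)` in `U`. -/
abbrev bas (U : X.affineOpens) (f : (affO k X).ring U) : X.affineOpens :=
  X.affineBasicOpen (U := U) (show Γ(X, U.1) from f)

lemma bas_le (U : X.affineOpens) (f : (affO k X).ring U) : bas U f ≤ U := X.affineBasicOpen_le _

lemma isLocalization_bas (U : X.affineOpens) (f : (affO k X).ring U) :
    letI := ((affO k X).res (bas_le U f)).toRingHom.toAlgebra
    IsLocalization.Away f ((affO k X).ring (bas U f)) :=
  U.2.isLocalization_basicOpen (show Γ(X, U.1) from f)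

lemma bas_res {U V : X.affineOpens} (h : V ≤ U) (f : (affO k X).ring U) (hf : bas U f ≤ V) :
    bas V ((affO k X).res h f) = bas U f :=
  Subtype.ext ((X.basicOpen_res (show Γ(X, U.1) from f) (homOfLE h).op).trans
    (inf_eq_right.2 hf))

/-- The localization property at `D(f)`, for `f` on a larger affine open `U` with `D(f) ⊆ V`. -/
lemma IsQCoh.exists_pow_smul_eq_zero {M : PMod (affO k X)} (hM : IsQCoh M) {U V : X.affineOpens}
    (h : V ≤ U) (f : (affO k X).ring U) (hf : bas U f ≤ V) (x : M.obj V) (hx : M.res hf x = 0) :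
    ∃ m : ℕ, (affO k X).res h f ^ m • x = 0 := by
  refine (hM V ((affO k X).res h f)).1 x ?_
  have h1 : bas V ((affO k X).res h f) ≤ bas U f := (bas_res h f hf).le
  refine (M.res_comp hf h1 x).symm.trans ?_
  rw [hx, map_zero]

/-- A section over `V ⊆ U` extends to `U` after multiplication by a power of `f`, if
`D(f) ⊆ V`. -/
lemma IsQCoh.exists_res_eq {M : PMod (affO k X)} (hM : IsQCoh M) {U V : X.affineOpens}
    (h : V ≤ U) (f : (affO k X).ring U) (hf : bas U f ≤ V) (y : M.obj V) :
    ∃ (m : ℕ) (x : M.obj U), M.res h x = (affO k X).res h f ^ m • y := by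
  obtain ⟨m, x, hx⟩ := (hM U f).2 (M.res hf y)
  have h1 : M.res hf (M.res h x - (affO k X).res h f ^ m • y) = 0 := by
    rw [map_sub, M.res_comp, M.res_smul, map_pow, (affO k X).res_comp, sub_eq_zero]
    refine hx.trans ?_
    rw [← map_pow]
    rfl
  obtain ⟨l, hl⟩ := hM.exists_pow_smul_eq_zero h f hf _ h1
  refine ⟨l + m, f ^ l • x, ?_⟩
  rw [M.res_smul, map_pow, pow_add, mul_smul, ← sub_eq_zero, ← smul_sub, hl]

lemma isQCoh_unit : IsQCoh (unit (affO k X)) := by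
  intro U (f : (affO k X).ring U)
  let _ := ((affO k X).res (bas_le U f)).toRingHom.toAlgebra
  have hl := isLocalization_bas U f
  constructor
  · intro x hx
    obtain ⟨⟨_, m, rfl⟩, hc⟩ := (IsLocalization.map_eq_zero_iff (Submonoid.powers f)
      ((affO k X).ring (bas U f)) (show (affO k X).ring U from x)).1 hx
    exact ⟨m, hc⟩
  · intro y
    obtain ⟨⟨x, _, m, rfl⟩, hc⟩ := IsLocalization.surj (Submonoid.powers f)
      (show (affO k X).ring (bas U f) from y)
    exact ⟨m, x, hc.symm.trans (mul_comm _ _)⟩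

/-- A smaller affine open is covered by open sets which are basic in both. -/
lemma exists_bas_cover {U V : X.affineOpens} (h : V ≤ U) :
    ∃ s : Set ((affO k X).ring U), (∀ f ∈ s, bas U f ≤ V) ∧
      Ideal.span ((affO k X).res h '' s) = ⊤ := by
  refine ⟨{f | bas U f ≤ V}, fun f hf => hf, ?_⟩
  refine (V.2.self_le_iSup_basicOpen_iff (s := (affO k X).res h '' {f | bas U f ≤ V})).1 ?_
  intro x hx
  obtain ⟨f, hf, hxf⟩ := U.2.exists_basicOpen_le (V := V.1) ⟨x, hx⟩ (h hx)
  rw [TopologicalSpace.Opens.mem_iSup]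
  refine ⟨⟨(affO k X).res h f, f, hf, rfl⟩, ?_⟩
  have h1 : X.basicOpen ((X.presheaf.map (homOfLE h).op).hom f) = V.1 ⊓ X.basicOpen f :=
    X.basicOpen_res f (homOfLE h).op
  change x ∈ X.basicOpen ((X.presheaf.map (homOfLE h).op).hom f)
  rw [h1]
  exact ⟨hx, hxf⟩

section Extend

variable {M : PMod (affO k X)} {U V : X.affineOpens}

/-- The sections of a quasi-coherent presheaf over a smaller affine open are obtained by base
change. -/
lemma IsQCoh.bijective_liftBaseChange (hM : IsQCoh M) (h : V ≤ U) :
    letI := ((affO k X).res h).toRingHom.toAlgebra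
    letI : Module ((affO k X).ring U) (M.obj V) :=
      Module.compHom _ ((affO k X).res h).toRingHom
    haveI : IsScalarTower ((affO k X).ring U) ((affO k X).ring V) (M.obj V) :=
      ⟨fun a b x => mul_smul ((affO k X).res h a) b x⟩
    Function.Bijective (LinearMap.liftBaseChange ((affO k X).ring V)
      ({ toFun := M.res h, map_add' := map_add _, map_smul' := M.res_smul h } :
        M.obj U →ₗ[(affO k X).ring U] M.obj V)) := by
  let _ := ((affO k X).res h).toRingHom.toAlgebra
  let _ : Module ((affO k X).ring U) (M.obj V) := Module.compHom _ ((affO k X).res h).toRingHom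
  have _ : IsScalarTower ((affO k X).ring U) ((affO k X).ring V) (M.obj V) :=
    ⟨fun a b x => mul_smul ((affO k X).res h a) b x⟩
  obtain ⟨s, hs, hspan⟩ := exists_bas_cover (k := k) h
  have hp : ∀ (f : (affO k X).ring U) (m : ℕ) (y : M.obj V),
      (affO k X).res h f ^ m • y = f ^ m • y := fun f m y => by
    rw [← map_pow]
    rfl
  have hp' : ∀ (f : (affO k X).ring U) (m : ℕ) (y : (affO k X).ring V),
      (affO k X).res h f ^ m * y = f ^ m • y := fun f m y => by
    rw [← map_pow]
    rfl
  refine liftBaseChange_bijective _ s hspan (fun a f hf => ?_) (fun y f hf => ?_)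
    fun x hx f hf => ?_
  · obtain ⟨m, r, hr⟩ := IsQCoh.exists_res_eq (M := unit (affO k X)) isQCoh_unit h f (hs f hf) a
    exact ⟨m, r, hr.trans (hp' f m a)⟩
  · obtain ⟨m, x, hx⟩ := hM.exists_res_eq h f (hs f hf) y
    exact ⟨m, x, hx.trans (hp f m y)⟩
  · refine (hM U f).1 x ?_
    have h1 : M.res h x = 0 := hx
    rw [← M.res_comp h (hs f hf), h1, map_zero]

lemma IsQCoh.span_res (hM : IsQCoh M) (h : V ≤ U) (y : M.obj V) :
    y ∈ Submodule.span ((affO k X).ring V) (Set.range (M.res h)) := by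
  let _ := ((affO k X).res h).toRingHom.toAlgebra
  let _ : Module ((affO k X).ring U) (M.obj V) := Module.compHom _ ((affO k X).res h).toRingHom
  have _ : IsScalarTower ((affO k X).ring U) ((affO k X).ring V) (M.obj V) :=
    ⟨fun a b x => mul_smul ((affO k X).res h a) b x⟩
  obtain ⟨t, rfl⟩ := (hM.bijective_liftBaseChange h).2 y
  induction t using TensorProduct.induction_on with
  | zero => rw [map_zero]; exact Submodule.zero_mem _
  | tmul a x =>
    rw [LinearMap.liftBaseChange_tmul]
    exact Submodule.smul_mem _ _ (Submodule.subset_span ⟨x, rfl⟩)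
  | add s t hs ht => rw [map_add]; exact Submodule.add_mem _ hs ht

/-- The extension of a functional to a smaller affine open. -/
lemma IsQCoh.exists_extend (hM : IsQCoh M) (h : V ≤ U)
    (ξ : M.obj U →ₗ[(affO k X).ring U] (affO k X).ring U) :
    ∃ ξ' : M.obj V →ₗ[(affO k X).ring V] (affO k X).ring V,
      ∀ x, ξ' (M.res h x) = (affO k X).res h (ξ x) := by
  let _ := ((affO k X).res h).toRingHom.toAlgebra
  let _ : Module ((affO k X).ring U) (M.obj V) := Module.compHom _ ((affO k X).res h).toRingHom
  have _ : IsScalarTower ((affO k X).ring U) ((affO k X).ring V) (M.obj V) :=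
    ⟨fun a b x => mul_smul ((affO k X).res h a) b x⟩
  let g : M.obj U →ₗ[(affO k X).ring U] M.obj V :=
    { toFun := M.res h, map_add' := map_add _, map_smul' := M.res_smul h }
  let e := LinearEquiv.ofBijective (g.liftBaseChange ((affO k X).ring V))
    (hM.bijective_liftBaseChange h)
  refine ⟨((Algebra.linearMap ((affO k X).ring U) ((affO k X).ring V)).comp ξ).liftBaseChange
    ((affO k X).ring V) ∘ₗ e.symm.toLinearMap, fun x => ?_⟩
  have h1 : e.symm (M.res h x) = 1 ⊗ₜ x := by
    rw [LinearEquiv.symm_apply_eq]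
    have h2 : e (1 ⊗ₜ x) = (1 : (affO k X).ring V) • g x :=
      LinearMap.liftBaseChange_tmul (l := g) ..
    exact (h2.trans (one_smul _ _)).symm
  rw [LinearMap.comp_apply, LinearEquiv.coe_coe, h1, LinearMap.liftBaseChange_tmul, one_smul]
  rfl

end Extend

/-- A dual basis of the module of sections over `U` extends to the affine opens below `U`. -/
lemma IsVectorBundle.nonempty_dualBasis {M : PMod (affO k X)} (hM : IsVectorBundle M)
    (U : X.affineOpens) : Nonempty (DualBasis M U) := by
  have hf := (hM.2 U).1
  have hp := (hM.2 U).2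
  obtain ⟨m, p, s, -, -, hps⟩ := Module.Finite.exists_comp_eq_id_of_projective
    ((affO k X).ring U) (M.obj U)
  let e : Fin m → M.obj U := fun i => p (Pi.single i 1)
  let ξ : Fin m → (M.obj U →ₗ[(affO k X).ring U] (affO k X).ring U) := fun i =>
    LinearMap.proj i ∘ₗ s
  have hsum : ∀ x, ∑ i, ξ i x • e i = x := fun x => by
    have h1 : p (s x) = x := LinearMap.congr_fun hps x
    conv_rhs => rw [← h1, ← Finset.univ_sum_single (s x), map_sum]
    refine Finset.sum_congr rfl fun i _ => ?_
    change s x i • p (Pi.single i 1) = _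
    rw [← map_smul]
    congr 1
    rw [← Pi.single_smul, smul_eq_mul, mul_one]
  choose ξ' hξ' using fun (i : Fin m) (V : X.affineOpens) (h : V ≤ U) => hM.1.exists_extend h (ξ i)
  refine ⟨⟨m, e, fun i => imk U (fun V h => ξ' i V h) fun {V W} h h' x => ?_, fun V h x => ?_⟩⟩
  · change ξ' i W _ (M.res h' x) = (affO k X).res h' (ξ' i V h x)
    induction hM.1.span_res h x using Submodule.span_induction with
    | mem x hx =>
      obtain ⟨y, rfl⟩ := hx
      rw [M.res_comp, hξ', hξ', (affO k X).res_comp]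
    | zero => rw [map_zero, map_zero, map_zero, map_zero]
    | add x y _ _ hx hy => rw [map_add, map_add, map_add, map_add, hx, hy]
    | smul a x _ hx => rw [M.res_smul, map_smul, map_smul, hx, smul_eq_mul, smul_eq_mul, map_mul]
  · change ∑ i, ξ' i V h x • M.res h (e i) = x
    induction hM.1.span_res h x using Submodule.span_induction with
    | mem x hx =>
      obtain ⟨y, rfl⟩ := hx
      conv_rhs => rw [← hsum y, map_sum]
      exact Finset.sum_congr rfl fun i _ => by rw [hξ', M.res_smul]
    | zero => simp
    | add x y _ _ hx hy => simp only [map_add, add_smul, Finset.sum_add_distrib, hx, hy]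
    | smul a x _ hx =>
      simp only [map_smul, smul_eq_mul, mul_smul, ← Finset.smul_sum, hx]

/-! ### Permanence properties of quasi-coherence -/

/-- The defining property of quasi-coherence, for one open `D(f)`. -/
def IsQCohAt (M : PMod (affO k X)) (U : X.affineOpens) (f : (affO k X).ring U) : Prop :=
  (∀ x : M.obj U, M.res (bas_le U f) x = 0 → ∃ m : ℕ, f ^ m • x = 0) ∧
    ∀ y : M.obj (bas U f), ∃ (m : ℕ) (x : M.obj U),
      M.res (bas_le U f) x = (affO k X).res (bas_le U f) (f ^ m) • y

lemma isQCoh_iff {M : PMod (affO k X)} : IsQCoh M ↔ ∀ U f, IsQCohAt M U f := Iff.rfl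

lemma IsQCoh.of_retract {M N : PMod (affO k X)} (hN : IsQCoh N) (s : M ⟶ N) (r : N ⟶ M)
    (h : s ≫ r = 𝟙 M) : IsQCoh M := isQCoh_iff.2 fun U f => by
  have hrs : ∀ V x, r.app V (s.app V x) = x := fun V x =>
    congrArg (fun q : M ⟶ M => q.app V x) h
  constructor
  · intro x hx
    obtain ⟨m, hm⟩ := (isQCoh_iff.1 hN U f).1 (s.app U x) (by rw [← hom_nat, hx, map_zero])
    exact ⟨m, by rw [← hrs U (f ^ m • x), map_smul, hm, map_zero]⟩
  · intro y
    obtain ⟨m, x, hx⟩ := (isQCoh_iff.1 hN U f).2 (s.app _ y)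
    exact ⟨m, r.app U x, by rw [← hom_nat, hx, map_smul, hrs]⟩

lemma IsQCoh.of_subsingleton {M : PMod (affO k X)} (h : ∀ U, Subsingleton (M.obj U)) : IsQCoh M :=
  isQCoh_iff.2 fun U f =>
    ⟨fun x _ => ⟨0, Subsingleton.elim _ _⟩, fun y => ⟨0, 0, Subsingleton.elim _ _⟩⟩

lemma isQCoh_zero : IsQCoh (zero (affO k X)) :=
  IsQCoh.of_subsingleton fun _ => inferInstanceAs (Subsingleton PUnit)

lemma IsQCoh.prod {M N : PMod (affO k X)} (hM : IsQCoh M) (hN : IsQCoh N) :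
    IsQCoh (prod M N) := isQCoh_iff.2 fun U f => by
  constructor
  · intro x hx
    obtain ⟨m, hm⟩ := (isQCoh_iff.1 hM U f).1 x.1 (congrArg Prod.fst hx)
    obtain ⟨l, hl⟩ := (isQCoh_iff.1 hN U f).1 x.2 (congrArg Prod.snd hx)
    refine ⟨m + l, Prod.ext ?_ ?_⟩
    · change f ^ (m + l) • x.1 = 0
      rw [pow_add, mul_comm, mul_smul, hm, smul_zero]
    · change f ^ (m + l) • x.2 = 0
      rw [pow_add, mul_smul, hl, smul_zero]
  · intro y
    obtain ⟨m, a, ha⟩ := (isQCoh_iff.1 hM U f).2 y.1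
    obtain ⟨l, b, hb⟩ := (isQCoh_iff.1 hN U f).2 y.2
    refine ⟨m + l, (f ^ l • a, f ^ m • b), Prod.ext ?_ ?_⟩
    · refine (M.res_smul (bas_le U f) (f ^ l) a).trans ?_
      rw [ha, smul_smul, ← map_mul, ← pow_add, add_comm l m]
      rfl
    · refine (N.res_smul (bas_le U f) (f ^ m) b).trans ?_
      rw [hb, smul_smul, ← map_mul, ← pow_add]
      rfl

/-- A product of quasi-coherent presheaves, almost all of which vanish, is quasi-coherent. -/
lemma IsQCoh.pi {F : ℕ → PMod (affO k X)} (hF : ∀ j, IsQCoh (F j)) (n : ℕ)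
    (h0 : ∀ j, n ≤ j → ∀ U, Subsingleton ((F j).obj U)) : IsQCoh (pi F) := by
  refine isQCoh_iff.2 fun U f => ?_
  constructor
  · intro x hx
    choose m hm using fun j => (isQCoh_iff.1 (hF j) U f).1 (x j) (congrFun hx j)
    refine ⟨(Finset.range n).sup m, funext fun j => ?_⟩
    change f ^ ((Finset.range n).sup m) • x j = 0
    by_cases hj : n ≤ j
    · exact (h0 j hj U).elim _ _
    · have h1 : m j ≤ (Finset.range n).sup m := Finset.le_sup (Finset.mem_range.2 (not_le.1 hj))
      rw [← Nat.sub_add_cancel h1, pow_add, mul_smul, hm, smul_zero]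
  · intro y
    choose m x hx using fun j => (isQCoh_iff.1 (hF j) U f).2 (y j)
    refine ⟨(Finset.range n).sup m, fun j => f ^ ((Finset.range n).sup m - m j) • x j,
      funext fun j => ?_⟩
    change (F j).res (bas_le U f) (f ^ ((Finset.range n).sup m - m j) • x j) =
      (affO k X).res (bas_le U f) (f ^ ((Finset.range n).sup m)) • y j
    by_cases hj : n ≤ j
    · exact (h0 j hj _).elim _ _
    · have h1 : m j ≤ (Finset.range n).sup m := Finset.le_sup (Finset.mem_range.2 (not_le.1 hj))
      rw [(F j).res_smul, hx, smul_smul, ← map_mul, ← pow_add, Nat.sub_add_cancel h1]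

lemma IsQCoh.tens {M N : PMod (affO k X)} (hM : IsQCoh M) (hN : IsQCoh N) :
    IsQCoh (tens M N) := isQCoh_iff.2 fun U f => by
  constructor
  · intro t ht
    let _ := ((affO k X).res (bas_le U f)).toRingHom.toAlgebra
    have hl := isLocalization_bas U f
    let inst : ∀ K : PMod (affO k X), Module ((affO k X).ring U) (K.obj (bas U f)) := fun K =>
      Module.compHom _ ((affO k X).res (bas_le U f)).toRingHom
    have _ : ∀ K : PMod (affO k X), IsScalarTower ((affO k X).ring U) ((affO k X).ring (bas U f))
        (K.obj (bas U f)) := fun K => ⟨fun a b x => mul_smul ((affO k X).res (bas_le U f) a) b x⟩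
    let g : ∀ K : PMod (affO k X), K.obj U →ₗ[(affO k X).ring U] K.obj (bas U f) := fun K =>
      { toFun := K.res (bas_le U f), map_add' := map_add _, map_smul' := K.res_smul (bas_le U f) }
    have hloc : ∀ K : PMod (affO k X), IsQCoh K →
        IsLocalizedModule (Submonoid.powers f) (g K) := fun K hK =>
      { map_units := fun s => by
          have h1 : IsUnit (algebraMap ((affO k X).ring U) ((affO k X).ring (bas U f)) s) :=
            IsLocalization.map_units _ s
          have h2 := h1.map (algebraMap ((affO k X).ring (bas U f))
            (Module.End ((affO k X).ring (bas U f)) (K.obj (bas U f))))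
          rw [Module.End.isUnit_iff] at h2 ⊢
          exact h2
        surj := fun y => by
          obtain ⟨m, x, hx⟩ := (isQCoh_iff.1 hK U f).2 y
          exact ⟨(x, ⟨f ^ m, m, rfl⟩), hx.symm⟩
        exists_of_eq := fun {x y} hxy => by
          obtain ⟨m, hm⟩ := (isQCoh_iff.1 hK U f).1 (x - y) (by
            rw [map_sub, sub_eq_zero]
            exact hxy)
          exact ⟨⟨f ^ m, m, rfl⟩, sub_eq_zero.1 ((smul_sub (f ^ m) x y).symm.trans hm)⟩ }
    have _ := hloc M hM
    have _ := hloc N hN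
    exact exists_pow_smul_tensor_eq_zero f (g M) (g N) ((PMod.tens M N).res (bas_le U f))
      (fun _ _ => rfl) t ht
  · intro t
    refine tens_induction (p := fun t => ∃ (m : ℕ) (x : (PMod.tens M N).obj U),
      (PMod.tens M N).res (bas_le U f) x = (affO k X).res (bas_le U f) (f ^ m) • t) t
      (fun a b => ?_) ⟨0, 0, by rw [map_zero, smul_zero]⟩ fun s t ⟨m, x, hx⟩ ⟨l, y, hy⟩ => ?_
    · obtain ⟨m, x, hx⟩ := (isQCoh_iff.1 hM U f).2 a
      obtain ⟨l, y, hy⟩ := (isQCoh_iff.1 hN U f).2 b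
      exact ⟨m + l, tmk M N U x y, by
        rw [tens_res, hx, hy, tmk_smul_left, tmk_smul_right, smul_smul, ← map_mul, ← pow_add]⟩
    · exact ⟨m + l, f ^ l • x + f ^ m • y, by
        rw [map_add, (PMod.tens M N).res_smul, (PMod.tens M N).res_smul, hx, hy, smul_smul,
          smul_smul, ← map_mul, ← map_mul, ← pow_add, ← pow_add, add_comm l m, smul_add]⟩

lemma isQCoh_Om : IsQCoh (Om (affO k X)) := by
  refine isQCoh_iff.2 fun U f => ?_
  let _ := ((affO k X).res (bas_le U f)).toRingHom.toAlgebra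
  have _ : IsScalarTower k ((affO k X).ring U) ((affO k X).ring (bas U f)) :=
    IsScalarTower.of_algebraMap_eq fun c => (((affO k X).res (bas_le U f)).commutes c).symm
  have hl := isLocalization_bas U f
  have hm := KaehlerDifferential.isLocalizedModule_map k ((affO k X).ring U)
    ((affO k X).ring (bas U f)) (Submonoid.powers f)
  constructor
  · intro x hx
    obtain ⟨⟨_, m, rfl⟩, hc⟩ := (IsLocalizedModule.eq_zero_iff (Submonoid.powers f)
      (KaehlerDifferential.map k k ((affO k X).ring U) ((affO k X).ring (bas U f)))).1 hx
    exact ⟨m, hc⟩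
  · intro (y : Ω[(affO k X).ring (bas U f)⁄k])
    obtain ⟨⟨x, ⟨_, m, rfl⟩⟩, hc⟩ := IsLocalizedModule.surj (Submonoid.powers f)
      (KaehlerDifferential.map k k ((affO k X).ring U) ((affO k X).ring (bas U f))) y
    refine ⟨m, x, hc.symm.trans ?_⟩
    exact algebra_compatible_smul ((affO k X).ring (bas U f)) (f ^ m) y

/-- A connection splits the jets as `J¹(M) ≅ (Ω ⊗ M) ⊕ M`. -/
lemma Connection.isQCoh_jet {M : PMod (affO k X)} (c : Connection M) (hM : IsQCoh M) :
    IsQCoh (jet M) :=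
  ((isQCoh_Om.tens hM).prod hM).of_retract (pair c.retr (eps M))
    (fst _ _ ≫ iota M + snd _ _ ≫ c.sec) (by
      rw [Preadditive.comp_add, ← Category.assoc, ← Category.assoc, pair_fst, pair_snd,
        c.retr_iota])

lemma isQCoh_atObj : ∀ (n q : ℕ) {M : PMod (affO k X)} (_ : Connection M) (_ : IsQCoh M),
    IsQCoh (atObj n q M)
  | 0, 0, _, _, hM => hM
  | 0, _ + 1, _, _, _ => isQCoh_zero
  | _ + 1, 0, _, c, hM => c.isQCoh_jet hM
  | n + 1, q + 1, _, c, hM => isQCoh_Om.tens (isQCoh_atObj n q c hM)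

lemma atObj_subsingleton {C : Type u} [Preorder C] {O : AlgPresheaf k C} : ∀ (n q : ℕ) (_ : n < q)
    (M : PMod O) (U : C), Subsingleton ((atObj n q M).obj U)
  | 0, 0, h, _, _ => absurd h (lt_irrefl 0)
  | 0, _ + 1, _, _, _ => inferInstanceAs (Subsingleton PUnit)
  | _ + 1, 0, h, _, _ => absurd h (Nat.not_lt_zero _)
  | n + 1, q + 1, h, M, U => by
    have _ := atObj_subsingleton n q (Nat.lt_of_succ_lt_succ h) M U
    have h0 : ∀ t : (tens (Om O) (atObj n q M)).obj U, t = 0 := fun t =>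
      tens_induction (p := fun t => t = 0) t
        (fun a b => by rw [Subsingleton.elim b 0, tmk_zero_right]) rfl
        fun s t hs ht => by rw [hs, ht, add_zero]
    exact ⟨fun s t => (h0 s).trans (h0 t).symm⟩

lemma IsVectorBundle.isQCoh_ext {K : PMod (affO k X)} (hK : IsVectorBundle K) (q : ℕ) :
    IsQCoh (ext K q) := isQCoh_iff.2 fun U f => by
  constructor
  · intro x hx
    obtain ⟨b⟩ := hK.nonempty_dualBasis U
    -- The functional `v ↦ det (ξ_{I j} (v_i))` on `⋀^q K`, over the members below `U`.
    let D : ∀ (V : X.affineOpens) (h : V ≤ U) (I : Fin q → Fin b.card),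
        (ext K q).obj V →ₗ[(affO k X).ring V] (affO k X).ring V := fun V h I =>
      exteriorPower.pairingDual ((affO k X).ring V) (K.obj V) q
        (exteriorPower.ιMulti ((affO k X).ring V) q fun j => iapp (b.ξ (I j)) V h)
    have hD : ∀ V h I v, D V h I (emk q V v) =
        (Matrix.of fun i j => dapp (b.ξ (I j)) V h (v i)).det := fun V h I v =>
      exteriorPower.pairingDual_ιMulti_ιMulti _ _
    have hres : ∀ I, (affO k X).res (bas_le U f) (D U le_rfl I x) =
        D (bas U f) (bas_le U f) I ((ext K q).res (bas_le U f) x) := fun I =>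
      emk_induction (p := fun x => (affO k X).res (bas_le U f) (D U le_rfl I x) =
        D (bas U f) (bas_le U f) I ((ext K q).res (bas_le U f) x)) x
        (fun r v => by
          rw [(D U le_rfl I).map_smul, (ext K q).res_smul, (D _ _ I).map_smul, emk_res, hD, hD,
            smul_eq_mul, smul_eq_mul, map_mul, AlgHom.map_det]
          congr 2
          funext i j
          exact (dapp_res (b.ξ (I j)) le_rfl (bas_le U f) (v i)).symm)
        (by simp only [map_zero]) fun s t hs ht => by simp only [map_add, hs, ht]
    have h1 : ∀ I, ∃ m : ℕ, f ^ m * D U le_rfl I x = 0 := fun I =>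
      (isQCoh_iff.1 isQCoh_unit U f).1 (D U le_rfl I x)
        ((hres I).trans ((congrArg _ hx).trans (map_zero _)))
    choose m hm using h1
    refine ⟨Finset.univ.sup m, ?_⟩
    refine exteriorPower_eq_zero b.e (fun i => iapp (b.ξ i) U le_rfl) b.sum_self q _ fun I => ?_
    change D U le_rfl I (f ^ (Finset.univ.sup m) • x) = 0
    have h2 : m I ≤ Finset.univ.sup m := Finset.le_sup (Finset.mem_univ I)
    rw [map_smul, smul_eq_mul, ← Nat.sub_add_cancel h2, pow_add, mul_assoc, hm, mul_zero]
  · intro t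
    refine emk_induction (p := fun t => ∃ (m : ℕ) (x : (ext K q).obj U),
      (ext K q).res (bas_le U f) x = (affO k X).res (bas_le U f) (f ^ m) • t) t
      (fun r v => ?_) ⟨0, 0, by rw [map_zero, smul_zero]⟩ fun s t ⟨m, x, hx⟩ ⟨l, y, hy⟩ => ?_
    · obtain ⟨l, r', hr⟩ := (isQCoh_iff.1 isQCoh_unit U f).2 r
      choose m x hx using fun i => (isQCoh_iff.1 hK.1 U f).2 (v i)
      refine ⟨l + ∑ i, m i, (show (affO k X).ring U from r') • emk q U x, ?_⟩
      have h1 : emk q (bas U f) (fun i => (affO k X).res (bas_le U f) (f ^ m i) • v i) =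
          (∏ i, (affO k X).res (bas_le U f) (f ^ m i)) • emk q (bas U f) v :=
        (exteriorPower.ιMulti ((affO k X).ring (bas U f)) q (M := K.obj (bas U f))).map_smul_univ
          _ v
      have h2 : (affO k X).res (bas_le U f) (show (affO k X).ring U from r') =
          (affO k X).res (bas_le U f) (f ^ l) * r := hr
      rw [(ext K q).res_smul, emk_res, funext hx, h1, h2, smul_smul, smul_smul, ← map_prod,
        Finset.prod_pow_eq_pow_sum, pow_add, map_mul]
      congr 1
      ring
    · exact ⟨m + l, f ^ l • x + f ^ m • y, by
        rw [map_add, (ext K q).res_smul, (ext K q).res_smul, hx, hy, smul_smul,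
          smul_smul, ← map_mul, ← map_mul, ← pow_add, ← pow_add, add_comm l m, smul_add]⟩

/-! ### Differentials of a smooth scheme -/

lemma scalars_eq (U : X.Opens) : scalars (k := k) X U =
    ((X ↘ Spec (.of k)).appLE ⊤ U le_top).hom.comp (Scheme.ΓSpecIso (.of k)).inv.hom := rfl

lemma ΓSpecIso_inv_eq : (Scheme.ΓSpecIso (.of k)).inv.hom =
    (Scheme.ΓSpecIso (.of k)).commRingCatIsoToRingEquiv.symm.toRingHom := rfl

lemma smooth_ring [Smooth (X ↘ Spec (.of k))] (U : X.affineOpens) :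
    Algebra.Smooth k ((affO k X).ring U) := by
  have h1 := (X ↘ Spec (.of k)).smooth_appLE (isAffineOpen_top _) U.2 le_top
  have h2 : (scalars (k := k) X U.1).Smooth := by
    rw [scalars_eq, ΓSpecIso_inv_eq]
    exact RingHom.Smooth.respectsIso.2 _ _ h1
  exact h2

lemma isVectorBundle_Om [Smooth (X ↘ Spec (.of k))] : IsVectorBundle (Om (affO k X)) :=
  ⟨isQCoh_Om, fun U => by
    have _ := smooth_ring (k := k) U
    constructor
    · exact inferInstanceAs (Module.Finite ((affO k X).ring U) Ω[(affO k X).ring U⁄k])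
    · exact inferInstanceAs (Module.Projective ((affO k X).ring U) Ω[(affO k X).ring U⁄k])⟩

/-- Near a point at which `X` is smooth of relative dimension `d`, the algebra of functions is
standard smooth of relative dimension `d`. -/
lemma exists_isStandardSmooth {d : ℕ} {U : X.Opens}
    [SmoothOfRelativeDimension d (U.ι ≫ X ↘ Spec (.of k))] (W : X.affineOpens) {x : X}
    (hU : x ∈ U) (hW : x ∈ W.1) : ∃ f : (affO k X).ring W, x ∈ (bas W f).1 ∧
      Algebra.IsStandardSmoothOfRelativeDimension d k ((affO k X).ring (bas W f)) := by
  obtain ⟨S, hS, V, hV, hx, e, hf⟩ :=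
    SmoothOfRelativeDimension.exists_isStandardSmoothOfRelativeDimension (n := d)
      (f := U.ι ≫ X ↘ Spec (.of k)) ⟨x, hU⟩
  have e' : U.ι ''ᵁ V ≤ (X ↘ Spec (.of k)) ⁻¹ᵁ S := by
    rintro _ ⟨y, hy, rfl⟩
    exact e hy
  have hf' : RingHom.IsStandardSmoothOfRelativeDimension d
      ((X ↘ Spec (.of k)).appLE S (U.ι ''ᵁ V) e').hom := by
    have _ : IsIso (U.ι.appLE (U.ι ''ᵁ V) V (U.ι.preimage_image_eq _).ge) := by
      rw [← Scheme.Hom.appIso_hom']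
      infer_instance
    rw [← Scheme.Hom.appLE_comp_appLE _ _ S (U.ι ''ᵁ V) V e' (U.ι.preimage_image_eq _).ge,
      CommRingCat.hom_comp,
      RingHom.isStandardSmoothOfRelativeDimension_respectsIso.cancel_right_isIso] at hf
    exact hf
  have hx' : x ∈ U.ι ''ᵁ V := ⟨⟨x, hU⟩, hx, rfl⟩
  obtain ⟨r, s, hxs, es, hs⟩ := exists_basicOpen_le_appLE_of_appLE_of_isAffine
    (RingHom.isStandardSmoothOfRelativeDimension_stableUnderCompositionWithLocalizationAway d).right
    (RingHom.isStandardSmoothOfRelativeDimension_localizationPreserves d).away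
    x ⟨⊤, isAffineOpen_top _⟩ ⟨S, hS⟩ W ⟨U.ι ''ᵁ V, hV.image_of_isOpenImmersion _⟩ hW hx' e' hf'
    trivial
  refine ⟨s, hxs, ?_⟩
  -- The base `D(r)` of the standard smooth algebra is replaced by `Spec k`.
  have hl : IsLocalization.Away r Γ(Spec (.of k), (Spec (.of k)).basicOpen r) :=
    (isAffineOpen_top _).isLocalization_basicOpen r
  have h1 := (RingHom.isStandardSmoothOfRelativeDimension_stableUnderCompositionWithLocalizationAway
    d).left _ r _ hs
  have h2 : (scalars (k := k) X (X.basicOpen s)).IsStandardSmoothOfRelativeDimension d := by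
    rw [scalars_eq, ΓSpecIso_inv_eq]
    refine RingHom.isStandardSmoothOfRelativeDimension_respectsIso.2 _ _ ?_
    have h3 : (X ↘ Spec (.of k)).appLE ⊤ (X.basicOpen s) le_top =
        CommRingCat.ofHom
          (algebraMap Γ(Spec (.of k), ⊤) Γ(Spec (.of k), (Spec (.of k)).basicOpen r)) ≫
          (X ↘ Spec (.of k)).appLE ((Spec (.of k)).basicOpen r) (X.basicOpen s) es := by
      rw [RingHom.algebraMap_toAlgebra, CommRingCat.ofHom_hom, Scheme.Hom.map_appLE]
    rw [h3]
    exact h1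
  exact h2

/-- If `X` is smooth of relative dimension at most `n`, then `⋀^q Ω = 0` for `q > n`: locally `Ω` is
free of rank at most `n`, and `⋀^q Ω` is quasi-coherent. -/
lemma subsingleton_lam [Smooth (X ↘ Spec (.of k))] (n : ℕ)
    (hn : ∀ x : X, ∃ d ≤ n, ∃ U : X.Opens, x ∈ U ∧
      SmoothOfRelativeDimension d (U.ι ≫ X ↘ Spec (.of k))) (W : X.affineOpens) (q : ℕ)
    (hq : n < q) : Subsingleton ((lam (affO k X) q).obj W) := by
  have key : ∀ x : (lam (affO k X) q).obj W, x = 0 := fun t => by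
    have hcov : Ideal.span {f : (affO k X).ring W |
        Subsingleton ((lam (affO k X) q).obj (bas W f))} = ⊤ := by
      refine (W.2.self_le_iSup_basicOpen_iff (s := {f : (affO k X).ring W |
        Subsingleton ((lam (affO k X) q).obj (bas W f))})).1 fun x hx => ?_
      obtain ⟨d, hd, U, hU, hs⟩ := hn x
      obtain ⟨f, hf, hst⟩ := exists_isStandardSmooth (k := k) (d := d) W hU hx
      rw [TopologicalSpace.Opens.mem_iSup]
      refine ⟨⟨f, ?_⟩, hf⟩
      have _ : Nonempty (X.basicOpen (show Γ(X, W.1) from f)) := ⟨⟨x, hf⟩⟩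
      have _ : Nontrivial ((affO k X).ring (bas W f)) :=
        inferInstanceAs (Nontrivial Γ(X, X.basicOpen (show Γ(X, W.1) from f)))
      have _ := hst.isStandardSmooth
      have hr := Module.finrank_eq_of_rank_eq
        (Algebra.IsStandardSmoothOfRelativeDimension.rank_kaehlerDifferential (R := k)
          (S := (affO k X).ring (bas W f)) d)
      let b := Module.finBasisOfFinrankEq ((affO k X).ring (bas W f))
        (Ω[(affO k X).ring (bas W f)⁄k]) hr
      have h0 : ∀ y : (lam (affO k X) q).obj (bas W f), y = 0 := fun y =>
        emk_induction (p := fun y => y = 0) y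
          (fun r v => by
            have h1 : emk q (bas W f) v = 0 :=
              ιMulti_eq_zero_of_span (lt_of_le_of_lt hd hq) v b fun i => b.mem_span (v i)
            rw [h1, smul_zero]) rfl fun s t hs ht => by rw [hs, ht, add_zero]
      exact ⟨fun s t => (h0 s).trans (h0 t).symm⟩
    refine (Submodule.mem_bot ((affO k X).ring W)).1
      (mem_of_pow_smul_mem ⊥ hcov t fun f (hf : Subsingleton _) => ?_)
    obtain ⟨m, hm⟩ := (isQCoh_iff.1 ((isVectorBundle_Om (k := k)).isQCoh_ext q) W f).1 t
      (Subsingleton.elim _ _)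
    exact ⟨m, hm⟩
  exact ⟨fun s t => (key s).trans (key t).symm⟩

/-! ### Quasi-coherence and quasi-isomorphisms of the curved modules -/

lemma Mixed.qcoh_fold {w : GlobalFun (affO k X)} (m : Mixed w) (n : ℕ) (E : Curved w)
    (h0 : ∀ q, IsQCoh (m.obj q E.M0)) (h1 : ∀ q, IsQCoh (m.obj q E.M1))
    (hs : ∀ q, n < q → ∀ M U, Subsingleton ((m.obj q M).obj U)) : qcoh w (m.fold E) :=
  have ev : ∀ M : PMod (affO k X), (∀ q, IsQCoh (m.obj q M)) →
      IsQCoh (pi fun j => m.obj (2 * j) M) := fun M h =>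
    IsQCoh.pi (fun j => h _) (n + 1) fun j hj U => hs _ (by omega) M U
  have od : ∀ M : PMod (affO k X), (∀ q, IsQCoh (m.obj q M)) →
      IsQCoh (pi fun j => m.obj (2 * j + 1) M) := fun M h =>
    IsQCoh.pi (fun j => h _) (n + 1) fun j hj U => hs _ (by omega) M U
  ⟨(ev _ h0).prod (od _ h1), (ev _ h1).prod (od _ h0)⟩

lemma qcoh_cone {w : GlobalFun (affO k X)} {M N : Curved w} (f : M ⟶ N) (hM : qcoh w M)
    (hN : qcoh w N) : qcoh w (Curved.cone f) := ⟨hM.2.prod hN.1, hM.1.prod hN.2⟩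

lemma qcoh_atiyah {w : GlobalFun (affO k X)} (n : ℕ) (E : Curved w) (hE : qcoh w E)
    (c0 : Connection E.M0) (c1 : Connection E.M1) : qcoh w (atiyah n E) :=
  (atMixed w n).qcoh_fold n E (fun q => isQCoh_atObj n q c0 hE.1)
    (fun q => isQCoh_atObj n q c1 hE.2) fun q hq M U => atObj_subsingleton n q hq M U

lemma qcoh_omegaTensor [Smooth (X ↘ Spec (.of k))] {w : GlobalFun (affO k X)} (n : ℕ)
    (hΩ : ∀ q, n < q → ∀ U, Subsingleton ((lam (affO k X) q).obj U)) (E : Curved w)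
    (hE : qcoh w E) : qcoh w (omegaTensor E) :=
  (omegaMixed w).qcoh_fold n E (fun q => (isVectorBundle_Om.isQCoh_ext q).tens hE.1)
    (fun q => (isVectorBundle_Om.isQCoh_ext q).tens hE.2) fun q hq M U => by
      have _ := hΩ q hq U
      have h0 : ∀ t : (tens (lam (affO k X) q) M).obj U, t = 0 := fun t =>
        tens_induction (p := fun t => t = 0) t
          (fun a b => by rw [Subsingleton.elim a 0, tmk_zero_left]) rfl
          fun s t hs ht => by rw [hs, ht, add_zero]
      exact ⟨fun s t => (h0 s).trans (h0 t).symm⟩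

/-- A resolution of `E` with a contraction over every affine open induces a quasi-isomorphism
with values in the endomorphisms of a matrix factorization `E`. -/
lemma quasiIso_toEnd {w : GlobalFun (affO k X)} {E : Curved w} (hE : IsMatrixFactorization E)
    {R : Curved w} (f : R ⟶ E) (hr : ∀ U, Nonempty (Retraction (R.d0.app U) (R.d1.app U)
      (E.d0.app U) (E.d1.app U) (f.f0.app U) (f.f1.app U))) :
    quasiIso k X (Curved.tensorMap f E.dual ≫ Curved.can E E) := by
  have h0 := fun U => Curved.can_f0_bijective E (hE.1.nonempty_dualBasis U).some
    (hE.2.nonempty_dualBasis U).some E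
  have h1 := fun U => Curved.can_f1_bijective E (hE.1.nonempty_dualBasis U).some
    (hE.2.nonempty_dualBasis U).some E
  constructor
  · intro U s hs x hx
    obtain ⟨t, ht⟩ := Curved.cone_exact0 (Curved.tensorMap f E.dual) (Curved.can E E)
      ((hr U).some.tensor E.dual) (h0 U) (h1 U) s hs
    exact ⟨U, le_rfl, t, hx, ht.trans (PMod.res_id _ U s).symm⟩
  · intro U s hs x hx
    obtain ⟨t, ht⟩ := Curved.cone_exact1 (Curved.tensorMap f E.dual) (Curved.can E E)
      ((hr U).some.tensor E.dual) (h0 U) (h1 U) s hs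
    exact ⟨U, le_rfl, t, hx, ht.trans (PMod.res_id _ U s).symm⟩

lemma quasiIso_barToEnd {w : GlobalFun (affO k X)} {E : Curved w} (hE : IsMatrixFactorization E) :
    quasiIso k X (barToEnd E) :=
  quasiIso_toEnd hE (barAug E) fun U =>
    ⟨(barMixed w).retraction E (exists_barContraction w E.M0 (hE.1.2 U).2).some
      (exists_barContraction w E.M1 (hE.2.2 U).2).some⟩

lemma quasiIso_atiyahToEnd {w : GlobalFun (affO k X)} {E : Curved w}
    (hE : IsMatrixFactorization E) (n : ℕ) (c0 : Connection E.M0) (c1 : Connection E.M1) :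
    quasiIso k X (atiyahToEnd n E) :=
  quasiIso_toEnd hE (atiyahAug n E) fun U => ⟨atiyahRetraction n E c0 c1 U⟩

/-- The Chern character is computed by the resolution `At(E)` in place of the bar complex, where the
closed section of the augmentation lifts the identity of `E`. -/
lemma chern_eq {w : GlobalFun (affO k X)} (n : ℕ) {E : Curved w} (hE : IsMatrixFactorization E)
    (c0 : Connection E.M0) (c1 : Connection E.M1) (ψ : atiyah n E ⟶ omegaTensor E)
    (hq : quasiIso k X (barToEnd E))
    (hc : IsClosedFamily (m := barMixed w) (m' := omegaMixed w) (barExp n) E)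
    (hψ : barToAtiyah n E ≫ ψ = foldHom (m := barMixed w) (m' := omegaMixed w) (barExp n) E hc)
    (b0 : ∀ U, DualBasis E.M0 U) (b1 : ∀ U, DualBasis E.M1 U) :
    chern n E hq hc =
      (toDerived k X).map (Curved.traceHom E b0 b1 (atiyahSec n E c0 c1 ≫ ψ)) := by
  have _ : IsIso ((toDerived k X).map (barToEnd E)) := MorphismProperty.Q_inverts _ _ hq
  have _ : IsIso ((toDerived k X).map (atiyahToEnd n E)) :=
    MorphismProperty.Q_inverts _ _ (quasiIso_atiyahToEnd hE n c0 c1)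
  have hg : Curved.tensorMap (barToAtiyah n E) E.dual ≫ Curved.tensorMap ψ E.dual ≫ contrC E =
      barToForms n E hc := by
    rw [← Category.assoc, ← Curved.tensorMap_comp, hψ]
    rfl
  refine (roof_eq (toDerived k X) (t := Curved.tensorMap (barToAtiyah n E) E.dual)
    (c := Curved.coevC E b0 b1 ≫ Curved.tensorMap (atiyahSec n E c0 c1) E.dual)
    (g' := Curved.tensorMap ψ E.dual ≫ contrC E) (l' := atiyahToEnd n E)
    (barToAtiyah_toEnd n E) ?_ hg).trans ?_
  · rw [Category.assoc, atiyahSec_toEnd n E _ (atiyahSec_aug n E c0 c1), Curved.coevC_can]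
  · rw [Curved.traceHom, Curved.tensorMap_comp, Category.assoc, Category.assoc]

end

end CurvedSheaf

theorem mainTheorem6 {k : Type u} [Field k] (X : Scheme.{u}) [X.Over (Spec (.of k))]
    [IsNoetherian X] [Smooth (X ↘ Spec (.of k))] (n : ℕ)
    (hn : ∀ x : X, ∃ d ≤ n, ∃ U : X.Opens, x ∈ U ∧
      SmoothOfRelativeDimension d (U.ι ≫ X ↘ Spec (.of k)))
    (hk : (n.factorial : k) ≠ 0) (w : Γ(X, ⊤)) (E : Curved (globalFun k X w))
    (hE : IsMatrixFactorization E) (c0 : Connection E.M0) (c1 : Connection E.M1) :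
    ∃ φ : E ⟶ omegaTensor E, φ.f0 = expNabla0 n E c0 c1 ∧ φ.f1 = expNabla1 n E c0 c1 ∧
      (∃ (hQ : qcoh _ E) (hA : qcoh _ (atiyah n E)) (hT : qcoh _ (omegaTensor E))
          (hπ : Curved.IsCoacyclic (qcoh _) (Curved.cone (atiyahAug n E)))
          (hc : IsClosedFamily (m := atMixed _ n) (m' := omegaMixed _) (atExp n) E),
        expAt (qcoh _) n E hQ hA hT hπ hc =
          (Curved.toCoDer (qcoh _)).map (X := ⟨E, hQ⟩) (Y := ⟨omegaTensor E, hT⟩)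
            (ObjectProperty.homMk φ)) ∧
      ∃ (hq : quasiIso k X (barToEnd E))
        (hc : IsClosedFamily (m := barMixed _) (m' := omegaMixed _) (barExp n) E)
        (hs : ∀ {U V : X.affineOpens} (h : V ≤ U),
          (omegaC (globalFun k X w)).M0.res h (str φ.f0 φ.f1 U) = str φ.f0 φ.f1 V)
        (hd : ∀ U, (omegaC (globalFun k X w)).d0.app U (str φ.f0 φ.f1 U) = 0),
        chern n E hq hc = (toDerived k X).map
          (Curved.ofSection (N := omegaC (globalFun k X w)) (str φ.f0 φ.f1) hs hd) := by
  have hΩ : ∀ q, n < q → ∀ U, Subsingleton ((PMod.lam (affO k X) q).obj U) :=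
    fun q hq U => subsingleton_lam n hn U q hq
  have hE' : qcoh _ E := ⟨hE.1.1, hE.2.1⟩
  have hA : IsClosedFamily (m := atMixed _ n) (m' := omegaMixed _) (atExp n) E :=
    atExp_isClosedFamily _ n hk (hΩ (n + 1) n.lt_succ_self) E
  have b0 := fun U => (hE.1.nonempty_dualBasis U).some
  have b1 := fun U => (hE.2.nonempty_dualBasis U).some
  have hQA := qcoh_atiyah n E hE' c0 c1
  obtain ⟨φ, h0, h1, rfl⟩ := exists_expNabla n E c0 c1 hA
  refine ⟨_, h0, h1, ⟨hE', hQA, qcoh_omegaTensor n hΩ E hE', ?_, hA, ?_⟩,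
    quasiIso_barToEnd hE, barExp_isClosedFamily n E hA, Curved.str_res E b0 b1 _,
    Curved.str_closed E b0 b1 _, ?_⟩
  · exact isCoacyclic_cone_atiyahAug _ n E c0 c1 ⟨isQCoh_zero, isQCoh_zero⟩
      (qcoh_cone _ hQA hE')
  · exact expAt_eq _ n E _ _ _ _ hA _ (atiyahSec_aug n E c0 c1)
  · exact (chern_eq n hE c0 c1 _ _ _ (barToAtiyah_exp n E hA _) b0 b1).trans
      (congrArg _ (Curved.traceHom_eq E b0 b1 _ _ _))
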